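/- Let $d\in\{1,2,3\}$, let $\Omega\subset\mathbb R^d$ be a bounded domain (open and connected) with boundary of class $C^3$, and let $T>0$, $L,M,\alpha_\phi>0$, $\alpha_c\ge 0$ and $\phi_0,c_0\in L^2(\Omega)$. Let $\delta_0>0$ and, for $0<\delta<\delta_0$, let $J_\delta\in L^1(\mathbb R^d)$ be nonnegative, radial, supported in the closed ball $\overline{B_\delta(0)}$, with $\int_{\mathbb R^d}J_\delta(z)|z|^2\,dz=2d$ (for example the normalised top-hat kernel). Put $$(u,v)_{V_\delta}=\tfrac12\iint_{\Omega\times\Omega}J_\delta(x-y)\,[u(x)-u(y)]\,[v(x)-v(y)]\,d(x,y),\qquad |u|_{V_\delta}^2=(u,u)_{V_\delta},\qquad V_\delta=\{u\in L^2(\Omega):|u|_{V_\delta}<\infty\},$$ with norm $\|u\|_{V_\delta}^2=\|u\|_{L^2}^2+|u|_{V_\delta}^2$, and let $\mathcal L_\delta$ be the operator $\langle\mathcal L_\delta u,v\rangle=(u,v)_{V_\delta}$, that is, $\mathcal L_\delta u(x)=\int_\Omega J_\delta(x-y)[u(x)-u(y)]\,dy$; write $L_\delta=\alpha_\phi\mathcal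 L_\delta$. Let $f\in C^1(\mathbb R^2)$, $f(\phi,c)=f_1(\phi,c)+f_2(\phi)$ with $f_1\in C^1(\mathbb R^2)$ and $0\le f_2\in C^1(\mathbb R)$, such that $\partial_cf(\phi,c)=Ac+h_1(\phi)$ and $\partial_\phi f_1(\phi,c)=c\,h_2(\phi)+h_3(\phi)$, where $A>0$, $h_1$ is $C^1$ with Lipschitz derivative and $h_1(0)=0$, $h_2$ is continuous and bounded, $h_3$ is continuous of at most linear growth, and such that $|\partial_\phi f_1|+|\partial_cf|\le C'(1+|c|+|\phi|)$ and $|f_2'(\phi)|\le C'(1+|\phi|^3)$ for a constant $C'$. For each $\delta\in(0,\delta_0)$ let $(\phi_\delta,c_\delta)$ be a weak solution on $(0,T)\times\Omega$ of the nonlocal KKS system $$\partial_t\phi_\delta=-L\,[\partial_\phi f(\phi_\delta,c_\delta)+\alpha_\phi\mathcal L_\delta\phi_\delta],\qquad \partial_tc_\delta=-M\mathcal L_\delta[\partial_cf(\phi_\delta,c_\delta)+\alpha_c\mathcal L_\delta c_\delta],\qquad \phi_\delta(0)=\phi_0,\ c_\delta(0)=c_0;$$ that is, $\phi_\delta,c_\delta\in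 L^\infty(0,T;L^2(\Omega))\cap L^2(0,T;V_\delta)$, $\partial_t\phi_\delta,\partial_tc_\delta\in L^2(0,T;V_\delta^*)$, the initial values are attained, and for a.e. $t$ and all $v\in V_\delta$ $$\langle\partial_t\phi_\delta,v\rangle=-L(\partial_\phi f(\phi_\delta,c_\delta),v)_{L^2}-\alpha_\phi L(\phi_\delta,v)_{V_\delta},\qquad \langle\partial_tc_\delta,v\rangle=-M(\partial_cf(\phi_\delta,c_\delta),v)_{V_\delta}-\alpha_cM(\mathcal L_\delta c_\delta,\mathcal L_\delta v)_{L^2}.$$ Put $g_\delta=\partial_cf(\phi_\delta,c_\delta)$. Suppose that there is a constant $C$, independent of $\delta$, such that for every $\delta\in(0,\delta_0)$ and a.e. $t\in(0,T)$ the functions $\phi_\delta(t),g_\delta(t)$ belong to $C^3(\overline\Omega)$ and all their derivatives of order at most $3$ are bounded by $C$. Let $\delta_n\to0$ in $(0,\delta_0)$ and let $\phi_{\delta_n}\rightharpoonup\phi$, $c_{\delta_n}\rightharpoonup c$ weakly in $L^2(0,T;L^2(\Omega))$. Then $\phi$ and $g=\partial_cf(\phi,c)$ belong to $L^2(0,T;H^1(\Omega))$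 and, in the norm of $L^2(0,T;H^{-1}(\Omega))$ with $H^{-1}(\Omega)=H^1_0(\Omega)^*$, $$L_{\delta_n}\phi_{\delta_n}\to-\alpha_\phi\Delta\phi,\qquad \mathcal L_{\delta_n}\partial_cf(\phi_{\delta_n},c_{\delta_n})\to-\Delta\,\partial_cf(\phi,c),$$ where $\langle\Delta u,v\rangle=-\int_\Omega\nabla u\cdot\nabla v\,dx$ for $v\in H_0^1(\Omega)$. Moreover $(\phi,c)$ solves the local KKS system $$\partial_t\phi=-L\,[\partial_\phi f(\phi,c)-\alpha_\phi\Delta\phi],\qquad \partial_tc=\nabla\cdot\bigl(M\nabla(\partial_cf(\phi,c)-\alpha_c\Delta c)\bigr),\qquad \phi(0)=\phi_0,\ c(0)=c_0$$ in the $H^{-1}$-weak sense: $\partial_\phi f(\phi,c)$ and the weak Laplacian $\Delta c$ are in $L^2(0,T;L^2(\Omega))$, the distributions $\partial_t\phi$ and $\partial_tc+M\alpha_c\Delta^2c$ are in $L^2(0,T;H^{-1}(\Omega))$, and for a.e. $t$ and all $v\in H^1_0(\Omega)$ $$\langle\partial_t\phi,v\rangle=-L\Bigl[\int_\Omega\partial_\phi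 f(\phi,c)\,v\,dx+\alpha_\phi\int_\Omega\nabla\phi\cdot\nabla v\,dx\Bigr],\qquad \langle\partial_tc+M\alpha_c\Delta^2c,\,v\rangle=-M\int_\Omega\nabla\partial_cf(\phi,c)\cdot\nabla v\,dx.$$ The initial values are attained in the sense of integration by parts in time: $-\int_0^T\eta'\,(\phi,v)_{L^2}\,dt-\eta(0)(\phi_0,v)_{L^2}=\int_0^T\eta\,\langle\partial_t\phi,v\rangle\,dt$ for all $\eta\in C_c^\infty([0,T))$ and $v\in H_0^1(\Omega)$, and for $v\in C_c^\infty(\Omega)$ likewise $-\int_0^T\eta'\,(c,v)_{L^2}\,dt-\eta(0)(c_0,v)_{L^2}+M\alpha_c\int_0^T\eta\,(\Delta c,\Delta v)_{L^2}\,dt=\int_0^T\eta\,\langle\partial_tc+M\alpha_c\Delta^2c,v\rangle\,dt$. -/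

import Mathlib

open MeasureTheory Set Filter Topology
open scoped ENNReal NNReal ContDiff

noncomputable section

namespace KKS

/-- The Euclidean space `ℝᵈ`. -/
abbrev Space (d : ℕ) := EuclideanSpace ℝ (Fin d)

variable {d : ℕ}

/-! ### Domain, time interval, kernel -/

/-- Lebesgue measure on `Ω`. -/
abbrev spaceMeas (Ω : Set (Space d)) : Measure (Space d) := volume.restrict Ω

/-- Lebesgue measure on `(0,T)`. -/
abbrev timeMeas (T : ℝ) : Measure ℝ := volume.restrict (Ioo 0 T)

/-- Lebesgue measure on `(0,T) × Ω`. -/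
abbrev spaceTimeMeas (T : ℝ) (Ω : Set (Space d)) : Measure (ℝ × Space d) :=
  (timeMeas T).prod (spaceMeas Ω)

/-- Bounded domains with boundary of class `C³`: near each boundary point, `Ω` is the region
`ρ < 0` of a `C³` function `ρ` with non-vanishing derivative. -/
structure IsC3Domain (Ω : Set (Space d)) : Prop where
  isOpen : IsOpen Ω
  isConnected : IsConnected Ω
  isBounded : Bornology.IsBounded Ω
  boundary : ∀ p ∈ frontier Ω, ∃ U : Set (Space d), IsOpen U ∧ p ∈ U ∧
    ∃ ρ : Space d → ℝ, ContDiffOn ℝ 3 ρ U ∧ fderiv ℝ ρ p ≠ 0 ∧ Ω ∩ U = {x ∈ U | ρ x < 0}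

/-- Integrable kernels that are nonnegative, radial, supported in the ball of radius `δ`, and
have second moment `2d`; the normalised top-hat kernel is one of them. -/
structure IsKernel (δ : ℝ) (J : Space d → ℝ) : Prop where
  integrable : Integrable J
  nonneg : ∀ z, 0 ≤ J z
  radial : ∃ j : ℝ → ℝ, ∀ z, J z = j ‖z‖
  support : Function.support J ⊆ Metric.closedBall 0 δ
  second_moment : ∫ z, J z * ‖z‖ ^ 2 = 2 * d

/-! ### The nonlocal space `V_δ` and the nonlocal operator -/

/-- The semi-inner product `(u,v)_{V_δ}`, which is also the pairing `⟨𝓛_δ u, v⟩`. -/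
def nlForm (J : Space d → ℝ) (Ω : Set (Space d)) (u v : Space d → ℝ) : ℝ :=
  1 / 2 * ∫ p in Ω ×ˢ Ω, J (p.1 - p.2) * ((u p.1 - u p.2) * (v p.1 - v p.2))

/-- The squared seminorm `|u|²_{V_δ}`, possibly infinite. -/
def nlSemiSq (J : Space d → ℝ) (Ω : Set (Space d)) (u : Space d → ℝ) : ℝ≥0∞ :=
  1 / 2 * ∫⁻ p in Ω ×ˢ Ω, ENNReal.ofReal (J (p.1 - p.2) * (u p.1 - u p.2) ^ 2)

/-- Membership in `V_δ`. -/
def MemV (J : Space d → ℝ) (Ω : Set (Space d)) (u : Space d → ℝ) : Prop :=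
  MemLp u 2 (spaceMeas Ω) ∧ nlSemiSq J Ω u < ⊤

/-- The norm of `V_δ`. -/
def normV (J : Space d → ℝ) (Ω : Set (Space d)) (u : Space d → ℝ) : ℝ :=
  Real.sqrt ((eLpNorm u 2 (spaceMeas Ω)).toReal ^ 2 + (nlSemiSq J Ω u).toReal)

/-- The nonlocal operator as a function,
`𝓛_δ u (x) = ∫_Ω J_δ(x-y) (u(x) - u(y)) dy`. -/
def nlOp (J : Space d → ℝ) (Ω : Set (Space d)) (u : Space d → ℝ) (x : Space d) : ℝ :=
  ∫ y in Ω, J (x - y) * (u x - u y)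

/-- The operator `L_δ = α_φ 𝓛_δ` of the phase-field equation, as a function on `Ω`: only
interactions with points of `Ω` are counted. -/
def phaseOp (αφ : ℝ) (J : Space d → ℝ) (Ω : Set (Space d)) (u : Space d → ℝ)
    (x : Space d) : ℝ :=
  αφ * nlOp J Ω u x

/-! ### The free energy density -/

/-- `∂_φ f (p,q)`. -/
def dPhi (f : ℝ → ℝ → ℝ) (p q : ℝ) : ℝ := deriv (fun s => f s q) p

/-- `∂_c f (p,q)`. -/
def dC (f : ℝ → ℝ → ℝ) (p q : ℝ) : ℝ := deriv (fun s => f p s) q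

/-- Structural assumptions on the free energy density: splitting, affine linearity in the
concentration, and growth. -/
structure IsFreeEnergy (f : ℝ → ℝ → ℝ) : Prop where
  contDiff : ContDiff ℝ 1 (Function.uncurry f)
  splitting : ∃ (f₁ : ℝ → ℝ → ℝ) (f₂ : ℝ → ℝ),
    ContDiff ℝ 1 (Function.uncurry f₁) ∧ ContDiff ℝ 1 f₂ ∧ (∀ p, 0 ≤ f₂ p) ∧
    (∀ p q, f p q = f₁ p q + f₂ p) ∧
    (∃ (A : ℝ) (h₁ h₂ h₃ : ℝ → ℝ), 0 < A ∧
      (ContDiff ℝ 1 h₁ ∧ (∃ K : ℝ≥0, LipschitzWith K (deriv h₁)) ∧ h₁ 0 = 0) ∧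
      (Continuous h₂ ∧ ∃ B, ∀ p, |h₂ p| ≤ B) ∧
      (Continuous h₃ ∧ ∃ B, ∀ p, |h₃ p| ≤ B * (1 + |p|)) ∧
      (∀ p q, dC f p q = A * q + h₁ p) ∧
      (∀ p q, dPhi f₁ p q = q * h₂ p + h₃ p)) ∧
    (∃ C₁ C₂ C₃ : ℝ, ∀ p q,
      |dPhi f₁ p q| ≤ C₁ * (1 + |q| + |p|) ∧
      |deriv f₂ p| ≤ C₂ * (1 + |p| ^ 3) ∧
      |dC f p q| ≤ C₃ * (1 + |q| + |p|))

/-! ### Test functions and regularity in space -/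

/-- Test functions in time on `[0,T)`: smooth, compactly supported, not required to vanish at
`0`, so that the initial value enters the weak time derivative. -/
def IsTimeTest (T : ℝ) (η : ℝ → ℝ) : Prop :=
  ContDiff ℝ ∞ η ∧ HasCompactSupport η ∧ tsupport η ⊆ Iio T

/-- Test functions in space: the elements of `C_c^∞(Ω)`. -/
def IsSpaceTest (Ω : Set (Space d)) (ψ : Space d → ℝ) : Prop :=
  ContDiff ℝ ∞ ψ ∧ HasCompactSupport ψ ∧ tsupport ψ ⊆ Ω

/-- `u ∈ C³(closure Ω)`: three times continuously differentiable in the open set `Ω`, and all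
derivatives up to order three extend continuously to the closure. -/
def IsC3Closure (Ω : Set (Space d)) (u : Space d → ℝ) : Prop :=
  ContDiffOn ℝ 3 u Ω ∧ ∀ k : ℕ, k ≤ 3 →
    ∃ D : Space d → (Space d) [×k]→L[ℝ] ℝ,
      ContinuousOn D (closure Ω) ∧ EqOn D (iteratedFDeriv ℝ k u) Ω

/-- All derivatives of `u` up to order three are bounded by `C` on `Ω`. -/
def C3BoundedBy (Ω : Set (Space d)) (u : Space d → ℝ) (C : ℝ) : Prop :=
  ∀ k : ℕ, k ≤ 3 → ∀ x ∈ Ω, ‖iteratedFDeriv ℝ k u x‖ ≤ C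

/-- `p ∈ L²(Ω)ᵈ` is the weak gradient of `u ∈ L²(Ω)`. -/
def HasWeakGrad (Ω : Set (Space d)) (u : Space d → ℝ) (p : Space d → Space d) : Prop :=
  MemLp u 2 (spaceMeas Ω) ∧ MemLp p 2 (spaceMeas Ω) ∧
  ∀ ψ, IsSpaceTest Ω ψ → ∫ x in Ω, u x • gradient ψ x = - ∫ x in Ω, ψ x • p x

/-- `w ∈ L²(Ω)` is the weak Laplacian of `u ∈ L²(Ω)`. -/
def HasWeakLaplacian (Ω : Set (Space d)) (u w : Space d → ℝ) : Prop :=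
  MemLp u 2 (spaceMeas Ω) ∧ MemLp w 2 (spaceMeas Ω) ∧
  ∀ ψ, IsSpaceTest Ω ψ → ∫ x in Ω, u x * Laplacian.laplacian ψ x = ∫ x in Ω, w x * ψ x

/-- `u ∈ L²(0,T;H¹(Ω))` with spatial weak gradient `G`. -/
def HasSpaceGrad (T : ℝ) (Ω : Set (Space d)) (u : ℝ → Space d → ℝ)
    (G : ℝ → Space d → Space d) : Prop :=
  MemLp (Function.uncurry u) 2 (spaceTimeMeas T Ω) ∧
  MemLp (Function.uncurry G) 2 (spaceTimeMeas T Ω) ∧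
  ∀ᵐ t ∂(timeMeas T), HasWeakGrad Ω (u t) (G t)

/-! ### `H¹₀(Ω)`, `H⁻¹(Ω)` and convergence in `L²(0,T;H⁻¹)` -/

/-- `H¹₀(Ω)`, with each `v` stored as the pair `(v, ∇v)` in `L²(Ω) × L²(Ω)ᵈ`: the closure of
`C_c^∞(Ω)` in the norm `(‖v‖² + ‖∇v‖²)^{1/2}`. -/
def H10 (Ω : Set (Space d)) :
    Submodule ℝ (WithLp 2 (Lp ℝ 2 (spaceMeas Ω) × Lp (Space d) 2 (spaceMeas Ω))) :=
  (Submodule.span ℝ {q | ∃ ψ : Space d → ℝ, IsSpaceTest Ω ψ ∧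
    q.fst =ᵐ[spaceMeas Ω] ψ ∧ q.snd =ᵐ[spaceMeas Ω] gradient ψ}).topologicalClosure

/-- The function underlying an element of `H¹₀(Ω)`. -/
def fn {Ω : Set (Space d)} (v : H10 Ω) : Space d → ℝ := v.1.fst

/-- The weak gradient of an element of `H¹₀(Ω)`. -/
def grad {Ω : Set (Space d)} (v : H10 Ω) : Space d → Space d := v.1.snd

/-- `H⁻¹(Ω)`, the dual of `H¹₀(Ω)`, with the dual norm. -/
abbrev HNeg (Ω : Set (Space d)) := StrongDual ℝ (H10 Ω)

/-- The Laplacian as a functional on `H¹₀(Ω)`: `⟨Δu, v⟩ = -∫ ∇u · ∇v`, with `p = ∇u`. -/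
def lapPairing {Ω : Set (Space d)} (p : Space d → Space d) (v : H10 Ω) : ℝ :=
  - ∫ x in Ω, inner ℝ (p x) (grad v x)

/-- The time-dependent functional `ℓ` on `H¹₀(Ω)` is the element `F` of `L²(0,T;H⁻¹(Ω))`. -/
def RepresentsL2HNeg (T : ℝ) (Ω : Set (Space d)) (ℓ : ℝ → H10 Ω → ℝ) (F : ℝ → HNeg Ω) : Prop :=
  MemLp F 2 (timeMeas T) ∧ ∀ᵐ t ∂(timeMeas T), ∀ v : H10 Ω, F t v = ℓ t v

/-- The functionals `ℓ n` and `ℓ'` belong to `L²(0,T;H⁻¹(Ω))`, and `ℓ n → ℓ'` in its norm. -/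
def TendstoL2HNeg (T : ℝ) (Ω : Set (Space d)) (ℓ : ℕ → ℝ → H10 Ω → ℝ) (ℓ' : ℝ → H10 Ω → ℝ) :
    Prop :=
  ∃ (F : ℕ → ℝ → HNeg Ω) (F' : ℝ → HNeg Ω),
    (∀ n, RepresentsL2HNeg T Ω (ℓ n) (F n)) ∧ RepresentsL2HNeg T Ω ℓ' F' ∧
    Tendsto (fun n => eLpNorm (F n - F') 2 (timeMeas T)) atTop (𝓝 0)

/-- Weak convergence in `L²(0,T;L²(Ω)) = L²((0,T) × Ω)`. -/
def TendstoWeakly (T : ℝ) (Ω : Set (Space d)) (u : ℕ → ℝ → Space d → ℝ)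
    (u' : ℝ → Space d → ℝ) : Prop :=
  MemLp (Function.uncurry u') 2 (spaceTimeMeas T Ω) ∧
  (∀ n, MemLp (Function.uncurry (u n)) 2 (spaceTimeMeas T Ω)) ∧
  ∀ w : ℝ × Space d → ℝ, MemLp w 2 (spaceTimeMeas T Ω) →
    Tendsto (fun n => ∫ p, u n p.1 p.2 * w p ∂(spaceTimeMeas T Ω)) atTop
      (𝓝 (∫ p, u' p.1 p.2 * w p ∂(spaceTimeMeas T Ω)))

/-! ### Weak solutions of the nonlocal system -/

/-- `ξ ∈ L²(0,T;V_δ*)`. -/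
structure MemL2VDual (T : ℝ) (J : Space d → ℝ) (Ω : Set (Space d))
    (ξ : ℝ → (Space d → ℝ) → ℝ) : Prop where
  linear : ∀ᵐ t ∂(timeMeas T), ∀ v w, MemV J Ω v → MemV J Ω w → ∀ a b : ℝ,
    ξ t (a • v + b • w) = a * ξ t v + b * ξ t w
  measurable : ∀ v, MemV J Ω v → AEStronglyMeasurable (fun t => ξ t v) (timeMeas T)
  bounded : ∃ K : ℝ → ℝ, MemLp K 2 (timeMeas T) ∧
    ∀ᵐ t ∂(timeMeas T), ∀ v, MemV J Ω v → |ξ t v| ≤ K t * normV J Ω v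

/-- `ξ = ∂_t u` in `L²(0,T;V_δ*)` together with `u(0) = u₀`. -/
def HasTimeDerivV (T : ℝ) (J : Space d → ℝ) (Ω : Set (Space d)) (u : ℝ → Space d → ℝ)
    (u₀ : Space d → ℝ) (ξ : ℝ → (Space d → ℝ) → ℝ) : Prop :=
  MemL2VDual T J Ω ξ ∧ ∀ v, MemV J Ω v → ∀ η, IsTimeTest T η →
    - (∫ t in Ioo 0 T, deriv η t * ∫ x in Ω, u t x * v x) - η 0 * ∫ x in Ω, u₀ x * v x
      = ∫ t in Ioo 0 T, η t * ξ t v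

/-- `u ∈ L^∞(0,T;L²(Ω)) ∩ L²(0,T;V_δ)`. -/
structure MemSolutionSpace (T : ℝ) (J : Space d → ℝ) (Ω : Set (Space d))
    (u : ℝ → Space d → ℝ) : Prop where
  measurable : AEStronglyMeasurable (Function.uncurry u) (spaceTimeMeas T Ω)
  bounded : ∃ C : ℝ≥0, ∀ᵐ t ∂(timeMeas T), eLpNorm (u t) 2 (spaceMeas Ω) ≤ C
  semi : ∫⁻ t in Ioo 0 T, nlSemiSq J Ω (u t) < ⊤

/-- Weak solutions `(φ,c)` of the nonlocal KKS system with initial data `(φ₀,c₀)`: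
`∂_t φ = -L (∂_φ f(φ,c) + α_φ 𝓛_δ φ)` and `∂_t c = -M 𝓛_δ (∂_c f(φ,c) + α_c 𝓛_δ c)`. -/
structure IsNonlocalSolution (T : ℝ) (Ω : Set (Space d)) (f : ℝ → ℝ → ℝ) (L M αφ αc : ℝ)
    (J : Space d → ℝ) (φ₀ c₀ : Space d → ℝ) (φ c : ℝ → Space d → ℝ) : Prop where
  mem_phi : MemSolutionSpace T J Ω φ
  mem_c : MemSolutionSpace T J Ω c
  allenCahn : ∃ ξ, HasTimeDerivV T J Ω φ φ₀ ξ ∧ ∀ᵐ t ∂(timeMeas T), ∀ v, MemV J Ω v →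
    ξ t v = - L * (∫ x in Ω, dPhi f (φ t x) (c t x) * v x) - αφ * L * nlForm J Ω (φ t) v
  cahnHilliard : ∃ ζ, HasTimeDerivV T J Ω c c₀ ζ ∧ ∀ᵐ t ∂(timeMeas T), ∀ v, MemV J Ω v →
    ζ t v = - M * nlForm J Ω (fun x => dC f (φ t x) (c t x)) v
      - αc * M * ∫ x in Ω, nlOp J Ω (c t) x * nlOp J Ω v x

/-! ### Weak solutions of the local system -/

/-- `(φ,c)` solves the local KKS system
`∂_t φ = -L (∂_φ f(φ,c) - α_φ Δφ)`, `∂_t c = ∇·(M ∇(∂_c f(φ,c) - α_c Δc))`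
with initial data `(φ₀,c₀)` in the `H⁻¹`-weak sense: `φ` and `g = ∂_c f(φ,c)` are in
`L²(0,T;H¹)`, `Δc` is in `L²(0,T;L²)`, `ξ = ∂_t φ` and `ζ = ∂_t c + M α_c Δ²c` are in
`L²(0,T;H⁻¹)`, and the two equations hold in `H⁻¹` for almost every `t`. -/
structure IsLocalSolution (T : ℝ) (Ω : Set (Space d)) (f : ℝ → ℝ → ℝ) (L M αφ αc : ℝ)
    (φ₀ c₀ : Space d → ℝ) (φ c : ℝ → Space d → ℝ) : Prop where
  allenCahn :
    MemLp (Function.uncurry fun t x => dPhi f (φ t x) (c t x)) 2 (spaceTimeMeas T Ω) ∧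
    ∃ (G : ℝ → Space d → Space d) (ξ : ℝ → HNeg Ω),
      HasSpaceGrad T Ω φ G ∧ MemLp ξ 2 (timeMeas T) ∧
      (∀ v : H10 Ω, ∀ η, IsTimeTest T η →
        - (∫ t in Ioo 0 T, deriv η t * ∫ x in Ω, φ t x * fn v x)
          - η 0 * ∫ x in Ω, φ₀ x * fn v x
        = ∫ t in Ioo 0 T, η t * ξ t v) ∧
      ∀ᵐ t ∂(timeMeas T), ∀ v : H10 Ω,
        ξ t v = - L * ((∫ x in Ω, dPhi f (φ t x) (c t x) * fn v x) - αφ * lapPairing (G t) v)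
  cahnHilliard :
    ∃ (G : ℝ → Space d → Space d) (w : ℝ → Space d → ℝ) (ζ : ℝ → HNeg Ω),
      HasSpaceGrad T Ω (fun t x => dC f (φ t x) (c t x)) G ∧
      MemLp (Function.uncurry c) 2 (spaceTimeMeas T Ω) ∧
      MemLp (Function.uncurry w) 2 (spaceTimeMeas T Ω) ∧
      (∀ᵐ t ∂(timeMeas T), HasWeakLaplacian Ω (c t) (w t)) ∧
      MemLp ζ 2 (timeMeas T) ∧
      (∀ ψ, IsSpaceTest Ω ψ → ∀ v : H10 Ω, fn v =ᵐ[spaceMeas Ω] ψ → ∀ η, IsTimeTest T η →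
        - (∫ t in Ioo 0 T, deriv η t * ∫ x in Ω, c t x * ψ x)
          - η 0 * (∫ x in Ω, c₀ x * ψ x)
          + M * αc * (∫ t in Ioo 0 T, η t * ∫ x in Ω, w t x * Laplacian.laplacian ψ x)
        = ∫ t in Ioo 0 T, η t * ζ t v) ∧
      ∀ᵐ t ∂(timeMeas T), ∀ v : H10 Ω, ζ t v = M * lapPairing (G t) v

end KKS

end

noncomputable section

namespace KKS

variable {d : ℕ}

/-! ### Kernels -/

namespace IsKernel

variable {δ : ℝ} {J : Space d → ℝ}

lemma comp_isometry (hJ : IsKernel δ J) (A : Space d ≃ₗᵢ[ℝ] Space d) (z : Space d) :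
    J (A z) = J z := by
  obtain ⟨j, hj⟩ := hJ.radial
  rw [hj, hj, A.norm_map]

lemma neg (hJ : IsKernel δ J) (z : Space d) : J (-z) = J z :=
  hJ.comp_isometry (LinearIsometryEquiv.neg ℝ) z

lemma eq_zero_of_lt (hJ : IsKernel δ J) {z : Space d} (hz : δ < ‖z‖) : J z = 0 := by
  by_contra h
  have := hJ.support h
  simp only [Metric.mem_closedBall, dist_zero_right] at this
  linarith

/-- To bound a function against `J` it suffices to bound it on the ball of radius `δ`. -/
lemma mul_le_mul_of_ball (hJ : IsKernel δ J) {a b : Space d → ℝ}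
    (h : ∀ z, ‖z‖ ≤ δ → a z ≤ b z) (z : Space d) : J z * a z ≤ J z * b z := by
  rcases le_or_gt ‖z‖ δ with hz | hz
  · exact mul_le_mul_of_nonneg_left (h z hz) (hJ.nonneg z)
  · simp [hJ.eq_zero_of_lt hz]

lemma integrable_mul (hJ : IsKernel δ J) {g : Space d → ℝ} (hg : AEStronglyMeasurable g)
    {B : ℝ} (hB : ∀ z, ‖z‖ ≤ δ → |g z| ≤ B) : Integrable (fun z => J z * g z) := by
  refine Integrable.mono' (hJ.integrable.mul_const B) (hJ.integrable.aestronglyMeasurable.mul hg)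
    (Eventually.of_forall fun z => ?_)
  rw [Real.norm_eq_abs, abs_mul, abs_of_nonneg (hJ.nonneg z)]
  exact hJ.mul_le_mul_of_ball (b := fun _ => B) hB z

lemma integrable_sq (hJ : IsKernel δ J) : Integrable (fun z => J z * ‖z‖ ^ 2) := by
  refine hJ.integrable_mul (B := δ ^ 2) (by fun_prop) fun z hz => ?_
  rw [abs_of_nonneg (by positivity)]
  gcongr

/-- A function of quadratic growth is integrable against the kernel. -/
lemma integrable_of_le_sq (hJ : IsKernel δ J) {g : Space d → ℝ} (hg : AEStronglyMeasurable g)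
    {B : ℝ} (hB : ∀ z, ‖z‖ ≤ δ → |g z| ≤ B * ‖z‖ ^ 2) : Integrable (fun z => J z * g z) := by
  refine hJ.integrable_mul (B := |B| * δ ^ 2) hg fun z hz => (hB z hz).trans ?_
  gcongr
  exact le_abs_self B

lemma norm_integral_le (hJ : IsKernel δ J) {g : Space d → ℝ}
    {B : ℝ} (hB : ∀ z, ‖z‖ ≤ δ → |g z| ≤ B * ‖z‖ ^ 2) : |∫ z, J z * g z| ≤ B * (2 * d) := by
  rw [← hJ.second_moment, ← integral_const_mul, ← Real.norm_eq_abs]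
  refine norm_integral_le_of_norm_le (hJ.integrable_sq.const_mul B)
    (Eventually.of_forall fun z => ?_)
  rw [Real.norm_eq_abs, abs_mul, abs_of_nonneg (hJ.nonneg z)]
  calc J z * |g z| ≤ J z * (B * ‖z‖ ^ 2) := hJ.mul_le_mul_of_ball hB z
    _ = B * (J z * ‖z‖ ^ 2) := by ring

lemma integral_comp_isometry (hJ : IsKernel δ J) (A : Space d ≃ₗᵢ[ℝ] Space d)
    (g : Space d → ℝ) : ∫ z, J z * g (A z) = ∫ z, J z * g z := by
  rw [← A.measurePreserving.integral_comp A.toHomeomorph.measurableEmbedding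
    (fun z => J z * g z)]
  simp_rw [hJ.comp_isometry A]

lemma integral_odd (hJ : IsKernel δ J) {g : Space d → ℝ} (hg : ∀ z, g (-z) = - g z) :
    ∫ z, J z * g z = 0 := by
  have h := hJ.integral_comp_isometry (LinearIsometryEquiv.neg ℝ) g
  simp only [LinearIsometryEquiv.coe_neg, hg, mul_neg, integral_neg] at h
  linarith

lemma integrable_coord (hJ : IsKernel δ J) (i j : Fin d) :
    Integrable (fun z : Space d => J z * (z i * z j)) := by
  refine hJ.integrable_of_le_sq (B := 1) (by fun_prop) fun z _ => ?_
  rw [abs_mul, one_mul, sq]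
  exact mul_le_mul (PiLp.norm_apply_le z i) (PiLp.norm_apply_le z j) (abs_nonneg _)
    (norm_nonneg _)

lemma integral_coord_ne (hJ : IsKernel δ J) {i j : Fin d} (hij : i ≠ j) :
    ∫ z : Space d, J z * (z i * z j) = 0 := by
  classical
  have h := hJ.integral_comp_isometry (LinearIsometryEquiv.piLpCongrRight 2
    (fun k : Fin d => if k = i then LinearIsometryEquiv.neg ℝ (E := ℝ)
      else LinearIsometryEquiv.refl ℝ ℝ)) (fun z => z i * z j)
  simp only [LinearIsometryEquiv.piLpCongrRight_apply, if_true, if_neg hij.symm,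
    LinearIsometryEquiv.coe_neg, LinearIsometryEquiv.coe_refl, id, neg_mul, mul_neg,
    integral_neg] at h
  linarith

lemma integral_coord_self (hJ : IsKernel δ J) (i : Fin d) :
    ∫ z : Space d, J z * (z i * z i) = 2 := by
  classical
  have hsame : ∀ j : Fin d, ∫ z : Space d, J z * (z j * z j)
      = ∫ z : Space d, J z * (z i * z i) := fun j => by
    have h := hJ.integral_comp_isometry
      (LinearIsometryEquiv.piLpCongrLeft 2 ℝ ℝ (Equiv.swap i j)) (fun z => z i * z i)
    simpa [Equiv.piCongrLeft'] using h
  have hsum := hJ.second_moment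
  simp_rw [EuclideanSpace.norm_sq_eq, Finset.mul_sum, Real.norm_eq_abs, sq_abs, sq] at hsum
  rw [integral_finsetSum _ fun j _ => hJ.integrable_coord j j] at hsum
  simp_rw [hsame, Finset.sum_const, Finset.card_univ, Fintype.card_fin, nsmul_eq_mul] at hsum
  have hd : (d : ℝ) ≠ 0 := by
    have := i.pos
    positivity
  rw [mul_comm] at hsum
  exact mul_right_cancel₀ hd hsum

/-- Isotropy: second moments against the kernel are traces. -/
lemma integral_bilin (hJ : IsKernel δ J) (B : Space d →L[ℝ] Space d →L[ℝ] ℝ) :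
    ∫ z, J z * B z z
      = 2 * ∑ i, B (EuclideanSpace.basisFun (Fin d) ℝ i) (EuclideanSpace.basisFun (Fin d) ℝ i) := by
  classical
  set e := EuclideanSpace.basisFun (Fin d) ℝ
  have hB : ∀ z, J z * B z z = ∑ i, ∑ j, B (e i) (e j) * (J z * (z i * z j)) := fun z => by
    have hz : z = ∑ i, z i • e i := by
      conv_lhs => rw [← e.sum_repr z]
      rfl
    conv_lhs => rw [hz]
    simp only [map_sum, map_smul, _root_.sum_apply, _root_.smul_apply,
      smul_eq_mul, Finset.mul_sum]
    rw [Finset.sum_comm]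
    have hJz : J (∑ i, z i • e i) = J z := by rw [← hz]
    refine Finset.sum_congr rfl fun i _ => Finset.sum_congr rfl fun j _ => ?_
    rw [hJz]
    ring
  simp_rw [hB]
  rw [integral_finsetSum _ fun i _ => integrable_finsetSum _ fun j _ =>
    (hJ.integrable_coord i j).const_mul _, Finset.mul_sum]
  refine Finset.sum_congr rfl fun i _ => ?_
  rw [integral_finsetSum _ fun j _ => (hJ.integrable_coord i j).const_mul _,
    Finset.sum_eq_single i]
  · rw [integral_const_mul, hJ.integral_coord_self, mul_comm]
  · intro j _ hji
    rw [integral_const_mul, hJ.integral_coord_ne hji.symm, mul_zero]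
  · simp

lemma integral_linear_mul_linear (hJ : IsKernel δ J) (a b : Space d →L[ℝ] ℝ) :
    ∫ z, J z * (a z * b z)
      = 2 * ∑ i, a (EuclideanSpace.basisFun (Fin d) ℝ i) * b (EuclideanSpace.basisFun (Fin d) ℝ i) :=
  hJ.integral_bilin (a.smulRight b)

end IsKernel

/-! ### Functions with bounded values, bounded gradient, and Lipschitz gradient -/

/-- On `Ω`, the function `u` and its derivative are bounded by `D`, and the derivative is
`D`-Lipschitz along segments contained in `Ω`. -/
structure HasC11Bound (Ω : Set (Space d)) (u : Space d → ℝ) (D : ℝ) : Prop where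
  abs_le : ∀ x ∈ Ω, |u x| ≤ D
  differentiableAt : ∀ x ∈ Ω, DifferentiableAt ℝ u x
  norm_fderiv_le : ∀ x ∈ Ω, ‖fderiv ℝ u x‖ ≤ D
  lipschitz : ∀ x ∈ Ω, ∀ y ∈ Ω, segment ℝ x y ⊆ Ω →
    ‖fderiv ℝ u y - fderiv ℝ u x‖ ≤ D * ‖y - x‖

namespace HasC11Bound

variable {Ω : Set (Space d)} {u : Space d → ℝ} {D : ℝ}

lemma nonneg (h : HasC11Bound Ω u D) (hΩ : Ω.Nonempty) : 0 ≤ D :=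
  (abs_nonneg _).trans (h.abs_le _ hΩ.some_mem)

lemma mono (h : HasC11Bound Ω u D) {D' : ℝ} (hD : D ≤ D') : HasC11Bound Ω u D' where
  abs_le x hx := (h.abs_le x hx).trans hD
  differentiableAt := h.differentiableAt
  norm_fderiv_le x hx := (h.norm_fderiv_le x hx).trans hD
  lipschitz x hx y hy hs := (h.lipschitz x hx y hy hs).trans (by gcongr)

lemma abs_sub_le_of_segment (h : HasC11Bound Ω u D) {x y : Space d}
    (hs : segment ℝ x y ⊆ Ω) : |u y - u x| ≤ D * ‖y - x‖ :=
  Convex.norm_image_sub_le_of_norm_fderiv_le (𝕜 := ℝ) (f := u) (s := segment ℝ x y)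
    (fun z hz => h.differentiableAt z (hs hz)) (fun z hz => h.norm_fderiv_le z (hs hz))
    (convex_segment x y) (left_mem_segment ℝ x y) (right_mem_segment ℝ x y)

lemma abs_sub_sub_le (h : HasC11Bound Ω u D) (hD : 0 ≤ D) {p x y : Space d} {r : ℝ}
    (hp : Metric.closedBall p r ⊆ Ω) (hx : x ∈ Metric.closedBall p r)
    (hy : y ∈ Metric.closedBall p r) :
    |u y - u x - fderiv ℝ u p (y - x)| ≤ D * r * ‖y - x‖ := by
  have hr : 0 ≤ r := dist_nonneg.trans (Metric.mem_closedBall.1 hx)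
  refine Convex.norm_image_sub_le_of_norm_fderiv_le' (𝕜 := ℝ) (f := u)
    (s := Metric.closedBall p r)
    (fun z hz => h.differentiableAt z (hp hz)) (fun z hz => ?_) (convex_closedBall p r) hx hy
  have hp' : p ∈ Metric.closedBall p r := Metric.mem_closedBall_self hr
  refine (h.lipschitz p (hp hp') z (hp hz)
    (((convex_closedBall p r).segment_subset hp' hz).trans hp)).trans ?_
  gcongr
  rwa [← dist_eq_norm]

lemma continuousOn (h : HasC11Bound Ω u D) : ContinuousOn u Ω := fun x hx =>
  (h.differentiableAt x hx).continuousAt.continuousWithinAt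

lemma aestronglyMeasurable (h : HasC11Bound Ω u D) (hΩ : IsOpen Ω) :
    AEStronglyMeasurable u (spaceMeas Ω) :=
  h.continuousOn.aestronglyMeasurable hΩ.measurableSet

end HasC11Bound

lemma hasC11Bound_of_C3 {Ω : Set (Space d)} (hΩ : IsOpen Ω) {u : Space d → ℝ} {C : ℝ}
    (hu : IsC3Closure Ω u) (hC : C3BoundedBy Ω u C) : HasC11Bound Ω u C where
  abs_le x hx := by simpa using hC 0 (by norm_num) x hx
  differentiableAt x hx :=
    (hu.1.contDiffAt (hΩ.mem_nhds hx)).differentiableAt (by norm_num)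
  norm_fderiv_le x hx := by
    rw [← norm_iteratedFDeriv_one]
    exact hC 1 (by norm_num) x hx
  lipschitz x hx y hy hs := by
    refine Convex.norm_image_sub_le_of_norm_fderiv_le (𝕜 := ℝ) (f := fderiv ℝ u)
      (s := segment ℝ x y) (fun z hz => ?_) (fun z hz => ?_)
      (convex_segment x y) (left_mem_segment ℝ x y) (right_mem_segment ℝ x y)
    · exact ((hu.1.contDiffAt (hΩ.mem_nhds (hs hz))).fderiv_right (m := 2)
        (by norm_num)).differentiableAt (by norm_num)
    · rw [← norm_iteratedFDeriv_one, norm_iteratedFDeriv_fderiv]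
      exact hC 2 (by norm_num) z (hs hz)

/-! ### Boundary layers -/

lemma mem_of_notMem_cthickening {Ω : Set (Space d)} {x y : Space d} {r : ℝ}
    (hx : x ∉ Metric.cthickening r Ωᶜ) (hy : dist x y ≤ r) : y ∈ Ω := by
  by_contra h
  exact hx (Metric.mem_cthickening_of_dist_le x y r Ωᶜ h hy)

lemma closedBall_subset_of_notMem {Ω : Set (Space d)} {x : Space d} {r : ℝ}
    (hx : x ∉ Metric.cthickening r Ωᶜ) : Metric.closedBall x r ⊆ Ω := fun _ hy =>
  mem_of_notMem_cthickening hx (by rwa [dist_comm])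

lemma isFiniteMeasure_spaceMeas {Ω : Set (Space d)} (hb : Bornology.IsBounded Ω) :
    IsFiniteMeasure (spaceMeas Ω) :=
  isFiniteMeasure_restrict.2 hb.measure_lt_top.ne

lemma IsSpaceTest.exists_layer {Ω : Set (Space d)} (hΩ : IsOpen Ω) {ψ : Space d → ℝ}
    (hψ : IsSpaceTest Ω ψ) : ∃ r > 0, ∀ x ∈ Metric.cthickening r Ωᶜ, ∀ y, dist y x ≤ r →
      ψ y = 0 := by
  obtain ⟨r, hr, hdis⟩ := Disjoint.exists_cthickenings (s := tsupport ψ) (t := Ωᶜ)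
    (disjoint_compl_right_iff_subset.2 hψ.2.2) hψ.2.1 hΩ.isClosed_compl
  refine ⟨r, hr, fun x hx y hxy => ?_⟩
  by_contra hy
  exact disjoint_left.1 hdis (Metric.mem_cthickening_of_dist_le x y r _
    (subset_tsupport ψ hy) (by rwa [dist_comm])) hx

/-! ### Quasi-convexity of `C³` domains at small scales -/

/-- At distances below `r`, functions with gradient bounded by `D` on `Ω` are Lipschitz with
constant `K * D`. -/
def IsQuasiConvex (Ω : Set (Space d)) (K r : ℝ) : Prop :=
  ∀ (u : Space d → ℝ) (D : ℝ), HasC11Bound Ω u D →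
    ∀ x ∈ Ω, ∀ y ∈ Ω, ‖y - x‖ < r → |u y - u x| ≤ K * D * ‖y - x‖

lemma exists_local_quasiConvex_of_boundary {Ω U : Set (Space d)} {p : Space d} (hU : IsOpen U)
    (hp : p ∈ U) {ρ : Space d → ℝ} (hρ : ContDiffOn ℝ 3 ρ U) (hdρ : fderiv ℝ ρ p ≠ 0)
    (hΩU : Ω ∩ U = {x ∈ U | ρ x < 0}) :
    ∃ K > 0, ∃ r > 0, ∀ (u : Space d → ℝ) (D : ℝ), HasC11Bound Ω u D →
      ∀ x ∈ Ω ∩ Metric.ball p r, ∀ y ∈ Ω ∩ Metric.ball p r,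
        |u y - u x| ≤ K * D * ‖y - x‖ := by
  have hstrict : HasStrictFDerivAt ρ (fderiv ℝ ρ p) p :=
    (hρ.contDiffAt (hU.mem_nhds hp)).hasStrictFDerivAt (by norm_num)
  set A := fderiv ℝ ρ p
  obtain ⟨ν, hν⟩ : ∃ ν, A ν = -2 := by
    obtain ⟨w, hw⟩ : ∃ w, A w ≠ 0 := by
      by_contra! h
      exact hdρ (ContinuousLinearMap.ext h)
    exact ⟨(-2 / A w) • w, by simp [hw]⟩
  have hν0 : 0 < ‖ν‖ := by
    rw [norm_pos_iff]
    rintro rfl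
    simp at hν
  -- with this tolerance, `ρ` decreases at unit rate along `ν`
  obtain ⟨s, hs, happ⟩ := hstrict.approximates_deriv_on_nhds (c := (1 / ‖ν‖).toNNReal)
    (Or.inr (by simpa using hν0))
  have hc : (((1 / ‖ν‖).toNNReal : ℝ≥0) : ℝ) = 1 / ‖ν‖ := Real.coe_toNNReal _ (by positivity)
  obtain ⟨R, hR, hball⟩ := Metric.mem_nhds_iff.1 (inter_mem hs (hU.mem_nhds hp))
  set N : ℝ := ‖A‖ + 1 / ‖ν‖ with hN
  have hN0 : 0 < N := by positivity
  -- `ρ` grows at rate at most `N`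
  have hgrow : ∀ x ∈ Metric.ball p R, ∀ y ∈ Metric.ball p R, ρ y ≤ ρ x + N * ‖y - x‖ := by
    intro x hx y hy
    have h1 := happ y (hball hy).1 x (hball hx).1
    rw [hc] at h1
    have h2 := (abs_le.1 h1).2
    have h3 := (le_abs_self _).trans (A.le_opNorm (y - x))
    rw [hN, add_mul]
    linarith
  have hdec : ∀ x ∈ Metric.ball p R, ∀ τ : ℝ, 0 ≤ τ → x + τ • ν ∈ Metric.ball p R →
      ρ (x + τ • ν) ≤ ρ x - τ := by
    intro x hx τ hτ hy
    have h1 := happ _ (hball hy).1 x (hball hx).1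
    rw [hc, add_sub_cancel_left, map_smul, hν, norm_smul, Real.norm_of_nonneg hτ] at h1
    have h2 := (abs_le.1 h1).2
    have h4 : 1 / ‖ν‖ * (τ * ‖ν‖) = τ := by field_simp
    rw [h4, smul_eq_mul] at h2
    linarith
  have hmem : ∀ z ∈ Metric.ball p R, ρ z < 0 → z ∈ Ω := fun z hz h =>
    (hΩU.symm.subset ⟨(hball hz).2, h⟩ : z ∈ Ω ∩ U).1
  have hneg : ∀ z ∈ Metric.ball p R, z ∈ Ω → ρ z < 0 := fun z hz h =>
    (hΩU.subset ⟨h, (hball hz).2⟩ : z ∈ {x ∈ U | ρ x < 0}).2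
  refine ⟨2 * (N * ‖ν‖) + 1, by positivity, R / (2 * (N * ‖ν‖) + 3), by positivity, ?_⟩
  rintro u D hu x ⟨hxΩ, hxb⟩ y ⟨hyΩ, hyb⟩
  have hD : 0 ≤ D := hu.nonneg ⟨x, hxΩ⟩
  set r := R / (2 * (N * ‖ν‖) + 3) with hr
  have hRr : R = r * (2 * (N * ‖ν‖) + 3) := by rw [hr]; field_simp
  have hr0 : 0 < r := by positivity
  set l := ‖y - x‖ with hl
  have hl0 : 0 ≤ l := norm_nonneg _
  have hl2 : l < 2 * r := by
    rw [hl, ← dist_eq_norm]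
    have := dist_triangle y p x
    rw [Metric.mem_ball] at hxb hyb
    rw [dist_comm p x] at this
    linarith
  have hrR : r ≤ R := by
    have : 0 ≤ r * (2 * (N * ‖ν‖) + 2) := by positivity
    rw [hRr]; linarith
  have hup : ∀ z ∈ Metric.ball p r, ∀ τ : ℝ, 0 ≤ τ → τ ≤ N * l →
      z + τ • ν ∈ Metric.ball p R := by
    intro z hz τ hτ hτN
    rw [Metric.mem_ball, dist_eq_norm] at hz ⊢
    have h1 : ‖z + τ • ν - p‖ ≤ ‖z - p‖ + τ * ‖ν‖ := by
      rw [add_sub_right_comm]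
      refine (norm_add_le _ _).trans ?_
      rw [norm_smul, Real.norm_of_nonneg hτ]
    have h2 : τ * ‖ν‖ ≤ N * (2 * r) * ‖ν‖ := by gcongr; exact hτN.trans (by gcongr)
    have h3 : R = r + (2 * r + N * (2 * r) * ‖ν‖) := by rw [hRr]; ring
    linarith
  have hbR : ∀ z ∈ Metric.ball p r, z ∈ Metric.ball p R := fun z hz =>
    Metric.ball_subset_ball hrR hz
  have hleg : ∀ z ∈ Metric.ball p r, z ∈ Ω → segment ℝ z (z + (N * l) • ν) ⊆ Ω := by
    intro z hz hzΩ w hw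
    rw [segment_eq_image'] at hw
    obtain ⟨θ, ⟨hθ0, hθ1⟩, rfl⟩ := hw
    have hNl : 0 ≤ N * l := by positivity
    have hτ0 : 0 ≤ θ * (N * l) := by positivity
    have hτ1 : θ * (N * l) ≤ N * l := mul_le_of_le_one_left hNl hθ1
    have heq : z + θ • (z + (N * l) • ν - z) = z + (θ * (N * l)) • ν := by
      rw [add_sub_cancel_left, smul_smul]
    show z + θ • (z + (N * l) • ν - z) ∈ Ω
    rw [heq]
    have hb := hup z hz _ hτ0 hτ1
    refine hmem _ hb ?_
    have := hdec z (hbR z hz) _ hτ0 hb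
    have := hneg z (hbR z hz) hzΩ
    linarith
  have hmid : segment ℝ (x + (N * l) • ν) (y + (N * l) • ν) ⊆ Ω := by
    intro w hw
    rw [segment_eq_image'] at hw
    obtain ⟨θ, ⟨hθ0, hθ1⟩, rfl⟩ := hw
    have hNl : 0 ≤ N * l := by positivity
    have heq : x + (N * l) • ν + θ • (y + (N * l) • ν - (x + (N * l) • ν))
        = (x + θ • (y - x)) + (N * l) • ν := by
      rw [add_sub_add_right_eq_sub]; abel
    show x + (N * l) • ν + θ • (y + (N * l) • ν - (x + (N * l) • ν)) ∈ Ω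
    rw [heq]
    have hxy : x + θ • (y - x) ∈ Metric.ball p r :=
      (convex_ball p r).add_smul_sub_mem hxb hyb ⟨hθ0, hθ1⟩
    have hb := hup _ hxy _ hNl le_rfl
    refine hmem _ hb ?_
    have h1 := hdec _ (hbR _ hxy) _ hNl hb
    have h2 := hgrow x (hbR x hxb) _ (hbR _ hxy)
    rw [add_sub_cancel_left, norm_smul, Real.norm_of_nonneg hθ0] at h2
    have h3 := hneg x (hbR x hxb) hxΩ
    have h4 : N * (θ * l) ≤ N * l := by
      gcongr
      exact mul_le_of_le_one_left hl0 hθ1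
    linarith
  have e1 := hu.abs_sub_le_of_segment (hleg x hxb hxΩ)
  have e2 := hu.abs_sub_le_of_segment hmid
  have e3 := hu.abs_sub_le_of_segment (hleg y hyb hyΩ)
  rw [add_sub_cancel_left, norm_smul, Real.norm_of_nonneg (by positivity)] at e1 e3
  rw [add_sub_add_right_eq_sub, ← hl] at e2
  have : |u y - u x| ≤ D * (N * l * ‖ν‖) + D * l + D * (N * l * ‖ν‖) := by
    rw [abs_le] at *
    constructor <;> linarith [e1.1, e1.2, e2.1, e2.2, e3.1, e3.2]
  refine this.trans (le_of_eq ?_)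
  ring

theorem IsC3Domain.exists_isQuasiConvex {Ω : Set (Space d)} (hΩ : IsC3Domain Ω) :
    ∃ K > 0, ∃ r > 0, IsQuasiConvex Ω K r := by
  have hloc : ∀ p ∈ closure Ω, ∃ K > 0, ∃ r > 0, ∀ (u : Space d → ℝ) (D : ℝ),
      HasC11Bound Ω u D → ∀ x ∈ Ω ∩ Metric.ball p r, ∀ y ∈ Ω ∩ Metric.ball p r,
        |u y - u x| ≤ K * D * ‖y - x‖ := by
    intro p hp
    by_cases hpΩ : p ∈ Ω
    · obtain ⟨r, hr, hb⟩ := Metric.isOpen_iff.1 hΩ.isOpen p hpΩ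
      refine ⟨1, one_pos, r, hr, fun u D hu x hx y hy => ?_⟩
      rw [one_mul]
      exact hu.abs_sub_le_of_segment (((convex_ball p r).segment_subset hx.2 hy.2).trans hb)
    · have hpf : p ∈ frontier Ω := ⟨hp, by rwa [hΩ.isOpen.interior_eq]⟩
      obtain ⟨U, hU, hpU, ρ, hρ, hdρ, hΩU⟩ := hΩ.boundary p hpf
      exact exists_local_quasiConvex_of_boundary hU hpU hρ hdρ hΩU
  choose! K hK r hr hloc using hloc
  have hcomp : IsCompact (closure Ω) := hΩ.isBounded.isCompact_closure
  obtain ⟨t, ht, hcov⟩ := hcomp.elim_nhds_subcover (fun p => Metric.ball p (r p))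
    (fun p hp => Metric.ball_mem_nhds p (hr p hp))
  obtain ⟨δ, hδ, hleb⟩ := lebesgue_number_lemma_of_metric (ι := t)
    (c := fun p => Metric.ball (p : Space d) (r p)) hcomp (fun _ => Metric.isOpen_ball)
    (by simpa [iUnion_subtype] using hcov)
  have hKp : ∀ p ∈ t, 0 ≤ K p := fun p hp => (hK p (ht p hp)).le
  refine ⟨∑ p ∈ t, K p + 1, by have := Finset.sum_nonneg hKp; linarith, δ, hδ, ?_⟩
  intro u D hu x hx y hy hxy
  have hD : 0 ≤ D := hu.nonneg ⟨x, hx⟩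
  obtain ⟨⟨p, hp⟩, hpb⟩ := hleb x (subset_closure hx)
  have h := hloc p (ht p hp) u D hu x ⟨hx, hpb (Metric.mem_ball_self hδ)⟩ y
    ⟨hy, hpb (by rwa [Metric.mem_ball, dist_eq_norm])⟩
  refine h.trans ?_
  gcongr
  have := Finset.single_le_sum hKp hp
  linarith


/-! ### The nonlocal operator -/

section NonlocalOperator

variable {Ω : Set (Space d)} {δ : ℝ} {J : Space d → ℝ}

lemma nlOp_eq_integral_shift (hΩ : MeasurableSet Ω) (u : Space d → ℝ) (x : Space d) :
    nlOp J Ω u x = ∫ z, J z * Ω.indicator (fun y => u x - u y) (x - z) := by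
  rw [nlOp, ← integral_indicator hΩ, ← integral_sub_left_eq_self _ volume x]
  refine integral_congr_ae (Eventually.of_forall fun z => ?_)
  by_cases h : x - z ∈ Ω <;> simp [h]

lemma nlOp_eq_of_interior (hJ : IsKernel δ J) (hΩ : MeasurableSet Ω) (u : Space d → ℝ)
    {x : Space d} (hx : x ∉ Metric.cthickening δ Ωᶜ) :
    nlOp J Ω u x = ∫ z, J z * (u x - u (x - z)) := by
  rw [nlOp_eq_integral_shift hΩ]
  refine integral_congr_ae (Eventually.of_forall fun z => ?_)
  rcases le_or_gt ‖z‖ δ with hz | hz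
  · have : x - z ∈ Ω := mem_of_notMem_cthickening hx (by simpa [dist_eq_norm] using hz)
    simp [this]
  · simp [hJ.eq_zero_of_lt hz]

lemma aestronglyMeasurable_shift (hΩ : MeasurableSet Ω) {u : Space d → ℝ}
    (hu : AEStronglyMeasurable u (spaceMeas Ω)) (x : Space d) :
    AEStronglyMeasurable (fun z => Ω.indicator (fun y => u x - u y) (x - z)) := by
  have h : AEStronglyMeasurable (Ω.indicator fun y => u x - u y) volume :=
    (aestronglyMeasurable_indicator_iff hΩ).2 (aestronglyMeasurable_const.sub hu)
  exact h.comp_measurePreserving (Measure.measurePreserving_sub_left volume x)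

lemma abs_nlOp_le_of_bound (hJ : IsKernel δ J) (hΩ : MeasurableSet Ω) {u : Space d → ℝ} {D : ℝ}
    (hu : ∀ x ∈ Ω, |u x| ≤ D) {x : Space d} (hx : x ∈ Ω) :
    |nlOp J Ω u x| ≤ 2 * D * ∫ z, J z := by
  have hD : 0 ≤ D := (abs_nonneg _).trans (hu x hx)
  rw [nlOp_eq_integral_shift hΩ, ← integral_const_mul, ← Real.norm_eq_abs]
  refine norm_integral_le_of_norm_le (hJ.integrable.const_mul _)
    (Eventually.of_forall fun z => ?_)
  rw [Real.norm_eq_abs, abs_mul, abs_of_nonneg (hJ.nonneg z), mul_comm]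
  refine mul_le_mul_of_nonneg_right ?_ (hJ.nonneg z)
  by_cases h : x - z ∈ Ω
  · simp only [h, indicator_of_mem]
    exact (abs_sub _ _).trans (by linarith [hu x hx, hu _ h])
  · simp only [h, not_false_eq_true, indicator_of_notMem, abs_zero]
    positivity

/-- Away from the boundary the nonlocal operator is bounded on functions with Lipschitz
gradient, uniformly in the kernel. -/
lemma abs_nlOp_le_of_interior (hJ : IsKernel δ J) (hΩ : IsOpen Ω) {u : Space d → ℝ} {D : ℝ}
    (hu : HasC11Bound Ω u D) (hδ : 0 ≤ δ) {x : Space d} (hx : x ∉ Metric.cthickening δ Ωᶜ) :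
    |nlOp J Ω u x| ≤ D * (2 * d) := by
  have hxΩ : x ∈ Ω := mem_of_notMem_cthickening hx (by simpa using hδ)
  have hD : 0 ≤ D := hu.nonneg ⟨x, hxΩ⟩
  set g : Space d → ℝ := fun z => Ω.indicator (fun y => u x - u y) (x - z)
  have hgm : AEStronglyMeasurable g :=
    aestronglyMeasurable_shift hΩ.measurableSet (hu.aestronglyMeasurable hΩ) x
  have hgb : ∀ z, ‖z‖ ≤ δ → |g z - fderiv ℝ u x z| ≤ D * ‖z‖ ^ 2 := by
    intro z hz
    have hmem : x - z ∈ Ω := mem_of_notMem_cthickening hx (by simpa [dist_eq_norm] using hz)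
    have h := hu.abs_sub_sub_le hD (p := x) (x := x) (y := x - z) (r := ‖z‖)
      ((Metric.closedBall_subset_closedBall hz).trans (closedBall_subset_of_notMem hx))
      (by simp) (by simp)
    rw [sub_sub_cancel_left, norm_neg, map_neg] at h
    simp only [g, indicator_of_mem hmem]
    rw [abs_sub_comm] at h
    calc |u x - u (x - z) - fderiv ℝ u x z|
        = |-fderiv ℝ u x z - (u (x - z) - u x)| := by ring_nf
      _ ≤ D * ‖z‖ * ‖z‖ := h
      _ = D * ‖z‖ ^ 2 := by ring
  have hsplit : nlOp J Ω u x = ∫ z, J z * (g z - fderiv ℝ u x z) := by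
    have hlin : Integrable fun z => J z * fderiv ℝ u x z :=
      hJ.integrable_mul (B := ‖fderiv ℝ u x‖ * δ) (by fun_prop) fun z hz =>
        ((fderiv ℝ u x).le_opNorm z).trans (by gcongr)
    have hrem : Integrable fun z => J z * (g z - fderiv ℝ u x z) :=
      hJ.integrable_of_le_sq (hgm.sub (by fun_prop)) hgb
    rw [nlOp_eq_integral_shift hΩ.measurableSet,
      ← add_zero (∫ z, J z * (g z - fderiv ℝ u x z)),
      ← hJ.integral_odd (g := fderiv ℝ u x) (fun z => map_neg _ z), ← integral_add hrem hlin]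
    refine integral_congr_ae (Eventually.of_forall fun z => ?_)
    simp only [g]
    ring
  rw [hsplit]
  exact hJ.norm_integral_le hgb

end NonlocalOperator

/-! ### The nonlocal bilinear form -/

section NonlocalForm

variable {Ω : Set (Space d)} {δ : ℝ} {J : Space d → ℝ}

lemma restrict_prod_eq (Ω : Set (Space d)) :
    (volume : Measure (Space d × Space d)).restrict (Ω ×ˢ Ω)
      = (spaceMeas Ω).prod (spaceMeas Ω) := by
  rw [Measure.prod_restrict, Measure.volume_eq_prod]

lemma IsKernel.integrable_convolution (hJ : IsKernel δ J) (hΩ : MeasurableSet Ω)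
    {v : Space d → ℝ} (hv : Integrable v (spaceMeas Ω)) :
    Integrable (fun p : Space d × Space d => J (p.1 - p.2) * v p.2)
      ((spaceMeas Ω).prod (spaceMeas Ω)) := by
  have h1 : Integrable (Ω.indicator v) := (integrable_indicator_iff hΩ).2 hv
  have h2 := h1.convolution_integrand (ContinuousLinearMap.mul ℝ ℝ) hJ.integrable
  rw [Measure.prod_restrict]
  refine (h2.mono_measure Measure.restrict_le_self).congr ?_
  filter_upwards [ae_restrict_mem (hΩ.prod hΩ)] with p hp
  simp [hp.2, mul_comm]

/-- The integrand of the first half of the nonlocal form. -/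
lemma IsKernel.integrable_form (hJ : IsKernel δ J) (hΩ : MeasurableSet Ω)
    {u v : Space d → ℝ} {D : ℝ} (hum : AEStronglyMeasurable u (spaceMeas Ω))
    (hu : ∀ x ∈ Ω, |u x| ≤ D) (hv : Integrable v (spaceMeas Ω)) :
    Integrable (fun p : Space d × Space d => J (p.1 - p.2) * (u p.1 - u p.2) * v p.2)
      ((spaceMeas Ω).prod (spaceMeas Ω)) := by
  have h := hJ.integrable_convolution hΩ hv
  have hm : AEStronglyMeasurable (fun p : Space d × Space d => u p.1 - u p.2)
      ((spaceMeas Ω).prod (spaceMeas Ω)) := hum.comp_fst.sub hum.comp_snd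
  refine (h.bdd_mul (c := 2 * D) hm ?_).congr
    (Eventually.of_forall fun p => by ring)
  rw [Measure.prod_restrict]
  filter_upwards [ae_restrict_mem (hΩ.prod hΩ)] with p hp
  exact (abs_sub _ _).trans (by linarith [hu p.1 hp.1, hu p.2 hp.2])

lemma nlForm_eq_integral_nlOp_mul (hJ : IsKernel δ J) (hΩ : MeasurableSet Ω)
    {u v : Space d → ℝ} {D : ℝ} (hum : AEStronglyMeasurable u (spaceMeas Ω))
    (hu : ∀ x ∈ Ω, |u x| ≤ D) (hv : Integrable v (spaceMeas Ω)) :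
    nlForm J Ω u v = ∫ x in Ω, nlOp J Ω u x * v x := by
  have h1 := hJ.integrable_form hΩ hum hu hv
  have hsw : ∀ p : Space d × Space d, J (p.1 - p.2) * (u p.1 - u p.2) * v p.1
      = -(J (p.swap.1 - p.swap.2) * (u p.swap.1 - u p.swap.2) * v p.swap.2) := fun p => by
    have : J (p.2 - p.1) = J (p.1 - p.2) := by rw [← hJ.neg, neg_sub]
    simp only [Prod.fst_swap, Prod.snd_swap, this]
    ring
  have h2 : Integrable (fun p : Space d × Space d => J (p.1 - p.2) * (u p.1 - u p.2) * v p.1)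
      ((spaceMeas Ω).prod (spaceMeas Ω)) := by
    simp_rw [hsw]
    exact h1.swap.neg
  have hI : ∫ p : Space d × Space d, J (p.1 - p.2) * (u p.1 - u p.2) * v p.1
        ∂((spaceMeas Ω).prod (spaceMeas Ω))
      = - ∫ p : Space d × Space d, J (p.1 - p.2) * (u p.1 - u p.2) * v p.2
        ∂((spaceMeas Ω).prod (spaceMeas Ω)) := by
    simp_rw [hsw]
    rw [integral_neg]
    congr 1
    exact integral_prod_swap (μ := spaceMeas Ω) (ν := spaceMeas Ω)
      (fun p : Space d × Space d => J (p.1 - p.2) * (u p.1 - u p.2) * v p.2)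
  have hsplit : ∫ p : Space d × Space d, J (p.1 - p.2) * ((u p.1 - u p.2) * (v p.1 - v p.2))
        ∂((spaceMeas Ω).prod (spaceMeas Ω))
      = 2 * ∫ p : Space d × Space d, J (p.1 - p.2) * (u p.1 - u p.2) * v p.1
        ∂((spaceMeas Ω).prod (spaceMeas Ω)) := by
    rw [two_mul]
    nth_rewrite 2 [hI]
    rw [← sub_eq_add_neg, ← integral_sub h2 h1]
    exact integral_congr_ae (Eventually.of_forall fun p => by ring)
  rw [nlForm, restrict_prod_eq, hsplit, integral_prod _ h2, ← mul_assoc]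
  norm_num
  refine integral_congr_ae (Eventually.of_forall fun x => ?_)
  simp only [nlOp]
  rw [← integral_mul_const]

lemma nlForm_comm (u v : Space d → ℝ) : nlForm J Ω u v = nlForm J Ω v u := by
  simp only [nlForm, mul_comm]

lemma integral_nlOp_mul_comm (hJ : IsKernel δ J) (hΩ : MeasurableSet Ω)
    (hb : Bornology.IsBounded Ω) {u v : Space d → ℝ} {D D' : ℝ}
    (hum : AEStronglyMeasurable u (spaceMeas Ω)) (hu : ∀ x ∈ Ω, |u x| ≤ D)
    (hvm : AEStronglyMeasurable v (spaceMeas Ω)) (hv : ∀ x ∈ Ω, |v x| ≤ D') :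
    ∫ x in Ω, nlOp J Ω u x * v x = ∫ x in Ω, u x * nlOp J Ω v x := by
  have := isFiniteMeasure_spaceMeas hb
  have iu : Integrable u (spaceMeas Ω) := Integrable.of_bound hum D
    ((ae_restrict_mem hΩ).mono fun x hx => hu x hx)
  have iv : Integrable v (spaceMeas Ω) := Integrable.of_bound hvm D'
    ((ae_restrict_mem hΩ).mono fun x hx => hv x hx)
  rw [← nlForm_eq_integral_nlOp_mul hJ hΩ hum hu iv, nlForm_comm,
    nlForm_eq_integral_nlOp_mul hJ hΩ hvm hv iu]
  exact integral_congr_ae (Eventually.of_forall fun x => mul_comm _ _)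

lemma memV_of_bound (hJ : IsKernel δ J) (hΩ : MeasurableSet Ω) (hb : Bornology.IsBounded Ω)
    {v : Space d → ℝ} {D : ℝ} (hvm : AEStronglyMeasurable v (spaceMeas Ω))
    (hv : ∀ x ∈ Ω, |v x| ≤ D) : MemV J Ω v := by
  have := isFiniteMeasure_spaceMeas hb
  have hv' : ∀ᵐ x ∂(spaceMeas Ω), ‖v x‖ ≤ D := (ae_restrict_mem hΩ).mono fun x hx => hv x hx
  have iv : Integrable v (spaceMeas Ω) := Integrable.of_bound hvm D hv'
  refine ⟨MemLp.of_bound hvm D hv', ?_⟩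
  rw [nlSemiSq]
  refine ENNReal.mul_lt_top (by simp) ?_
  have h1 := hJ.integrable_form hΩ hvm hv (iv : Integrable v (spaceMeas Ω))
  have hint : Integrable (fun p : Space d × Space d => J (p.1 - p.2) * (v p.1 - v p.2) ^ 2)
      ((spaceMeas Ω).prod (spaceMeas Ω)) := by
    have h2 : Integrable (fun p : Space d × Space d => J (p.1 - p.2) * (v p.1 - v p.2) * 1)
      ((spaceMeas Ω).prod (spaceMeas Ω)) :=
      hJ.integrable_form hΩ (v := fun _ => (1 : ℝ)) hvm hv (integrable_const 1)
    refine (h2.bdd_mul (c := 2 * D) (hvm.comp_fst.sub hvm.comp_snd) ?_).congr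
      (Eventually.of_forall fun p => by simp only [Pi.sub_apply]; ring)
    rw [Measure.prod_restrict]
    filter_upwards [ae_restrict_mem (hΩ.prod hΩ)] with p hp
    exact (abs_sub _ _).trans (by linarith [hv p.1 hp.1, hv p.2 hp.2])
  rw [restrict_prod_eq]
  refine lt_of_le_of_lt (lintegral_mono fun p => ?_) hint.2
  rw [← ofReal_norm]
  exact ENNReal.ofReal_le_ofReal (le_abs_self _)

end NonlocalForm

/-! ### Test functions -/

namespace IsSpaceTest

variable {Ω : Set (Space d)} {ψ : Space d → ℝ}

lemma contDiff_fderiv_apply (hψ : IsSpaceTest Ω ψ) (e : Space d) :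
    IsSpaceTest Ω (fun x => fderiv ℝ ψ x e) := by
  refine ⟨(hψ.1.fderiv_right (m := ∞) (by norm_num)).clm_apply contDiff_const, ?_, ?_⟩
  · exact hψ.2.1.fderiv_apply (𝕜 := ℝ) e
  · exact (tsupport_fderiv_apply_subset ℝ e).trans hψ.2.2

lemma _root_.ContDiff.exists_norm_fderiv_le {E F : Type*} [NormedAddCommGroup E]
    [NormedSpace ℝ E] [NormedAddCommGroup F] [NormedSpace ℝ F] {f : E → F}
    (hf : ContDiff ℝ ∞ f) (hc : HasCompactSupport f) : ∃ C, ∀ x, ‖fderiv ℝ f x‖ ≤ C :=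
  (hf.continuous_fderiv (by norm_num)).bounded_above_of_compact_support (hc.fderiv ℝ)

lemma exists_hasC11Bound (hψ : IsSpaceTest Ω ψ) : ∃ D, 0 ≤ D ∧ ∀ S, HasC11Bound S ψ D := by
  have h1 : ContDiff ℝ ∞ (fderiv ℝ ψ) := hψ.1.fderiv_right (by norm_num)
  obtain ⟨A, hA⟩ := hψ.1.continuous.bounded_above_of_compact_support hψ.2.1
  obtain ⟨B, hB⟩ := hψ.1.exists_norm_fderiv_le hψ.2.1
  obtain ⟨C, hC⟩ := h1.exists_norm_fderiv_le (hψ.2.1.fderiv ℝ)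
  obtain ⟨M, hAM, hBM, hCM⟩ : ∃ M, A ≤ M ∧ B ≤ M ∧ C ≤ M :=
    ⟨max A (max B C), le_max_left _ _, (le_max_left _ _).trans (le_max_right _ _),
      (le_max_right _ _).trans (le_max_right _ _)⟩
  refine ⟨M, (norm_nonneg _).trans ((hA 0).trans hAM), fun S => ?_⟩
  refine ⟨fun x _ => (hA x).trans hAM, fun x _ => hψ.1.differentiable (by norm_num) x,
    fun x _ => (hB x).trans hBM, fun x _ y _ _ => ?_⟩
  refine (Convex.norm_image_sub_le_of_norm_fderiv_le (fun z _ =>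
    h1.differentiable (by norm_num) z) (fun z _ => hC z) convex_univ
      (mem_univ x) (mem_univ y)).trans ?_
  gcongr

lemma memV {δ : ℝ} {J : Space d → ℝ} (hJ : IsKernel δ J) (hΩ : MeasurableSet Ω)
    (hb : Bornology.IsBounded Ω) (hψ : IsSpaceTest Ω ψ) : MemV J Ω ψ := by
  obtain ⟨D, -, hD⟩ := hψ.exists_hasC11Bound
  exact memV_of_bound hJ hΩ hb hψ.1.continuous.aestronglyMeasurable (hD Ω).abs_le

lemma laplacian_eq (ψ : Space d → ℝ) (x : Space d) :
    Laplacian.laplacian ψ x = ∑ i, fderiv ℝ (fderiv ℝ ψ) x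
      (EuclideanSpace.basisFun (Fin d) ℝ i) (EuclideanSpace.basisFun (Fin d) ℝ i) := by
  rw [InnerProductSpace.laplacian_eq_iteratedFDeriv_orthonormalBasis ψ
    (EuclideanSpace.basisFun (Fin d) ℝ)]
  simp [iteratedFDeriv_two_apply]

lemma laplacian_eq_sum (hψ : IsSpaceTest Ω ψ) (x : Space d) :
    Laplacian.laplacian ψ x = ∑ i, fderiv ℝ (fun y => fderiv ℝ ψ y
      (EuclideanSpace.basisFun (Fin d) ℝ i)) x (EuclideanSpace.basisFun (Fin d) ℝ i) := by
  rw [laplacian_eq]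
  refine Finset.sum_congr rfl fun i _ => ?_
  have h1 : ContDiff ℝ ∞ (fderiv ℝ ψ) := hψ.1.fderiv_right (by norm_num)
  rw [fderiv_clm_apply (h1.differentiable (by norm_num) x) (differentiableAt_const _)]
  simp

lemma sum {ι : Type*} (s : Finset ι) {f : ι → Space d → ℝ} (h : ∀ i ∈ s, IsSpaceTest Ω (f i)) :
    IsSpaceTest Ω (fun x => ∑ i ∈ s, f i x) := by
  classical
  induction s using Finset.induction_on with
  | empty =>
    simp only [Finset.sum_empty]
    exact ⟨contDiff_const, HasCompactSupport.zero, by simp [tsupport, Function.support]⟩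
  | insert i s hi ih =>
    simp_rw [Finset.sum_insert hi]
    have hi' := h i (Finset.mem_insert_self i s)
    have hs' := ih fun j hj => h j (Finset.mem_insert_of_mem hj)
    refine ⟨hi'.1.add hs'.1, hi'.2.1.add hs'.2.1, ?_⟩
    exact (tsupport_add (f i) _).trans (union_subset hi'.2.2 hs'.2.2)

lemma laplacian (hψ : IsSpaceTest Ω ψ) : IsSpaceTest Ω (Laplacian.laplacian ψ) := by
  have : Laplacian.laplacian ψ = fun x => ∑ i, fderiv ℝ (fun y => fderiv ℝ ψ y
      (EuclideanSpace.basisFun (Fin d) ℝ i)) x (EuclideanSpace.basisFun (Fin d) ℝ i) :=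
    funext hψ.laplacian_eq_sum
  rw [this]
  exact sum _ fun i _ => (hψ.contDiff_fderiv_apply _).contDiff_fderiv_apply _

lemma nlOp_eq_zero_of_layer {r δ : ℝ} {J : Space d → ℝ} (hJ : IsKernel δ J)
    (hr : ∀ x ∈ Metric.cthickening r Ωᶜ, ∀ y, dist y x ≤ r → ψ y = 0) (hδ0 : 0 ≤ δ)
    (hδ : δ ≤ r) {x : Space d} (hx : x ∈ Metric.cthickening δ Ωᶜ) : nlOp J Ω ψ x = 0 := by
  have hx' := Metric.cthickening_mono hδ _ hx
  have hx0 : ψ x = 0 := hr x hx' x (by simpa using hδ0.trans hδ)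
  rw [nlOp]
  refine integral_eq_zero_of_ae (Eventually.of_forall fun y => ?_)
  simp only [Pi.zero_apply, hx0, zero_sub]
  rcases le_or_gt ‖x - y‖ δ with h | h
  · rw [hr x hx' y (by rw [dist_comm, dist_eq_norm]; exact h.trans hδ)]
    simp
  · rw [hJ.eq_zero_of_lt h, zero_mul]

/-- The nonlocal operator is bounded on a test function uniformly for small horizons. -/
lemma exists_abs_nlOp_le (hΩ : IsOpen Ω) (hψ : IsSpaceTest Ω ψ) :
    ∃ r > 0, ∃ B, 0 ≤ B ∧ ∀ (δ : ℝ) (J : Space d → ℝ), 0 < δ → δ ≤ r → IsKernel δ J →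
      (∀ x, |nlOp J Ω ψ x| ≤ B) ∧ ∀ x ∈ Metric.cthickening δ Ωᶜ, nlOp J Ω ψ x = 0 := by
  obtain ⟨D, hD0, hD⟩ := hψ.exists_hasC11Bound
  obtain ⟨r, hr, hlayer⟩ := hψ.exists_layer hΩ
  refine ⟨r, hr, D * (2 * d), by positivity, fun δ J hδ hδr hJ => ?_⟩
  have h0 : ∀ x ∈ Metric.cthickening δ Ωᶜ, nlOp J Ω ψ x = 0 := fun x hx =>
    nlOp_eq_zero_of_layer hJ hlayer hδ.le hδr hx
  refine ⟨fun x => ?_, h0⟩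
  by_cases hx : x ∈ Metric.cthickening δ Ωᶜ
  · rw [h0 x hx, abs_zero]
    positivity
  · exact abs_nlOp_le_of_interior hJ hΩ (hD Ω) hδ.le hx

/-- On test functions the nonlocal operators converge pointwise to `-Δ`. -/
lemma tendsto_nlOp (hΩ : IsOpen Ω) (hψ : IsSpaceTest Ω ψ) {δ : ℕ → ℝ}
    {J : ℕ → Space d → ℝ} (hJ : ∀ n, IsKernel (δ n) (J n)) (hδ : Tendsto δ atTop (𝓝 0))
    {x : Space d} (hx : x ∈ Ω) :
    Tendsto (fun n => nlOp (J n) Ω ψ x) atTop (𝓝 (-Laplacian.laplacian ψ x)) := by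
  have h1 : ContDiff ℝ ∞ (fderiv ℝ ψ) := hψ.1.fderiv_right (by norm_num)
  set B := fderiv ℝ (fderiv ℝ ψ) x with hB
  have hBd : HasFDerivAt (fderiv ℝ ψ) B x := (h1.differentiable (by norm_num) x).hasFDerivAt
  rw [Metric.tendsto_atTop]
  intro ε hε
  set η : ℝ := ε / (2 * d + 1)
  have hη : 0 < η := by positivity
  obtain ⟨r, hr, hrB⟩ := Metric.eventually_nhds_iff.1 (hBd.isLittleO.def hη)
  have hev : ∀ᶠ s in 𝓝 (0 : ℝ), x ∉ Metric.cthickening s Ωᶜ :=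
    Metric.eventually_notMem_cthickening_of_infEDist_pos
      (by rw [hΩ.isClosed_compl.closure_eq]; simpa using hx)
  obtain ⟨N, hN⟩ := eventually_atTop.1
    ((hδ.eventually hev).and (hδ.eventually (gt_mem_nhds hr)))
  refine ⟨N, fun n hn => ?_⟩
  obtain ⟨hxn, hδn⟩ := hN n hn
  set e : Space d → ℝ := fun z => ψ (x - z) - ψ x + fderiv ℝ ψ x z - 1 / 2 * B z z
  have he : ∀ z, ‖z‖ ≤ δ n → |e z| ≤ η * ‖z‖ ^ 2 := by
    intro z hz
    set g : ℝ → ℝ := fun s => ψ (x - s • z) - ψ x + s * fderiv ℝ ψ x z - 1 / 2 * s ^ 2 * B z z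
    have hg : ∀ s, HasDerivAt g (-((fderiv ℝ ψ (x - s • z) - fderiv ℝ ψ x - B (-(s • z))) z))
        s := by
      intro s
      have hline : HasDerivAt (fun s : ℝ => x - s • z) (-z) s := by
        simpa using ((hasDerivAt_id s).smul_const z).const_sub x
      have hψs := ((hψ.1.differentiable (by norm_num) (x - s • z)).hasFDerivAt
        ).comp_hasDerivAt s hline
      have hlin := (hasDerivAt_id s).mul_const (fderiv ℝ ψ x z)
      have hsq := (((hasDerivAt_id s).pow 2).const_mul (1 / 2 : ℝ)).mul_const (B z z)
      refine (((hψs.sub_const (ψ x)).add hlin).sub hsq).congr_deriv ?_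
      simp
      ring
    have hmv := norm_image_sub_le_of_norm_deriv_le_segment_01' (f := g) (C := η * ‖z‖ ^ 2)
      (fun s _ => (hg s).hasDerivWithinAt) (fun s hs => ?_)
    · have e1 : g 1 - g 0 = e z := by simp [g, e]
      rwa [e1] at hmv
    · have hs1 : ‖s • z‖ ≤ ‖z‖ := by
        rw [norm_smul, Real.norm_of_nonneg hs.1]
        exact mul_le_of_le_one_left (norm_nonneg _) hs.2.le
      have hb := hrB (y := x - s • z) (by
        rw [dist_eq_norm, sub_sub_cancel_left, norm_neg]
        exact hs1.trans_lt (hz.trans_lt hδn))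
      rw [sub_sub_cancel_left, norm_neg] at hb
      rw [norm_neg]
      refine (ContinuousLinearMap.le_opNorm _ z).trans ?_
      calc _ ≤ (η * ‖s • z‖) * ‖z‖ := by gcongr
        _ ≤ (η * ‖z‖) * ‖z‖ := by gcongr
        _ = η * ‖z‖ ^ 2 := by ring
  have hem : AEStronglyMeasurable e := by
    have := hψ.1.continuous
    have : Continuous e := by fun_prop
    exact this.aestronglyMeasurable
  have i1 : Integrable fun z => J n z * e z := (hJ n).integrable_of_le_sq hem he
  have i2 : Integrable fun z => J n z * fderiv ℝ ψ x z :=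
    (hJ n).integrable_mul (B := ‖fderiv ℝ ψ x‖ * δ n) (by fun_prop) fun z hz =>
      ((fderiv ℝ ψ x).le_opNorm z).trans (by gcongr)
  have i3 : Integrable fun z => J n z * B z z := by
    refine (hJ n).integrable_of_le_sq (B := ‖B‖) ?_ fun z _ => ?_
    · have : Continuous fun z => B z z := by fun_prop
      exact this.aestronglyMeasurable
    · refine (B.le_opNorm₂ z z).trans (le_of_eq (by ring))
  have hval : nlOp (J n) Ω ψ x = -Laplacian.laplacian ψ x - ∫ z, J n z * e z := by
    have : nlOp (J n) Ω ψ x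
        = (∫ z, J n z * fderiv ℝ ψ x z) - 1 / 2 * (∫ z, J n z * B z z) - ∫ z, J n z * e z := by
      have i4 : Integrable fun z => J n z * fderiv ℝ ψ x z - 1 / 2 * (J n z * B z z) :=
        i2.sub (i3.const_mul _)
      rw [nlOp_eq_of_interior (hJ n) hΩ.measurableSet ψ hxn, ← integral_const_mul,
        ← integral_sub i2 (i3.const_mul _), ← integral_sub i4 i1]
      refine integral_congr_ae (Eventually.of_forall fun z => ?_)
      simp only [e]
      ring
    rw [this, (hJ n).integral_odd (fun z => map_neg _ z), (hJ n).integral_bilin, laplacian_eq]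
    ring
  rw [hval, dist_eq_norm, sub_sub_cancel_left, norm_neg]
  refine ((hJ n).norm_integral_le he).trans_lt ?_
  simp only [η]
  rw [div_mul_eq_mul_div, div_lt_iff₀ (by positivity)]
  linarith

end IsSpaceTest


/-! ### Consistency of the nonlocal form -/

section Consistency

variable {Ω : Set (Space d)} {δ : ℝ} {J : Space d → ℝ} {u ψ : Space d → ℝ} {D : ℝ}

/-- The increment `u (y + z) - u y`, set to zero unless both points lie in `Ω`. -/
def increment (Ω : Set (Space d)) (u : Space d → ℝ) (z y : Space d) : ℝ :=
  Ω.indicator 1 (y + z) * Ω.indicator 1 y * (Ω.indicator u (y + z) - Ω.indicator u y)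

lemma increment_of_mem {z y : Space d} (h1 : y + z ∈ Ω) (h2 : y ∈ Ω) :
    increment Ω u z y = u (y + z) - u y := by
  simp [increment, h1, h2]

lemma increment_of_notMem {z y : Space d} (h : ¬ (y + z ∈ Ω ∧ y ∈ Ω)) :
    increment Ω u z y = 0 := by
  rw [increment]
  by_cases h1 : y + z ∈ Ω
  · have h2 : y ∉ Ω := fun h2 => h ⟨h1, h2⟩
    simp [h2]
  · simp [h1]

lemma measurable_indicator_of_continuousOn (hΩ : IsOpen Ω) (hu : ContinuousOn u Ω) :
    Measurable (Ω.indicator u) := by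
  classical
  rw [← piecewise_eq_indicator]
  exact hu.measurable_piecewise continuousOn_const hΩ.measurableSet

lemma measurable_increment (hΩ : IsOpen Ω) (hu : ContinuousOn u Ω) :
    Measurable (fun p : Space d × Space d => increment Ω u p.1 p.2) := by
  have h1 : Measurable (Ω.indicator (1 : Space d → ℝ)) :=
    measurable_one.indicator hΩ.measurableSet
  have h2 := measurable_indicator_of_continuousOn hΩ hu
  have hs : Measurable fun p : Space d × Space d => p.2 + p.1 := measurable_snd.add measurable_fst
  exact ((h1.comp hs).mul (h1.comp measurable_snd)).mul
    ((h2.comp hs).sub (h2.comp measurable_snd))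

lemma abs_increment_le (hu : ∀ x ∈ Ω, |u x| ≤ D) (hD : 0 ≤ D) (z y : Space d) :
    |increment Ω u z y| ≤ 2 * D * Ω.indicator 1 y := by
  by_cases h : y + z ∈ Ω ∧ y ∈ Ω
  · rw [increment_of_mem h.1 h.2]
    simp only [h.2, indicator_of_mem, Pi.one_apply, mul_one]
    exact (abs_sub _ _).trans (by linarith [hu _ h.1, hu _ h.2])
  · rw [increment_of_notMem h, abs_zero]
    exact mul_nonneg (by positivity) (indicator_nonneg (fun _ _ => zero_le_one) _)

lemma integrable_indicator_one (hΩ : IsOpen Ω) (hb : Bornology.IsBounded Ω) :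
    Integrable (Ω.indicator (1 : Space d → ℝ)) :=
  (integrable_indicator_iff hΩ.measurableSet).2
    (integrableOn_const (by simpa using hb.measure_lt_top.ne))

lemma integrable_increment_prod (hJ : IsKernel δ J) (hΩ : IsOpen Ω)
    (hb : Bornology.IsBounded Ω) (hu : HasC11Bound Ω u D) (hD : 0 ≤ D) (hψ : IsSpaceTest Ω ψ) :
    Integrable (fun p : Space d × Space d =>
      J p.1 * (increment Ω u p.1 p.2 * (ψ (p.2 + p.1) - ψ p.2))) (volume.prod volume) := by
  obtain ⟨B, hB0, hB⟩ := hψ.exists_hasC11Bound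
  have hψb : ∀ x, |ψ x| ≤ B := fun x => (hB univ).abs_le x (mem_univ x)
  have hdom := (hJ.integrable.mul_prod (integrable_indicator_one hΩ hb)).const_mul
    (2 * D * (2 * B))
  have hcont := hψ.1.continuous
  refine hdom.mono' ?_ (Eventually.of_forall fun p => ?_)
  · have hcm : Measurable fun p : Space d × Space d => ψ (p.2 + p.1) - ψ p.2 := by
      have : Continuous fun p : Space d × Space d => ψ (p.2 + p.1) - ψ p.2 := by fun_prop
      exact this.measurable
    exact hJ.integrable.aestronglyMeasurable.comp_fst.mul
      ((measurable_increment hΩ hu.continuousOn).mul hcm).aestronglyMeasurable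
  · rw [Real.norm_eq_abs, abs_mul, abs_mul, abs_of_nonneg (hJ.nonneg _)]
    have h1 := abs_increment_le hu.abs_le hD p.1 p.2
    have h2 : |ψ (p.2 + p.1) - ψ p.2| ≤ 2 * B :=
      (abs_sub _ _).trans (by linarith [hψb (p.2 + p.1), hψb p.2])
    calc J p.1 * (|increment Ω u p.1 p.2| * |ψ (p.2 + p.1) - ψ p.2|)
        ≤ J p.1 * ((2 * D * Ω.indicator 1 p.2) * (2 * B)) := by
          refine mul_le_mul_of_nonneg_left ?_ (hJ.nonneg _)
          exact mul_le_mul h1 h2 (abs_nonneg _) ((abs_nonneg _).trans h1)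
      _ = 2 * D * (2 * B) * (J p.1 * Ω.indicator 1 p.2) := by ring

lemma nlForm_eq_integral_increment (hJ : IsKernel δ J) (hΩ : IsOpen Ω)
    (hb : Bornology.IsBounded Ω) (hu : HasC11Bound Ω u D) (hD : 0 ≤ D) (hψ : IsSpaceTest Ω ψ) :
    nlForm J Ω u ψ
      = 1 / 2 * ∫ z, J z * ∫ y, increment Ω u z y * (ψ (y + z) - ψ y) := by
  have hint := integrable_increment_prod hJ hΩ hb hu hD hψ
  have hmp := measurePreserving_sub_prod (volume : Measure (Space d)) volume
  rw [nlForm, ← integral_indicator (hΩ.measurableSet.prod hΩ.measurableSet)]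
  congr 1
  simp_rw [← integral_const_mul]
  rw [← integral_prod (fun p : Space d × Space d =>
    J p.1 * (increment Ω u p.1 p.2 * (ψ (p.2 + p.1) - ψ p.2))) hint]
  conv_rhs => rw [← hmp.map_eq]
  rw [integral_map hmp.measurable.aemeasurable (by rw [hmp.map_eq]; exact hint.1),
    Measure.volume_eq_prod]
  refine integral_congr_ae (Eventually.of_forall fun p => ?_)
  simp only [add_sub_cancel]
  by_cases h : p.1 ∈ Ω ∧ p.2 ∈ Ω
  · rw [indicator_of_mem (by exact h), increment_of_mem (by simpa using h.1) h.2]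
    simp
  · rw [indicator_of_notMem (by exact h), increment_of_notMem (by simpa using h)]
    simp

/-- The weight measuring the consistency error: `δ` in the interior, `K + 1` in the layer. -/
def layerWeight (Ω : Set (Space d)) (K δ : ℝ) (x : Space d) : ℝ :=
  δ + (Metric.cthickening δ Ωᶜ).indicator (fun _ => K + 1) x

lemma layerWeight_nonneg {K : ℝ} (hK : 0 ≤ K) (hδ : 0 ≤ δ) (x : Space d) :
    0 ≤ layerWeight Ω K δ x :=
  add_nonneg hδ (indicator_nonneg (fun _ _ => by positivity) x)

lemma measurable_layerWeight (K : ℝ) : Measurable (layerWeight Ω K δ) :=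
  measurable_const.add (measurable_const.indicator Metric.isClosed_cthickening.measurableSet)

lemma layerWeight_le {K : ℝ} (hK : 0 ≤ K) (x : Space d) :
    layerWeight Ω K δ x ≤ δ + (K + 1) := by
  rw [layerWeight]
  gcongr
  exact indicator_le_self' (fun _ _ => by positivity) x

lemma abs_increment_sub_le {K r : ℝ} (hK : 0 ≤ K) (hqc : IsQuasiConvex Ω K r)
    (hu : HasC11Bound Ω u D) (hδr : δ < r) {x z : Space d} (hx : x ∈ Ω) (hz : ‖z‖ ≤ δ)
    {s : ℝ} (hs : s ∈ Icc (0 : ℝ) 1) :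
    |increment Ω u z (x - s • z) - fderiv ℝ u x z| ≤ D * ‖z‖ * layerWeight Ω K δ x := by
  have hD : 0 ≤ D := hu.nonneg ⟨x, hx⟩
  have hδ : 0 ≤ δ := (norm_nonneg z).trans hz
  by_cases hl : x ∈ Metric.cthickening δ Ωᶜ
  · have h1 : |increment Ω u z (x - s • z)| ≤ K * D * ‖z‖ := by
      by_cases h : x - s • z + z ∈ Ω ∧ x - s • z ∈ Ω
      · rw [increment_of_mem h.1 h.2]
        have := hqc u D hu _ h.2 _ h.1 (by rw [add_sub_cancel_left]; linarith)
        rwa [add_sub_cancel_left] at this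
      · rw [increment_of_notMem h, abs_zero]
        positivity
    have h2 : |fderiv ℝ u x z| ≤ D * ‖z‖ :=
      ((fderiv ℝ u x).le_opNorm z).trans
        (mul_le_mul_of_nonneg_right (hu.norm_fderiv_le x hx) (norm_nonneg z))
    rw [layerWeight, indicator_of_mem hl]
    refine (abs_sub _ _).trans ?_
    have : 0 ≤ D * ‖z‖ * δ := by positivity
    linarith
  · have hball := closedBall_subset_of_notMem hl
    have hsz : ‖s • z‖ ≤ δ := by
      rw [norm_smul, Real.norm_of_nonneg hs.1]
      exact (mul_le_of_le_one_left (norm_nonneg _) hs.2).trans hz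
    have hsz' : ‖(1 - s) • z‖ ≤ δ := by
      rw [norm_smul, Real.norm_of_nonneg (by linarith [hs.2])]
      exact (mul_le_of_le_one_left (norm_nonneg _) (by linarith [hs.1])).trans hz
    have m1 : x - s • z ∈ Metric.closedBall x δ := by simpa using hsz
    have m2 : x - s • z + z ∈ Metric.closedBall x δ := by
      have : x - s • z + z = x + (1 - s) • z := by rw [sub_smul, one_smul]; abel
      rw [this]
      simpa using hsz'
    rw [increment_of_mem (hball m2) (hball m1), layerWeight, indicator_of_notMem hl, add_zero]
    have := hu.abs_sub_sub_le hD hball m1 m2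
    rw [add_sub_cancel_left] at this
    exact this.trans (le_of_eq (by ring))

lemma IsSpaceTest.fderiv_eq_zero (hψ : IsSpaceTest Ω ψ) {x : Space d} (hx : x ∉ Ω) :
    fderiv ℝ ψ x = 0 := by
  by_contra h
  exact hx (hψ.2.2 (support_fderiv_subset ℝ h))

lemma measurable_fderiv_apply_prod (u : Space d → ℝ) :
    Measurable fun p : Space d × Space d => fderiv ℝ u p.1 p.2 := by
  have h : Continuous fun q : (Space d →L[ℝ] ℝ) × Space d => q.1 q.2 :=
    isBoundedBilinearMap_apply.continuous
  exact h.measurable.comp (((measurable_fderiv ℝ u).comp measurable_fst).prodMk measurable_snd)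

lemma integrable_layerWeight_mul {K : ℝ} (hK : 0 ≤ K) (hδ : 0 ≤ δ)
    (hb : Bornology.IsBounded Ω) (hψ : IsSpaceTest Ω ψ) :
    Integrable (fun x => layerWeight Ω K δ x * ‖fderiv ℝ ψ x‖) (spaceMeas Ω) := by
  have := isFiniteMeasure_spaceMeas hb
  obtain ⟨B, hB0, hB⟩ := hψ.exists_hasC11Bound
  refine Integrable.of_bound (C := (δ + (K + 1)) * B)
    ((measurable_layerWeight K).mul (measurable_fderiv ℝ ψ).norm).aestronglyMeasurable
    (Eventually.of_forall fun x => ?_)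
  rw [Real.norm_eq_abs, abs_mul, abs_of_nonneg (layerWeight_nonneg hK hδ x), abs_norm]
  exact mul_le_mul (layerWeight_le hK x) ((hB univ).norm_fderiv_le x (mem_univ x))
    (norm_nonneg _) (by positivity)

lemma integrable_fderiv_mul_fderiv (hΩ : IsOpen Ω) (hb : Bornology.IsBounded Ω)
    (hu : HasC11Bound Ω u D) (hψ : IsSpaceTest Ω ψ) (z : Space d) :
    Integrable (fun x => fderiv ℝ u x z * fderiv ℝ ψ x z) (spaceMeas Ω) := by
  have := isFiniteMeasure_spaceMeas hb
  obtain ⟨B, hB0, hB⟩ := hψ.exists_hasC11Bound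
  refine Integrable.of_bound (C := (D * ‖z‖) * (B * ‖z‖))
    ((measurable_fderiv_apply_const ℝ u z).mul
      (measurable_fderiv_apply_const ℝ ψ z)).aestronglyMeasurable ?_
  filter_upwards [ae_restrict_mem hΩ.measurableSet] with x hx
  rw [norm_mul]
  have hD : 0 ≤ D := hu.nonneg ⟨x, hx⟩
  refine mul_le_mul ((ContinuousLinearMap.le_opNorm _ z).trans ?_)
    ((ContinuousLinearMap.le_opNorm _ z).trans ?_) (norm_nonneg _) (by positivity)
  · exact mul_le_mul_of_nonneg_right (hu.norm_fderiv_le x hx) (norm_nonneg z)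
  · exact mul_le_mul_of_nonneg_right ((hB univ).norm_fderiv_le x (mem_univ x)) (norm_nonneg z)

/-- The consistency error of a single increment direction. -/
lemma abs_integral_increment_sub_le {K r : ℝ} (hK : 0 ≤ K) (hΩ : IsOpen Ω)
    (hb : Bornology.IsBounded Ω) (hqc : IsQuasiConvex Ω K r)
    (hu : HasC11Bound Ω u D) (hD : 0 ≤ D) (hδr : δ < r) (hψ : IsSpaceTest Ω ψ)
    {z : Space d} (hz : ‖z‖ ≤ δ) :
    |(∫ y, increment Ω u z y * (ψ (y + z) - ψ y))
        - ∫ x in Ω, fderiv ℝ u x z * fderiv ℝ ψ x z|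
      ≤ (D * ∫ x in Ω, layerWeight Ω K δ x * ‖fderiv ℝ ψ x‖) * ‖z‖ ^ 2 := by
  have hδ : 0 ≤ δ := (norm_nonneg z).trans hz
  obtain ⟨B, hB0, hB⟩ := hψ.exists_hasC11Bound
  have hψb : ∀ x, |ψ x| ≤ B := fun x => (hB univ).abs_le x (mem_univ x)
  have hdψb : ∀ x, ‖fderiv ℝ ψ x‖ ≤ B := fun x => (hB univ).norm_fderiv_le x (mem_univ x)
  have hψc := hψ.1.continuous
  have hψd : Differentiable ℝ ψ := hψ.1.differentiable (by norm_num)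
  have hdψc : Continuous fun x => fderiv ℝ ψ x z :=
    (hψ.contDiff_fderiv_apply z).1.continuous
  have hmeas : Measurable (increment Ω u z) :=
    (measurable_increment hΩ hu.continuousOn).comp measurable_prodMk_left
  have hdom := integrable_indicator_one hΩ hb
  have hint : ∀ g : Space d → ℝ, Continuous g → ∀ A : ℝ, (∀ y, |g y| ≤ A) →
      Integrable fun y => increment Ω u z y * g y := by
    intro g hg A hA
    refine (hdom.const_mul (2 * D * A)).mono' (hmeas.mul hg.measurable).aestronglyMeasurable
      (Eventually.of_forall fun y => ?_)
    rw [norm_mul]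
    have h1 := abs_increment_le hu.abs_le hD z y
    calc _ ≤ (2 * D * Ω.indicator 1 y) * A :=
          mul_le_mul h1 (hA y) (abs_nonneg _) ((abs_nonneg _).trans h1)
      _ = _ := by ring
  set T : ℝ := ∫ x in Ω, fderiv ℝ u x z * fderiv ℝ ψ x z
  set h : ℝ → ℝ := fun s => ∫ y, increment Ω u z y * ψ (y + s • z)
  have hderiv : ∀ s, HasDerivAt h (∫ y, increment Ω u z y * fderiv ℝ ψ (y + s • z) z) s := by
    intro s
    refine (hasDerivAt_integral_of_dominated_loc_of_deriv_le (μ := volume)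
      (F := fun s y => increment Ω u z y * ψ (y + s • z))
      (F' := fun s y => increment Ω u z y * fderiv ℝ ψ (y + s • z) z)
      (bound := fun y => 2 * D * Ω.indicator 1 y * (B * ‖z‖)) (s := univ) univ_mem ?_ ?_ ?_ ?_ ?_
      ?_).2
    · exact Eventually.of_forall fun s =>
        (hint _ (hψc.comp (by fun_prop)) B fun y => hψb _).1
    · exact hint _ (hψc.comp (by fun_prop)) B fun y => hψb _
    · exact hmeas.aestronglyMeasurable.mul
        (hdψc.comp (continuous_add_const (s • z))).aestronglyMeasurable
    · refine Eventually.of_forall fun y s _ => ?_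
      rw [norm_mul]
      have h1 := abs_increment_le hu.abs_le hD z y
      refine mul_le_mul h1 ((ContinuousLinearMap.le_opNorm _ z).trans ?_) (norm_nonneg _)
        ((abs_nonneg _).trans h1)
      exact mul_le_mul_of_nonneg_right (hdψb _) (norm_nonneg z)
    · exact (hdom.const_mul (2 * D)).mul_const _
    · refine Eventually.of_forall fun y s _ => ?_
      have hline : HasDerivAt (fun s : ℝ => y + s • z) z s := by
        simpa using ((hasDerivAt_id s).smul_const z).const_add y
      exact ((hψd _).hasFDerivAt.comp_hasDerivAt s hline).const_mul _
  have hkey : ∀ s ∈ Icc (0 : ℝ) 1, |(∫ y, increment Ω u z y * fderiv ℝ ψ (y + s • z) z) - T|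
      ≤ (D * ∫ x in Ω, layerWeight Ω K δ x * ‖fderiv ℝ ψ x‖) * ‖z‖ ^ 2 := by
    intro s hs
    have hi : Integrable fun y => increment Ω u z y * fderiv ℝ ψ (y + s • z) z :=
      hint _ (hdψc.comp (continuous_add_const (s • z))) (B * ‖z‖) fun y =>
        (ContinuousLinearMap.le_opNorm _ z).trans
          (mul_le_mul_of_nonneg_right (hdψb _) (norm_nonneg z))
    have hi' : Integrable fun x => increment Ω u z (x - s • z) * fderiv ℝ ψ x z := by
      simpa using hi.comp_sub_right (s • z)
    have hshift : ∫ y, increment Ω u z y * fderiv ℝ ψ (y + s • z) z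
        = ∫ x in Ω, increment Ω u z (x - s • z) * fderiv ℝ ψ x z := by
      rw [setIntegral_eq_integral_of_forall_compl_eq_zero, ← integral_sub_right_eq_self _ (s • z)]
      · simp
      · intro x hx
        rw [hψ.fderiv_eq_zero hx]
        simp
    rw [hshift, ← integral_sub hi'.integrableOn
      (integrable_fderiv_mul_fderiv hΩ hb hu hψ z), mul_right_comm, ← integral_const_mul,
      ← Real.norm_eq_abs]
    refine norm_integral_le_of_norm_le
      ((integrable_layerWeight_mul hK hδ hb hψ).const_mul _) ?_
    filter_upwards [ae_restrict_mem hΩ.measurableSet] with x hx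
    rw [← sub_mul, norm_mul]
    calc _ ≤ (D * ‖z‖ * layerWeight Ω K δ x) * (‖fderiv ℝ ψ x‖ * ‖z‖) := by
          refine mul_le_mul (abs_increment_sub_le hK hqc hu hδr hx hz hs)
            (ContinuousLinearMap.le_opNorm _ z) (norm_nonneg _) ?_
          have := layerWeight_nonneg (Ω := Ω) hK hδ x
          positivity
      _ = D * ‖z‖ ^ 2 * (layerWeight Ω K δ x * ‖fderiv ℝ ψ x‖) := by ring
  have hmv := norm_image_sub_le_of_norm_deriv_le_segment_01' (f := fun s => h s - s * T)
    (f' := fun s => (∫ y, increment Ω u z y * fderiv ℝ ψ (y + s • z) z) - T)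
    (fun s _ => by
      have := ((hderiv s).sub ((hasDerivAt_id s).mul_const T)).hasDerivWithinAt (s := Icc 0 1)
      rwa [one_mul] at this)
    (fun s hs => hkey s ⟨hs.1, hs.2.le⟩)
  have hdiff : h 1 - 1 * T - (h 0 - 0 * T)
      = (∫ y, increment Ω u z y * (ψ (y + z) - ψ y)) - T := by
    have : h 1 - h 0 = ∫ y, increment Ω u z y * (ψ (y + z) - ψ y) := by
      simp only [h]
      have hs : ∀ s : ℝ, Integrable fun y => increment Ω u z y * ψ (y + s • z) := fun s =>
        hint _ (hψc.comp (continuous_add_const (s • z))) B fun y => hψb _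
      rw [← integral_sub (hs 1) (hs 0)]
      refine integral_congr_ae (Eventually.of_forall fun y => ?_)
      simp
      ring
    rw [← this]
    ring
  rwa [hdiff] at hmv

/-- The Euclidean pairing of two linear forms. -/
def formDot (a b : Space d →L[ℝ] ℝ) : ℝ :=
  ∑ i, a (EuclideanSpace.basisFun (Fin d) ℝ i) * b (EuclideanSpace.basisFun (Fin d) ℝ i)

lemma formDot_fderiv (u v : Space d → ℝ) (x : Space d) :
    formDot (fderiv ℝ u x) (fderiv ℝ v x) = inner ℝ (gradient u x) (gradient v x) := by
  rw [← (EuclideanSpace.basisFun (Fin d) ℝ).sum_inner_mul_inner, formDot]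
  refine Finset.sum_congr rfl fun i _ => ?_
  have h (w : Space d → ℝ) (e : Space d) : inner ℝ (gradient w x) e = fderiv ℝ w x e := by
    rw [gradient, InnerProductSpace.toDual_symm_apply]
  rw [h, real_inner_comm, h]

/-- Quantitative consistency of the nonlocal form with the Dirichlet form on test functions. -/
theorem abs_nlForm_sub_le {K r : ℝ} (hK : 0 ≤ K) (hΩ : IsOpen Ω)
    (hb : Bornology.IsBounded Ω) (hqc : IsQuasiConvex Ω K r) (hJ : IsKernel δ J)
    (hu : HasC11Bound Ω u D) (hD : 0 ≤ D) (hδr : δ < r) (hψ : IsSpaceTest Ω ψ) :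
    |nlForm J Ω u ψ - ∫ x in Ω, inner ℝ (gradient u x) (gradient ψ x)|
      ≤ d * D * ∫ x in Ω, layerWeight Ω K δ x * ‖fderiv ℝ ψ x‖ := by
  have := isFiniteMeasure_spaceMeas hb
  obtain ⟨B, hB0, hB⟩ := hψ.exists_hasC11Bound
  have hdψb : ∀ x, ‖fderiv ℝ ψ x‖ ≤ B := fun x => (hB univ).norm_fderiv_le x (mem_univ x)
  have hint : Integrable (fun p : Space d × Space d =>
      J p.1 * (fderiv ℝ u p.2 p.1 * fderiv ℝ ψ p.2 p.1)) (volume.prod (spaceMeas Ω)) := by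
    have hdom := (hJ.integrable_sq.mul_prod (integrable_const (μ := spaceMeas Ω) (1 : ℝ))).const_mul
      (D * B)
    refine hdom.mono' ?_ ?_
    · exact hJ.integrable.aestronglyMeasurable.comp_fst.mul
        (((measurable_fderiv_apply_prod u).comp measurable_swap).mul
          ((measurable_fderiv_apply_prod ψ).comp measurable_swap)).aestronglyMeasurable
    · filter_upwards [Measure.quasiMeasurePreserving_snd.ae
        (ae_restrict_mem hΩ.measurableSet)] with p hp
      rw [norm_mul, Real.norm_of_nonneg (hJ.nonneg _), norm_mul]
      calc J p.1 * (‖fderiv ℝ u p.2 p.1‖ * ‖fderiv ℝ ψ p.2 p.1‖)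
          ≤ J p.1 * ((D * ‖p.1‖) * (B * ‖p.1‖)) := by
            refine mul_le_mul_of_nonneg_left ?_ (hJ.nonneg _)
            refine mul_le_mul ((ContinuousLinearMap.le_opNorm _ _).trans ?_)
              ((ContinuousLinearMap.le_opNorm _ _).trans ?_) (norm_nonneg _) (by positivity)
            · exact mul_le_mul_of_nonneg_right (hu.norm_fderiv_le _ hp) (norm_nonneg _)
            · exact mul_le_mul_of_nonneg_right (hdψb _) (norm_nonneg _)
        _ = D * B * (J p.1 * ‖p.1‖ ^ 2 * 1) := by ring
  have hlocal : ∫ x in Ω, inner ℝ (gradient u x) (gradient ψ x)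
      = 1 / 2 * ∫ z, J z * ∫ x in Ω, fderiv ℝ u x z * fderiv ℝ ψ x z := by
    simp_rw [← integral_const_mul (J _)]
    rw [integral_integral_swap hint, ← integral_const_mul]
    refine integral_congr_ae (Eventually.of_forall fun x => ?_)
    simp only
    rw [hJ.integral_linear_mul_linear, ← formDot_fderiv, formDot]
    ring
  have i1 : Integrable fun z => J z * ∫ y, increment Ω u z y * (ψ (y + z) - ψ y) := by
    have := (integrable_increment_prod hJ hΩ hb hu hD hψ).integral_prod_left
    simpa only [integral_const_mul] using this
  have i2 : Integrable fun z => J z * ∫ x in Ω, fderiv ℝ u x z * fderiv ℝ ψ x z := by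
    have := hint.integral_prod_left
    simpa only [integral_const_mul] using this
  rw [nlForm_eq_integral_increment hJ hΩ hb hu hD hψ, hlocal, ← mul_sub, ← integral_sub i1 i2]
  simp_rw [← mul_sub]
  rw [abs_mul, abs_of_nonneg (by norm_num : (0 : ℝ) ≤ 1 / 2)]
  have := hJ.norm_integral_le (g := fun z =>
      (∫ y, increment Ω u z y * (ψ (y + z) - ψ y)) - ∫ x in Ω, fderiv ℝ u x z * fderiv ℝ ψ x z)
    (B := D * ∫ x in Ω, layerWeight Ω K δ x * ‖fderiv ℝ ψ x‖)
    (fun z hz => abs_integral_increment_sub_le hK hΩ hb hqc hu hD hδr hψ hz)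
  linarith

end Consistency


/-! ### Measurability of functions valued in the dual of a separable Hilbert space -/

lemma Orthonormal.countable_index {ι H : Type*} [NormedAddCommGroup H] [InnerProductSpace ℝ H]
    [TopologicalSpace.SeparableSpace H] {b : ι → H} (hb : Orthonormal ℝ b) : Countable ι := by
  refine Pairwise.countable_of_isOpen_disjoint (s := fun i => Metric.ball (b i) (1 / 2))
    (fun i j hij => ?_) (fun i => Metric.isOpen_ball)
    (fun i => ⟨b i, Metric.mem_ball_self (by norm_num)⟩)
  refine Metric.ball_disjoint_ball ?_
  have h : ‖b i - b j‖ ^ 2 = 2 := by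
    rw [norm_sub_sq_real, hb.1 i, hb.1 j, hb.2 hij]
    norm_num
  rw [dist_eq_norm]
  nlinarith [norm_nonneg (b i - b j)]

/-- A weakly-* measurable function into the dual of a separable Hilbert space is strongly
measurable. -/
theorem aestronglyMeasurable_dual {α H : Type*} [MeasurableSpace α] {μ : Measure α}
    [NormedAddCommGroup H] [InnerProductSpace ℝ H] [CompleteSpace H]
    [TopologicalSpace.SeparableSpace H] {F : α → StrongDual ℝ H}
    (hF : ∀ v, AEStronglyMeasurable (fun t => F t v) μ) : AEStronglyMeasurable F μ := by
  obtain ⟨w, b, -⟩ := exists_hilbertBasis ℝ H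
  have : Countable w := Orthonormal.countable_index b.orthonormal
  set g : α → H := fun t => (InnerProductSpace.toDual ℝ H).symm (F t)
  have hg : AEStronglyMeasurable g μ := by
    refine aestronglyMeasurable_of_tendsto_ae (atTop : Filter (Finset w))
      (f := fun s t => ∑ i ∈ s, F t (b i) • b i) (fun s => ?_)
      (Eventually.of_forall fun t => ?_)
    · exact Finset.aestronglyMeasurable_fun_sum s fun i _ => (hF (b i)).smul_const _
    · have h := b.hasSum_repr (g t)
      have hr : ∀ i, b.repr (g t) i = F t (b i) := fun i => by
        rw [b.repr_apply_apply, real_inner_comm, InnerProductSpace.toDual_symm_apply]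
      simp_rw [hr] at h
      exact h
  have : F = fun t => InnerProductSpace.toDual ℝ H (g t) := by
    funext t
    simp [g]
  rw [this]
  exact (InnerProductSpace.toDual ℝ H).continuous.comp_aestronglyMeasurable hg

/-! ### `H¹₀(Ω)` and its dual -/

section Dual

variable {Ω : Set (Space d)}

lemma IsSpaceTest.zero : IsSpaceTest Ω (fun _ => 0) :=
  ⟨contDiff_const, HasCompactSupport.zero, by simp [tsupport, Function.support]⟩

lemma IsSpaceTest.add {ψ χ : Space d → ℝ} (hψ : IsSpaceTest Ω ψ) (hχ : IsSpaceTest Ω χ) :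
    IsSpaceTest Ω (ψ + χ) :=
  ⟨hψ.1.add hχ.1, hψ.2.1.add hχ.2.1, (tsupport_add ψ χ).trans (union_subset hψ.2.2 hχ.2.2)⟩

lemma IsSpaceTest.const_smul {ψ : Space d → ℝ} (hψ : IsSpaceTest Ω ψ) (a : ℝ) :
    IsSpaceTest Ω (a • ψ) :=
  ⟨contDiff_const.smul hψ.1, hψ.2.1.smul_left (f := fun _ => a),
    (tsupport_smul_subset_right (fun _ => a) ψ).trans hψ.2.2⟩

lemma IsSpaceTest.differentiable {ψ : Space d → ℝ} (hψ : IsSpaceTest Ω ψ) :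
    Differentiable ℝ ψ := hψ.1.differentiable (by norm_num)

lemma exists_test_of_mem_span
    {q : WithLp 2 (Lp ℝ 2 (spaceMeas Ω) × Lp (Space d) 2 (spaceMeas Ω))}
    (hq : q ∈ Submodule.span ℝ {q : WithLp 2 (Lp ℝ 2 (spaceMeas Ω) × Lp (Space d) 2 (spaceMeas Ω)) |
      ∃ ψ : Space d → ℝ, IsSpaceTest Ω ψ ∧
      q.fst =ᵐ[spaceMeas Ω] ψ ∧ q.snd =ᵐ[spaceMeas Ω] gradient ψ}) :
    ∃ ψ : Space d → ℝ, IsSpaceTest Ω ψ ∧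
      q.fst =ᵐ[spaceMeas Ω] ψ ∧ q.snd =ᵐ[spaceMeas Ω] gradient ψ := by
  induction hq using Submodule.span_induction with
  | mem q h => exact h
  | zero =>
    refine ⟨fun _ => 0, IsSpaceTest.zero, Lp.coeFn_zero _ _ _, ?_⟩
    refine (Lp.coeFn_zero (Space d) 2 (spaceMeas Ω)).trans (Eventually.of_forall fun x => ?_)
    simp [gradient]
  | add p q _ _ hp hq =>
    obtain ⟨ψ, hψ, h1, h2⟩ := hp
    obtain ⟨χ, hχ, h3, h4⟩ := hq
    refine ⟨ψ + χ, hψ.add hχ, (Lp.coeFn_add p.fst q.fst).trans (h1.add h3),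
      (Lp.coeFn_add p.snd q.snd).trans ((h2.add h4).trans (Eventually.of_forall fun x => ?_))⟩
    simp only [gradient, Pi.add_apply]
    rw [fderiv_add (hψ.differentiable x) (hχ.differentiable x), map_add]
  | smul a q _ hq =>
    obtain ⟨ψ, hψ, h1, h2⟩ := hq
    refine ⟨a • ψ, hψ.const_smul a, (Lp.coeFn_smul a q.fst).trans (h1.const_smul a),
      (Lp.coeFn_smul a q.snd).trans ((h2.const_smul a).trans (Eventually.of_forall fun x => ?_))⟩
    simp only [gradient, Pi.smul_apply]
    rw [fderiv_const_smul (hψ.differentiable x), map_smul]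

/-- `v` is (the class of) a test function `ψ`, together with its gradient. -/
def IsTestElem (v : H10 Ω) (ψ : Space d → ℝ) : Prop :=
  IsSpaceTest Ω ψ ∧ fn v =ᵐ[spaceMeas Ω] ψ ∧ grad v =ᵐ[spaceMeas Ω] gradient ψ

lemma dense_isTestElem : Dense {v : H10 Ω | ∃ ψ, IsTestElem v ψ} := by
  rw [Metric.dense_iff]
  intro v r hr
  obtain ⟨q, hq, hqv⟩ := Metric.mem_closure_iff.1 v.2 r hr
  obtain ⟨ψ, hψ⟩ := exists_test_of_mem_span hq
  refine ⟨⟨q, Submodule.le_topologicalClosure _ hq⟩, ?_, ψ, hψ⟩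
  rw [Metric.mem_ball, dist_comm]
  exact hqv

/-- A property that is closed and holds for test functions holds on `H¹₀(Ω)`. -/
lemma H10.induction_on {P : H10 Ω → Prop} (v : H10 Ω) (hP : IsClosed {v | P v})
    (h : ∀ v ψ, IsTestElem v ψ → P v) : P v :=
  isClosed_property (e := ((↑) : {v : H10 Ω | ∃ ψ, IsTestElem v ψ} → H10 Ω))
    (by simpa [DenseRange] using dense_isTestElem (Ω := Ω)) hP
    (fun w => w.2.elim fun ψ hψ => h w ψ hψ) v

instance : CompleteSpace (H10 Ω) :=
  (Submodule.isClosed_topologicalClosure _).completeSpace_coe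

instance : TopologicalSpace.SeparableSpace (H10 Ω) := by
  have : Fact ((2 : ℝ≥0∞) ≠ ⊤) := ⟨by norm_num⟩
  have : SecondCountableTopology
      (WithLp 2 (Lp ℝ 2 (spaceMeas Ω) × Lp (Space d) 2 (spaceMeas Ω))) :=
    WithLp.secondCountableTopology 2 _ _
  infer_instance

lemma memLp_fn (v : H10 Ω) : MemLp (fn v) 2 (spaceMeas Ω) := Lp.memLp v.1.fst

lemma memLp_grad (v : H10 Ω) : MemLp (grad v) 2 (spaceMeas Ω) := Lp.memLp v.1.snd

lemma norm_fst_le (v : H10 Ω) : ‖v.1.fst‖ ≤ ‖v‖ := WithLp.norm_fst_le _ v.1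

lemma norm_snd_le (v : H10 Ω) : ‖v.1.snd‖ ≤ ‖v‖ := WithLp.norm_snd_le _ v.1

/-- The functional `v ↦ ∫ a v + ∫ P · ∇v` on `H¹₀(Ω)`. -/
def dualPair {a : Space d → ℝ} {P : Space d → Space d} (ha : MemLp a 2 (spaceMeas Ω))
    (hP : MemLp P 2 (spaceMeas Ω)) : HNeg Ω :=
  (innerSL ℝ (WithLp.toLp 2 (ha.toLp a, hP.toLp P))).comp (H10 Ω).subtypeL

lemma dualPair_apply {a : Space d → ℝ} {P : Space d → Space d} (ha : MemLp a 2 (spaceMeas Ω))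
    (hP : MemLp P 2 (spaceMeas Ω)) (v : H10 Ω) :
    dualPair ha hP v = (∫ x in Ω, a x * fn v x) + ∫ x in Ω, inner ℝ (P x) (grad v x) := by
  have h1 : dualPair ha hP v
      = inner ℝ (ha.toLp a) v.1.fst + inner ℝ (hP.toLp P) v.1.snd := by
    simp only [dualPair, ContinuousLinearMap.comp_apply, innerSL_apply_apply,
      Submodule.subtypeL_apply]
    rw [WithLp.prod_inner_apply]
    rfl
  rw [h1, L2.inner_def, L2.inner_def]
  congr 1
  · refine integral_congr_ae ?_
    filter_upwards [ha.coeFn_toLp] with x hx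
    rw [hx]
    simp [fn, mul_comm]
  · refine integral_congr_ae ?_
    filter_upwards [hP.coeFn_toLp] with x hx
    rw [hx]
    rfl

lemma norm_dualPair_le {a : Space d → ℝ} {P : Space d → Space d} (ha : MemLp a 2 (spaceMeas Ω))
    (hP : MemLp P 2 (spaceMeas Ω)) :
    ‖dualPair ha hP‖ ≤ (eLpNorm a 2 (spaceMeas Ω)).toReal + (eLpNorm P 2 (spaceMeas Ω)).toReal := by
  refine ContinuousLinearMap.opNorm_le_bound _ (by positivity) fun v => ?_
  have h1 : dualPair ha hP v
      = inner ℝ (ha.toLp a) v.1.fst + inner ℝ (hP.toLp P) v.1.snd := by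
    simp only [dualPair, ContinuousLinearMap.comp_apply, innerSL_apply_apply,
      Submodule.subtypeL_apply]
    rw [WithLp.prod_inner_apply]
    rfl
  rw [h1, ← Lp.norm_toLp a ha, ← Lp.norm_toLp P hP, add_mul]
  refine (norm_add_le _ _).trans (add_le_add ?_ ?_)
  · exact (norm_inner_le_norm _ _).trans (by gcongr; exact norm_fst_le v)
  · exact (norm_inner_le_norm _ _).trans (by gcongr; exact norm_snd_le v)

lemma eLpNorm_toReal_le_of_bound {F : Type*} [NormedAddCommGroup F] (hb : Bornology.IsBounded Ω)
    {a : Space d → F} {K : ℝ} (hK : 0 ≤ K) (h : ∀ᵐ x ∂(spaceMeas Ω), ‖a x‖ ≤ K) :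
    (eLpNorm a 2 (spaceMeas Ω)).toReal ≤ K * (spaceMeas Ω univ ^ (2 : ℝ)⁻¹).toReal := by
  have := isFiniteMeasure_spaceMeas hb
  have h1 := eLpNorm_le_of_ae_bound (p := 2) h
  have h2 : spaceMeas Ω univ ^ (ENNReal.toReal 2)⁻¹ * ENNReal.ofReal K ≠ ⊤ :=
    ENNReal.mul_ne_top (ENNReal.rpow_ne_top_of_nonneg (by norm_num) (measure_ne_top _ _))
      ENNReal.ofReal_ne_top
  have h3 := ENNReal.toReal_mono h2 h1
  rw [ENNReal.toReal_mul, ENNReal.toReal_ofReal hK, mul_comm] at h3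
  simpa using h3

variable {T : ℝ}

/-- Bounded coefficients `a`, `P` define an element of `L^∞(0,T;H⁻¹(Ω))`. -/
theorem exists_dual_representation (hb : Bornology.IsBounded Ω) {a : ℝ → Space d → ℝ}
    {P : ℝ → Space d → Space d}
    (ha : AEStronglyMeasurable (Function.uncurry a) (spaceTimeMeas T Ω))
    (hP : AEStronglyMeasurable (Function.uncurry P) (spaceTimeMeas T Ω)) {K : ℝ}
    (haK : ∀ᵐ t ∂(timeMeas T), ∀ᵐ x ∂(spaceMeas Ω), |a t x| ≤ K)
    (hPK : ∀ᵐ t ∂(timeMeas T), ∀ᵐ x ∂(spaceMeas Ω), ‖P t x‖ ≤ K) :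
    ∃ F : ℝ → HNeg Ω, MemLp F 2 (timeMeas T) ∧
      ∀ᵐ t ∂(timeMeas T), ∀ v : H10 Ω,
        F t v = (∫ x in Ω, a t x * fn v x) + ∫ x in Ω, inner ℝ (P t x) (grad v x) := by
  classical
  have := isFiniteMeasure_spaceMeas hb
  have hmem : ∀ᵐ t ∂(timeMeas T), MemLp (a t) 2 (spaceMeas Ω) ∧ MemLp (P t) 2 (spaceMeas Ω) := by
    filter_upwards [haK, hPK, ha.prodMk_left, hP.prodMk_left] with t h1 h2 h3 h4
    exact ⟨MemLp.of_bound h3 K h1, MemLp.of_bound h4 K h2⟩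
  set F : ℝ → HNeg Ω := fun t =>
    if h : MemLp (a t) 2 (spaceMeas Ω) ∧ MemLp (P t) 2 (spaceMeas Ω) then dualPair h.1 h.2 else 0
  have hF : ∀ᵐ t ∂(timeMeas T), ∀ v : H10 Ω,
      F t v = (∫ x in Ω, a t x * fn v x) + ∫ x in Ω, inner ℝ (P t x) (grad v x) := by
    filter_upwards [hmem] with t ht v
    simp only [F, dif_pos ht]
    exact dualPair_apply _ _ v
  refine ⟨F, ?_, hF⟩
  refine MemLp.of_bound (f := F) (μ := timeMeas T) (C := |K| * (spaceMeas Ω univ ^ (2 : ℝ)⁻¹).toReal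
    + |K| * (spaceMeas Ω univ ^ (2 : ℝ)⁻¹).toReal) ?_ ?_
  · refine aestronglyMeasurable_dual fun v => ?_
    have hm : AEStronglyMeasurable (fun t => (∫ x in Ω, a t x * fn v x)
        + ∫ x in Ω, inner ℝ (P t x) (grad v x)) (timeMeas T) := by
      refine AEStronglyMeasurable.add (μ := timeMeas T) ?_ ?_
      · exact (ha.mul (memLp_fn v).1.comp_snd).integral_prod_right'
      · have hi : AEStronglyMeasurable (fun p : ℝ × Space d => inner ℝ (P p.1 p.2) (grad v p.2))
            (spaceTimeMeas T Ω) :=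
          AEStronglyMeasurable.inner (𝕜 := ℝ) hP (memLp_grad v).1.comp_snd
        exact hi.integral_prod_right'
    refine hm.congr ?_
    filter_upwards [hF] with t ht
    rw [ht v]
  · filter_upwards [hmem, haK, hPK] with t ht h1 h2
    simp only [F, dif_pos ht]
    refine (norm_dualPair_le _ _).trans (add_le_add ?_ ?_)
    · exact eLpNorm_toReal_le_of_bound hb (abs_nonneg K) (h1.mono fun x hx => hx.trans (le_abs_self K))
    · exact eLpNorm_toReal_le_of_bound hb (abs_nonneg K) (h2.mono fun x hx => hx.trans (le_abs_self K))

end Dual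


/-! ### Mollification -/

section Mollify

variable {E : Type*} [NormedAddCommGroup E] [InnerProductSpace ℝ E] [FiniteDimensional ℝ E]
  [MeasurableSpace E] [BorelSpace E]

/-- A standard smooth bump of radius `ε` with integral one. -/
def mollifier (E : Type*) [NormedAddCommGroup E] [InnerProductSpace ℝ E] [FiniteDimensional ℝ E]
    [MeasurableSpace E] [BorelSpace E] (ε : ℝ) (y : E) : ℝ :=
  if h : 0 < ε then (⟨ε / 2, ε, by positivity, by linarith⟩ : ContDiffBump (0 : E)).normed volume y
  else 0

variable {ε : ℝ}

lemma mollifier_contDiff (ε : ℝ) : ContDiff ℝ ∞ (mollifier E ε) := by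
  by_cases h : 0 < ε
  · have : mollifier E ε = fun y =>
        (⟨ε / 2, ε, by positivity, by linarith⟩ : ContDiffBump (0 : E)).normed volume y := by
      funext y; simp [mollifier, h]
    rw [this]
    exact ContDiffBump.contDiff_normed _
  · have : mollifier E ε = fun _ => 0 := by funext y; simp [mollifier, h]
    rw [this]
    exact contDiff_const

lemma mollifier_nonneg (ε : ℝ) (y : E) : 0 ≤ mollifier E ε y := by
  by_cases h : 0 < ε
  · simp only [mollifier, h, dif_pos]
    exact ContDiffBump.nonneg_normed _ _
  · simp [mollifier, h]

lemma integral_mollifier (hε : 0 < ε) : ∫ y, mollifier E ε y = 1 := by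
  simp only [mollifier, hε, dif_pos]
  exact ContDiffBump.integral_normed _

lemma tsupport_mollifier_sub (hε : 0 < ε) (x : E) :
    tsupport (fun y => mollifier E ε (y - x)) ⊆ Metric.closedBall x ε := by
  refine closure_minimal (fun y hy => ?_) Metric.isClosed_closedBall
  have hy' : mollifier E ε (y - x) ≠ 0 := hy
  simp only [mollifier, hε, dif_pos] at hy'
  have : y - x ∈ Function.support
      ((⟨ε / 2, ε, by positivity, by linarith⟩ : ContDiffBump (0 : E)).normed volume) := hy'
  rw [ContDiffBump.support_normed_eq] at this
  simp only [Metric.mem_ball, dist_zero_right] at this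
  rw [Metric.mem_closedBall, dist_eq_norm]
  exact this.le

lemma hasCompactSupport_mollifier_sub (hε : 0 < ε) (x : E) :
    HasCompactSupport (fun y => mollifier E ε (y - x)) :=
  (isCompact_closedBall x ε).of_isClosed_subset (isClosed_tsupport _)
    (tsupport_mollifier_sub hε x)

lemma contDiff_mollifier_sub (x : E) : ContDiff ℝ ∞ (fun y => mollifier E ε (y - x)) :=
  (mollifier_contDiff ε).comp (contDiff_id.sub contDiff_const)

/-- A function that varies little near `x` is close to its mollification at `x`. -/
lemma abs_integral_mul_mollifier_sub_le (hε : 0 < ε) {S : Set E} {x : E}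
    (hx : Metric.closedBall x ε ⊆ S) {f : E → ℝ}
    (hf : AEStronglyMeasurable f (volume.restrict S)) {A : ℝ}
    (hA : ∀ y ∈ Metric.closedBall x ε, |f y - f x| ≤ A) :
    |(∫ y in S, f y * mollifier E ε (y - x)) - f x| ≤ A := by
  have hm0 : ∀ y ∉ Metric.closedBall x ε, mollifier E ε (y - x) = 0 := fun y hy =>
    by_contra fun h => hy (tsupport_mollifier_sub hε x (subset_tsupport _ h))
  have hint : Integrable fun y => mollifier E ε (y - x) :=
    (contDiff_mollifier_sub x).continuous.integrable_of_hasCompactSupport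
      (hasCompactSupport_mollifier_sub hε x)
  have h1 : ∫ y in S, mollifier E ε (y - x) = 1 := by
    rw [setIntegral_eq_integral_of_forall_compl_eq_zero fun y hy => hm0 y fun h => hy (hx h),
      integral_sub_right_eq_self (mollifier E ε) x, integral_mollifier hε]
  have hdiff : ∀ y, ‖(f y - f x) * mollifier E ε (y - x)‖ ≤ A * mollifier E ε (y - x) := by
    intro y
    by_cases hy : y ∈ Metric.closedBall x ε
    · rw [norm_mul, Real.norm_of_nonneg (mollifier_nonneg ε _)]
      exact mul_le_mul_of_nonneg_right (hA y hy) (mollifier_nonneg ε _)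
    · simp [hm0 y hy]
  have hi1 : Integrable (fun y => (f y - f x) * mollifier E ε (y - x)) (volume.restrict S) :=
    (hint.integrableOn.const_mul A).mono' ((hf.sub aestronglyMeasurable_const).mul
      (contDiff_mollifier_sub x).continuous.aestronglyMeasurable) (Eventually.of_forall hdiff)
  have hi2 : Integrable (fun y => f x * mollifier E ε (y - x)) (volume.restrict S) :=
    hint.integrableOn.const_mul _
  have heq : (∫ y in S, f y * mollifier E ε (y - x)) - f x
      = ∫ y in S, (f y - f x) * mollifier E ε (y - x) := by
    have : ∫ y in S, f y * mollifier E ε (y - x)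
        = (∫ y in S, (f y - f x) * mollifier E ε (y - x))
          + ∫ y in S, f x * mollifier E ε (y - x) := by
      rw [← integral_add hi1 hi2]
      refine integral_congr_ae (Eventually.of_forall fun y => ?_)
      simp only
      ring
    rw [this, integral_const_mul, h1]
    ring
  rw [heq, ← Real.norm_eq_abs]
  refine (norm_integral_le_of_norm_le (hint.integrableOn.const_mul A)
    (Eventually.of_forall hdiff)).trans (le_of_eq ?_)
  rw [integral_const_mul, h1, mul_one]

/-- Weak convergence of functions that are equi-Lipschitz near `x` implies convergence at `x`. -/
lemma exists_tendsto_of_weak {S : Set E} (hS : IsOpen S) {x : E} (hx : x ∈ S)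
    {f : ℕ → E → ℝ} (hf : ∀ n, AEStronglyMeasurable (f n) (volume.restrict S)) {D : ℝ}
    (hD : ∀ r > 0, Metric.closedBall x r ⊆ S → ∀ n, ∀ y ∈ Metric.closedBall x r,
      |f n y - f n x| ≤ D * r)
    (hweak : ∀ ψ : E → ℝ, ContDiff ℝ ∞ ψ → HasCompactSupport ψ → tsupport ψ ⊆ S →
      ∃ l, Tendsto (fun n => ∫ y in S, f n y * ψ y) atTop (𝓝 l)) :
    ∃ l, Tendsto (fun n => f n x) atTop (𝓝 l) := by
  refine cauchySeq_tendsto_of_complete (Metric.cauchySeq_iff.2 fun ε hε => ?_)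
  obtain ⟨r0, hr0, hb0⟩ := Metric.isOpen_iff.1 hS x hx
  set r := min (r0 / 2) (ε / (3 * (|D| + 1)))
  have hr : 0 < r := by positivity
  have hbr : Metric.closedBall x r ⊆ S :=
    (Metric.closedBall_subset_ball ((min_le_left _ _).trans_lt (by linarith))).trans hb0
  have hDr : D * r < ε / 3 := by
    have h1 : r ≤ ε / (3 * (|D| + 1)) := min_le_right _ _
    calc D * r ≤ |D| * r := by gcongr; exact le_abs_self D
      _ < (|D| + 1) * r := by gcongr; linarith
      _ ≤ (|D| + 1) * (ε / (3 * (|D| + 1))) := by gcongr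
      _ = ε / 3 := by field_simp
  obtain ⟨l, hl⟩ := hweak _ (contDiff_mollifier_sub x) (hasCompactSupport_mollifier_sub hr x)
    ((tsupport_mollifier_sub hr x).trans hbr)
  obtain ⟨N, hN⟩ := Metric.cauchySeq_iff.1 hl.cauchySeq (ε / 3) (by positivity)
  refine ⟨N, fun m hm n hn => ?_⟩
  have h1 := abs_integral_mul_mollifier_sub_le hr hbr (hf m) (hD r hr hbr m)
  have h2 := abs_integral_mul_mollifier_sub_le hr hbr (hf n) (hD r hr hbr n)
  have h3 := hN m hm n hn
  rw [Real.dist_eq] at h3 ⊢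
  rw [abs_le] at h1 h2
  rw [abs_lt] at h3 ⊢
  constructor <;> linarith [h1.1, h1.2, h2.1, h2.2, h3.1, h3.2]

end Mollify

/-! ### Compactness in time -/

section Time

variable {T : ℝ}

lemma exists_isTimeTest_deriv_eq (hT : 0 < T) {θ : ℝ → ℝ} (hθ : ContDiff ℝ ∞ θ)
    (hc : HasCompactSupport θ) (hs : tsupport θ ⊆ Ioo 0 T) :
    ∃ η, IsTimeTest T η ∧ (∀ t ∈ Icc 0 T, η t = -∫ s in t..T, θ s) ∧
      ∀ t ∈ Ioo 0 T, deriv η t = θ t := by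
  set Θ : ℝ → ℝ := fun t => ∫ s in T..t, θ s
  have hΘ' : ∀ t, HasDerivAt Θ (θ t) t := fun t =>
    intervalIntegral.integral_hasDerivAt_right (hθ.continuous.intervalIntegrable _ _)
      hθ.continuous.stronglyMeasurable.stronglyMeasurableAtFilter hθ.continuous.continuousAt
  have hΘ : ContDiff ℝ ∞ Θ := by
    rw [contDiff_infty_iff_deriv]
    refine ⟨fun t => (hΘ' t).differentiableAt, ?_⟩
    rwa [funext fun t => (hΘ' t).deriv]
  obtain ⟨b, hbT, hb⟩ : ∃ b < T, ∀ t, b ≤ t → Θ t = 0 := by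
    obtain ⟨r, hr, hdis⟩ := Disjoint.exists_cthickenings (s := tsupport θ) (t := {T})
      (disjoint_singleton_right.2 fun h => lt_irrefl _ (hs h).2) hc isClosed_singleton
    refine ⟨T - r, by linarith, fun t ht => ?_⟩
    refine intervalIntegral.integral_zero_ae (Eventually.of_forall fun s hsI => ?_)
    by_contra hne
    have hmem : s ∈ tsupport θ := subset_tsupport θ hne
    refine disjoint_left.1 hdis (Metric.self_subset_cthickening _ hmem)
      (Metric.mem_cthickening_of_dist_le s T r _ rfl ?_)
    have hsT := (hs hmem).2
    rw [Real.dist_eq, abs_le]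
    rw [uIoc_eq_union] at hsI
    rcases hsI with h | h
    · exact absurd h.1 (not_lt.2 hsT.le)
    · constructor <;> linarith [h.1, h.2]
  set χ : ContDiffBump (0 : ℝ) := ⟨T + 1, T + 2, by linarith, by linarith⟩
  refine ⟨fun t => χ t * Θ t, ⟨χ.contDiff.mul hΘ, χ.hasCompactSupport.mul_right, ?_⟩, ?_, ?_⟩
  · have : tsupport (fun t => χ t * Θ t) ⊆ Iic b := by
      refine closure_minimal (fun t ht => ?_) isClosed_Iic
      by_contra hlt
      exact ht (by simp [hb t (not_le.1 hlt).le])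
    exact this.trans (Iic_subset_Iio.2 hbT)
  · intro t ht
    have h1 : χ t = 1 := χ.one_of_mem_closedBall (by
      rw [mem_closedBall_zero_iff, Real.norm_eq_abs, abs_of_nonneg ht.1]
      show t ≤ T + 1
      linarith [ht.2])
    simp only [h1, one_mul, Θ]
    rw [intervalIntegral.integral_symm]
  · intro t ht
    have h1 : (fun t => χ t * Θ t) =ᶠ[𝓝 t] Θ := by
      filter_upwards [Ioo_mem_nhds ht.1 ht.2] with s hs
      have : χ s = 1 := χ.one_of_mem_closedBall (by
        rw [mem_closedBall_zero_iff, Real.norm_eq_abs, abs_of_nonneg hs.1.le]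
        show s ≤ T + 1
        linarith [hs.2])
      rw [this, one_mul]
    rw [h1.deriv_eq, (hΘ' t).deriv]

/-- A function with weak time derivative `b` and initial value `α` is `α + ∫₀ᵗ b`. -/
lemma ae_eq_add_integral_of_weak_deriv (hT : 0 < T) {a b : ℝ → ℝ} {α : ℝ}
    (ha : Integrable a (timeMeas T)) (hb : Integrable b (timeMeas T))
    (hab : ∀ η, IsTimeTest T η →
      -(∫ t in Ioo 0 T, deriv η t * a t) - η 0 * α = ∫ t in Ioo 0 T, η t * b t) :
    ∀ᵐ t ∂(timeMeas T), a t = α + ∫ s in Ioo 0 T, (Ioo 0 t).indicator b s := by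
  set B : ℝ → ℝ := fun t => ∫ s in Ioo 0 T, (Ioo 0 t).indicator b s
  have hker : AEStronglyMeasurable (fun p : ℝ × ℝ => (Ioo 0 p.1).indicator b p.2)
      ((timeMeas T).prod (timeMeas T)) := by
    have hset : MeasurableSet {p : ℝ × ℝ | 0 < p.2 ∧ p.2 < p.1} :=
      (measurableSet_lt measurable_const measurable_snd).inter
        (measurableSet_lt measurable_snd measurable_fst)
    exact (hb.1.comp_snd (μ := timeMeas T)).indicator hset
  have hBm : AEStronglyMeasurable B (timeMeas T) := hker.integral_prod_right'
  have hBb : ∀ t, ‖B t‖ ≤ ∫ s in Ioo 0 T, ‖b s‖ := fun t => by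
    refine norm_integral_le_of_norm_le hb.norm (Eventually.of_forall fun s => ?_)
    exact norm_indicator_le_norm_self _ _
  have hBi : Integrable B (timeMeas T) := Integrable.of_bound hBm _ (Eventually.of_forall hBb)
  have hzero : ∀ᵐ t, t ∈ Ioo 0 T → a t - (α + B t) = 0 := by
    refine isOpen_Ioo.ae_eq_zero_of_integral_contDiff_smul_eq_zero ?_ ?_
    · have : IntegrableOn (fun t => a t - (α + B t)) (Ioo 0 T) :=
        ha.sub ((integrable_const α).add hBi)
      exact this.locallyIntegrableOn
    · intro θ hθ hc hs
      obtain ⟨η, hη, hηI, hηd⟩ := exists_isTimeTest_deriv_eq hT hθ hc hs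
      have h := hab η hη
      obtain ⟨M, hM⟩ := hθ.continuous.bounded_above_of_compact_support hc
      have hθm : AEStronglyMeasurable θ (timeMeas T) := hθ.continuous.aestronglyMeasurable
      have hθa : Integrable (fun t => θ t * a t) (timeMeas T) :=
        ha.bdd_mul hθm (Eventually.of_forall hM)
      have hθi : Integrable θ (timeMeas T) := Integrable.of_bound hθm M (Eventually.of_forall hM)
      have hθB : Integrable (fun t => θ t * B t) (timeMeas T) :=
        hBi.bdd_mul hθm (Eventually.of_forall hM)
      have h1 : ∫ t in Ioo 0 T, deriv η t * a t = ∫ t in Ioo 0 T, θ t * a t :=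
        setIntegral_congr_fun measurableSet_Ioo fun t ht => by simp only [hηd t ht]
      have h2 : η 0 = -∫ t in Ioo 0 T, θ t := by
        rw [hηI 0 ⟨le_rfl, hT.le⟩, intervalIntegral.integral_of_le hT.le,
          integral_Ioc_eq_integral_Ioo]
      have h3 : ∫ s in Ioo 0 T, η s * b s = -∫ t in Ioo 0 T, θ t * B t := by
        have hprod : Integrable (fun p : ℝ × ℝ => θ p.1 * (Ioo 0 p.1).indicator b p.2)
            ((timeMeas T).prod (timeMeas T)) := by
          refine ((hθi.norm).mul_prod hb.norm).mono' (hθm.comp_fst.mul hker)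
            (Eventually.of_forall fun p => ?_)
          rw [norm_mul]
          gcongr
          exact norm_indicator_le_norm_self _ _
        have hsw := integral_integral_swap (f := fun t s => θ t * (Ioo 0 t).indicator b s) hprod
        simp only [integral_const_mul] at hsw
        simp only [B]
        rw [hsw, ← integral_neg]
        refine setIntegral_congr_fun measurableSet_Ioo fun s hs => ?_
        rw [hηI s ⟨hs.1.le, hs.2.le⟩, neg_mul, intervalIntegral.integral_of_le hs.2.le,
          integral_Ioc_eq_integral_Ioo, ← integral_mul_const]
        congr 1
        rw [← integral_indicator measurableSet_Ioo, ← integral_indicator measurableSet_Ioo]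
        refine integral_congr_ae (Eventually.of_forall fun t => ?_)
        by_cases h1 : s < t
        · by_cases h2 : t < T
          · have m1 : t ∈ Ioo s T := ⟨h1, h2⟩
            have m2 : t ∈ Ioo 0 T := ⟨hs.1.trans h1, h2⟩
            have m3 : s ∈ Ioo 0 t := ⟨hs.1, h1⟩
            simp [m1, m2, m3]
          · have m1 : t ∉ Ioo s T := fun h => h2 h.2
            have m2 : t ∉ Ioo 0 T := fun h => h2 h.2
            simp [m1, m2]
        · have m1 : t ∉ Ioo s T := fun h => h1 h.1
          have m3 : s ∉ Ioo 0 t := fun h => h1 h.2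
          by_cases m2 : t ∈ Ioo 0 T
          · simp only [m1, m2, m3, not_false_eq_true, indicator_of_notMem, indicator_of_mem,
              mul_zero]
          · simp [m1, m2]
      rw [h1, h2, h3] at h
      have hsplit : ∫ t in Ioo 0 T, θ t * (a t - (α + B t))
          = (∫ t in Ioo 0 T, θ t * a t) - ((∫ t in Ioo 0 T, θ t) * α
            + ∫ t in Ioo 0 T, θ t * B t) := by
        have hsum : Integrable (fun t => θ t * α + θ t * B t) (timeMeas T) :=
          (hθi.mul_const α).add hθB
        rw [← integral_mul_const, ← integral_add (hθi.mul_const α) hθB, ← integral_sub hθa hsum]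
        refine integral_congr_ae (Eventually.of_forall fun t => ?_)
        simp only
        ring
      have hset : ∫ t, θ t • (a t - (α + B t)) = ∫ t in Ioo 0 T, θ t * (a t - (α + B t)) := by
        rw [setIntegral_eq_integral_of_forall_compl_eq_zero]
        · rfl
        · intro t ht
          have : θ t = 0 := by_contra fun h => ht (hs (subset_tsupport θ h))
          rw [this, zero_mul]
      rw [hset, hsplit]
      linarith
  filter_upwards [(ae_restrict_iff' measurableSet_Ioo).2 hzero] with t ht
  linarith

/-- Weakly convergent functions of time with uniformly bounded weak derivatives converge almost
everywhere. -/
theorem ae_exists_tendsto_of_weak_deriv (hT : 0 < T) {a b : ℕ → ℝ → ℝ} {α : ℝ} {K : ℝ}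
    (ha : ∀ n, Integrable (a n) (timeMeas T)) (hb : ∀ n, AEStronglyMeasurable (b n) (timeMeas T))
    (hK : ∀ n, ∀ᵐ t ∂(timeMeas T), |b n t| ≤ K)
    (hab : ∀ n, ∀ η, IsTimeTest T η →
      -(∫ t in Ioo 0 T, deriv η t * a n t) - η 0 * α = ∫ t in Ioo 0 T, η t * b n t)
    (hweak : ∀ θ : ℝ → ℝ, Continuous θ → HasCompactSupport θ →
      ∃ l, Tendsto (fun n => ∫ t in Ioo 0 T, a n t * θ t) atTop (𝓝 l)) :
    ∀ᵐ t ∂(timeMeas T), ∃ l, Tendsto (fun n => a n t) atTop (𝓝 l) := by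
  have hbi : ∀ n, Integrable (b n) (timeMeas T) := fun n => Integrable.of_bound (hb n) K (hK n)
  have hae := ae_all_iff.2 fun n =>
    ae_eq_add_integral_of_weak_deriv hT (ha n) (hbi n) (hab n)
  set A : ℕ → ℝ → ℝ := fun n t => α + ∫ s in Ioo 0 T, (Ioo 0 t).indicator (b n) s
  have hK0 : 0 ≤ K ∨ timeMeas T = 0 := by
    by_cases h : timeMeas T = 0
    · exact Or.inr h
    · have : NeBot (ae (timeMeas T)) := ae_neBot.2 h
      obtain ⟨t, ht⟩ := (hK 0).exists
      exact Or.inl ((abs_nonneg _).trans ht)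
  rcases hK0 with hK0 | h0
  swap
  · rw [h0]; simp
  have hlip : ∀ n, ∀ t, ∀ t', t ≤ t' → |A n t' - A n t| ≤ K * (t' - t) := by
    intro n t t' htt
    have hi : ∀ t, Integrable ((Ioo 0 t).indicator (b n)) (timeMeas T) := fun t =>
      (hbi n).indicator measurableSet_Ioo
    have hd : A n t' - A n t
        = ∫ s in Ioo 0 T, ((Ioo 0 t').indicator (b n) s - (Ioo 0 t).indicator (b n) s) := by
      simp only [A]
      rw [integral_sub (hi t') (hi t)]
      ring
    rw [hd, ← Real.norm_eq_abs]
    have hbd : Integrable ((Ico t t').indicator fun _ => K) (timeMeas T) :=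
      (integrable_const K).indicator measurableSet_Ico
    refine (norm_integral_le_of_norm_le hbd ?_).trans ?_
    · filter_upwards [hK n] with s hs
      by_cases h1 : s ∈ Ioo 0 t
      · have h2 : s ∈ Ioo 0 t' := ⟨h1.1, h1.2.trans_le htt⟩
        simp only [h1, h2, indicator_of_mem, sub_self, norm_zero]
        exact indicator_nonneg (fun _ _ => hK0) s
      · by_cases h2 : s ∈ Ioo 0 t'
        · have h3 : s ∈ Ico t t' := ⟨not_lt.1 fun h => h1 ⟨h2.1, h⟩, h2.2⟩
          simpa [h1, h2, h3] using hs
        · simp only [h1, h2, not_false_eq_true, indicator_of_notMem, sub_self, norm_zero]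
          exact indicator_nonneg (fun _ _ => hK0) s
    · rw [integral_indicator_const _ measurableSet_Ico, smul_eq_mul, mul_comm]
      refine mul_le_mul_of_nonneg_left ?_ hK0
      have hle : timeMeas T (Ico t t') ≤ volume (Ico t t') := Measure.restrict_apply_le _ _
      have := ENNReal.toReal_mono (by simp) hle
      rw [Real.volume_Ico, ENNReal.toReal_ofReal (by linarith)] at this
      exact this
  have hlip' : ∀ n, ∀ t, ∀ t', |A n t' - A n t| ≤ K * |t' - t| := by
    intro n t t'
    rcases le_total t t' with h | h
    · rw [abs_of_nonneg (sub_nonneg.2 h)]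
      exact hlip n t t' h
    · rw [abs_sub_comm, abs_sub_comm t' t, abs_of_nonneg (sub_nonneg.2 h)]
      exact hlip n t' t h
  have hconv : ∀ t ∈ Ioo 0 T, ∃ l, Tendsto (fun n => A n t) atTop (𝓝 l) := by
    intro t ht
    refine exists_tendsto_of_weak (S := Ioo 0 T) isOpen_Ioo ht (D := K) (fun n => ?_) ?_ ?_
    · refine (ha n).1.congr ?_
      filter_upwards [hae] with s hs using hs n
    · intro r hr hbr n s hs
      refine (hlip' n t s).trans ?_
      gcongr
      exact hs
    · intro θ hθ hc hs
      obtain ⟨l, hl⟩ := hweak θ hθ.continuous hc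
      refine ⟨l, hl.congr fun n => integral_congr_ae ?_⟩
      filter_upwards [hae] with s hs
      rw [hs n]
  filter_upwards [hae, ae_restrict_mem measurableSet_Ioo] with t ht htT
  obtain ⟨l, hl⟩ := hconv t htT
  exact ⟨l, hl.congr fun n => (ht n).symm⟩

end Time


/-! ### Integration by parts and gradients -/

section Space

variable {Ω : Set (Space d)} {u ψ : Space d → ℝ} {D : ℝ}

lemma inner_gradient (w : Space d → ℝ) (x e : Space d) :
    inner ℝ (gradient w x) e = fderiv ℝ w x e := by
  rw [gradient, InnerProductSpace.toDual_symm_apply]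

lemma norm_gradient (w : Space d → ℝ) (x : Space d) : ‖gradient w x‖ = ‖fderiv ℝ w x‖ := by
  rw [gradient, LinearIsometryEquiv.norm_map]

lemma gradient_eq_sum (w : Space d → ℝ) (x : Space d) :
    gradient w x = ∑ i, fderiv ℝ w x (EuclideanSpace.basisFun (Fin d) ℝ i)
      • EuclideanSpace.basisFun (Fin d) ℝ i := by
  conv_lhs => rw [← (EuclideanSpace.basisFun (Fin d) ℝ).sum_repr' (gradient w x)]
  refine Finset.sum_congr rfl fun i _ => ?_
  rw [real_inner_comm, inner_gradient]

lemma measurable_gradient (w : Space d → ℝ) : Measurable (gradient w) :=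
  (InnerProductSpace.toDual ℝ (Space d)).symm.continuous.measurable.comp (measurable_fderiv ℝ w)

lemma integral_mul_eq_of_test (u : Space d → ℝ) (hψ : IsSpaceTest Ω ψ) :
    ∫ x in Ω, u x * ψ x = ∫ x, u x * ψ x :=
  setIntegral_eq_integral_of_forall_compl_eq_zero fun x hx => by
    have : ψ x = 0 := by_contra fun h => hx (hψ.2.2 (subset_tsupport ψ h))
    rw [this, mul_zero]

lemma integrable_mul_test (hΩ : IsOpen Ω) (hum : AEStronglyMeasurable u (spaceMeas Ω))
    (hu : ∀ x ∈ Ω, |u x| ≤ D) (hψ : IsSpaceTest Ω ψ) : Integrable fun x => u x * ψ x := by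
  have h0 : ∀ x ∉ Ω, ψ x = 0 := fun x hx =>
    by_contra fun h => hx (hψ.2.2 (subset_tsupport ψ h))
  have hψi : Integrable ψ := hψ.1.continuous.integrable_of_hasCompactSupport hψ.2.1
  have h : IntegrableOn (fun x => u x * ψ x) Ω :=
    hψi.integrableOn.bdd_mul (c := D) hum
      ((ae_restrict_mem hΩ.measurableSet).mono fun x hx => hu x hx)
  refine (integrableOn_iff_integrable_of_support_subset fun x hx => ?_).1 h
  by_contra hxΩ
  exact hx (by simp [h0 x hxΩ])

lemma integral_fderiv_mul_test (hΩ : IsOpen Ω) (hu : HasC11Bound Ω u D) (hψ : IsSpaceTest Ω ψ)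
    (e : Space d) :
    ∫ x in Ω, u x * fderiv ℝ ψ x e = -∫ x in Ω, fderiv ℝ u x e * ψ x := by
  have hDe : ∀ x ∈ Ω, |fderiv ℝ u x e| ≤ D * ‖e‖ := fun x hx =>
    ((fderiv ℝ u x).le_opNorm e).trans
      (mul_le_mul_of_nonneg_right (hu.norm_fderiv_le x hx) (norm_nonneg e))
  rw [integral_mul_eq_of_test u (hψ.contDiff_fderiv_apply e), integral_mul_eq_of_test _ hψ]
  refine integral_mul_fderiv_eq_neg_fderiv_mul_of_integrable ?_ ?_ ?_ ?_ ?_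
  · exact integrable_mul_test hΩ (measurable_fderiv_apply_const ℝ u e).aestronglyMeasurable hDe hψ
  · exact integrable_mul_test hΩ (hu.aestronglyMeasurable hΩ) hu.abs_le
      (hψ.contDiff_fderiv_apply e)
  · exact integrable_mul_test hΩ (hu.aestronglyMeasurable hΩ) hu.abs_le hψ
  · exact fun x hx => hu.differentiableAt x (hψ.2.2 hx)
  · exact fun x _ => hψ.differentiable x

lemma integral_smul_gradient (hΩ : IsOpen Ω) (hu : HasC11Bound Ω u D) (hψ : IsSpaceTest Ω ψ) :
    ∫ x in Ω, u x • gradient ψ x = -∫ x in Ω, ψ x • gradient u x := by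
  have hDe : ∀ e, ∀ x ∈ Ω, |fderiv ℝ u x e| ≤ D * ‖e‖ := fun e x hx =>
    ((fderiv ℝ u x).le_opNorm e).trans
      (mul_le_mul_of_nonneg_right (hu.norm_fderiv_le x hx) (norm_nonneg e))
  have h1 : ∀ x, u x • gradient ψ x
      = ∑ i, (u x * fderiv ℝ ψ x (EuclideanSpace.basisFun (Fin d) ℝ i))
        • EuclideanSpace.basisFun (Fin d) ℝ i := fun x => by
    rw [gradient_eq_sum, Finset.smul_sum]
    simp_rw [smul_smul]
  have h2 : ∀ x, ψ x • gradient u x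
      = ∑ i, (fderiv ℝ u x (EuclideanSpace.basisFun (Fin d) ℝ i) * ψ x)
        • EuclideanSpace.basisFun (Fin d) ℝ i := fun x => by
    rw [gradient_eq_sum, Finset.smul_sum]
    simp_rw [smul_smul, mul_comm]
  simp_rw [h1, h2]
  rw [integral_finsetSum _ fun i _ => Integrable.smul_const (integrable_mul_test hΩ
      (hu.aestronglyMeasurable hΩ) hu.abs_le (hψ.contDiff_fderiv_apply _)).integrableOn _,
    integral_finsetSum _ fun i _ => Integrable.smul_const (integrable_mul_test hΩ
      (measurable_fderiv_apply_const ℝ u _).aestronglyMeasurable (hDe _) hψ).integrableOn _,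
    ← Finset.sum_neg_distrib]
  refine Finset.sum_congr rfl fun i _ => ?_
  rw [integral_smul_const, integral_smul_const, integral_fderiv_mul_test hΩ hu hψ, neg_smul]

/-! ### Countable families of test functions -/

lemma IsSpaceTest.memLp (hψ : IsSpaceTest Ω ψ) (hb : Bornology.IsBounded Ω) :
    MemLp ψ 2 (spaceMeas Ω) := by
  have := isFiniteMeasure_spaceMeas hb
  obtain ⟨B, -, hB⟩ := hψ.exists_hasC11Bound
  exact MemLp.of_bound hψ.1.continuous.aestronglyMeasurable B
    (Eventually.of_forall fun x => (hB univ).abs_le x (mem_univ x))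

/-- There is a countable family of test functions approximating every test function and its
Laplacian in `L²(Ω)`. -/
lemma exists_countable_tests (hb : Bornology.IsBounded Ω) :
    ∃ S : Set (Space d → ℝ), S.Countable ∧ (∀ χ ∈ S, IsSpaceTest Ω χ) ∧
      ∀ ψ, IsSpaceTest Ω ψ → ∀ ε > 0, ∃ χ ∈ S,
        (eLpNorm (ψ - χ) 2 (spaceMeas Ω)).toReal < ε ∧
        (eLpNorm (Laplacian.laplacian ψ - Laplacian.laplacian χ) 2 (spaceMeas Ω)).toReal < ε := by
  have : Fact ((2 : ℝ≥0∞) ≠ ⊤) := ⟨by norm_num⟩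
  set m : {ψ : Space d → ℝ // IsSpaceTest Ω ψ} → Lp ℝ 2 (spaceMeas Ω) × Lp ℝ 2 (spaceMeas Ω) :=
    fun ψ => ((ψ.2.memLp hb).toLp, (ψ.2.laplacian.memLp hb).toLp)
  have : SecondCountableTopology (Lp ℝ 2 (spaceMeas Ω)) := Lp.SecondCountableTopology
  have : SecondCountableTopology (Lp ℝ 2 (spaceMeas Ω) × Lp ℝ 2 (spaceMeas Ω)) := inferInstance
  have : SecondCountableTopology (range m) := TopologicalSpace.Subtype.secondCountableTopology _
  obtain ⟨s, hs, hd⟩ := TopologicalSpace.exists_countable_dense (range m)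
  have hch : ∀ q : range m, ∃ ψ, m ψ = q := fun q => q.2
  choose g hg using hch
  refine ⟨(fun q => (g q : Space d → ℝ)) '' s, hs.image _, ?_, ?_⟩
  · rintro _ ⟨q, -, rfl⟩
    exact (g q).2
  · intro ψ hψ ε hε
    obtain ⟨q, hqs, hq⟩ := Metric.dense_iff.1 hd ⟨m ⟨ψ, hψ⟩, ⟨ψ, hψ⟩, rfl⟩ ε hε
    refine ⟨g q, ⟨q, hq, rfl⟩, ?_⟩
    have hdist : dist (m ⟨ψ, hψ⟩) (m (g q)) < ε := by
      rw [hg q, dist_comm]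
      exact hqs
    rw [Prod.dist_eq, max_lt_iff, dist_eq_norm, dist_eq_norm] at hdist
    simp only [m] at hdist
    rw [← MemLp.toLp_sub, ← MemLp.toLp_sub, Lp.norm_toLp, Lp.norm_toLp] at hdist
    exact hdist

lemma abs_integral_mul_le {α : Type*} [MeasurableSpace α] {μ : Measure α} {f g : α → ℝ}
    (hf : MemLp f 2 μ) (hg : MemLp g 2 μ) :
    |∫ x, f x * g x ∂μ| ≤ (eLpNorm f 2 μ).toReal * (eLpNorm g 2 μ).toReal := by
  have h : inner ℝ (hf.toLp f : Lp ℝ 2 μ) (hg.toLp g : Lp ℝ 2 μ) = ∫ x, f x * g x ∂μ := by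
    rw [L2.inner_def]
    refine integral_congr_ae ?_
    filter_upwards [hf.coeFn_toLp, hg.coeFn_toLp] with x h1 h2
    rw [h1, h2]
    simp [mul_comm]
  rw [← h, ← Lp.norm_toLp f hf, ← Lp.norm_toLp g hg]
  exact norm_inner_le_norm (𝕜 := ℝ) _ _

lemma integrable_mul_of_memLp {α : Type*} [MeasurableSpace α] {μ : Measure α} {f g : α → ℝ}
    (hf : MemLp f 2 μ) (hg : MemLp g 2 μ) : Integrable (fun x => f x * g x) μ :=
  hf.integrable_mul hg

/-- Weak convergence of a bounded sequence only needs to be tested on a countable family. -/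
lemma exists_tendsto_of_countable_tests (hΩ : MeasurableSet Ω) (hb : Bornology.IsBounded Ω)
    {S : Set (Space d → ℝ)} (hS : ∀ χ ∈ S, IsSpaceTest Ω χ)
    (hdense : ∀ ψ, IsSpaceTest Ω ψ → ∀ ε > 0, ∃ χ ∈ S,
        (eLpNorm (ψ - χ) 2 (spaceMeas Ω)).toReal < ε)
    {u : ℕ → Space d → ℝ} (hum : ∀ n, AEStronglyMeasurable (u n) (spaceMeas Ω))
    (hu : ∀ n, ∀ x ∈ Ω, |u n x| ≤ D)
    (hlim : ∀ χ ∈ S, ∃ l, Tendsto (fun n => ∫ x in Ω, u n x * χ x) atTop (𝓝 l))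
    (hψ : IsSpaceTest Ω ψ) : ∃ l, Tendsto (fun n => ∫ x in Ω, u n x * ψ x) atTop (𝓝 l) := by
  have := isFiniteMeasure_spaceMeas hb
  have hu' : ∀ n, ∀ᵐ x ∂(spaceMeas Ω), ‖u n x‖ ≤ |D| := fun n =>
    (ae_restrict_mem hΩ).mono fun x hx => (hu n x hx).trans (le_abs_self D)
  have huL : ∀ n, MemLp (u n) 2 (spaceMeas Ω) := fun n => MemLp.of_bound (hum n) _ (hu' n)
  set V : ℝ := |D| * (spaceMeas Ω univ ^ (2 : ℝ)⁻¹).toReal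
  have hV : ∀ n, (eLpNorm (u n) 2 (spaceMeas Ω)).toReal ≤ V := fun n =>
    eLpNorm_toReal_le_of_bound hb (abs_nonneg D) (hu' n)
  have hV0 : 0 ≤ V := ENNReal.toReal_nonneg.trans (hV 0)
  refine cauchySeq_tendsto_of_complete (Metric.cauchySeq_iff.2 fun ε hε => ?_)
  obtain ⟨χ, hχS, hχ⟩ := hdense ψ hψ (ε / (3 * (V + 1))) (by positivity)
  obtain ⟨l, hl⟩ := hlim χ hχS
  obtain ⟨N, hN⟩ := Metric.cauchySeq_iff.1 hl.cauchySeq (ε / 3) (by positivity)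
  have hψL := hψ.memLp hb
  have hχL := (hS χ hχS).memLp hb
  have hclose : ∀ n, |(∫ x in Ω, u n x * ψ x) - ∫ x in Ω, u n x * χ x| < ε / 3 := by
    intro n
    rw [← integral_sub (integrable_mul_of_memLp (huL n) hψL)
      (integrable_mul_of_memLp (huL n) hχL)]
    have heq : ∫ x in Ω, (u n x * ψ x - u n x * χ x) = ∫ x in Ω, u n x * (ψ - χ) x :=
      integral_congr_ae (Eventually.of_forall fun x => by simp [mul_sub])
    rw [heq]
    calc _ ≤ V * (eLpNorm (ψ - χ) 2 (spaceMeas Ω)).toReal :=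
          (abs_integral_mul_le (huL n) (hψL.sub hχL)).trans
            (mul_le_mul_of_nonneg_right (hV n) ENNReal.toReal_nonneg)
      _ ≤ V * (ε / (3 * (V + 1))) := by gcongr
      _ < (V + 1) * (ε / (3 * (V + 1))) := by gcongr; linarith
      _ = ε / 3 := by field_simp
  refine ⟨N, fun i hi j hj => ?_⟩
  have h1 := hclose i
  have h2 := hclose j
  have h3 := hN i hi j hj
  rw [Real.dist_eq] at h3 ⊢
  rw [abs_lt] at h1 h2 h3 ⊢
  constructor <;> linarith [h1.1, h1.2, h2.1, h2.2, h3.1, h3.2]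

/-! ### Pointwise convergence of values and gradients -/

lemma HasC11Bound.abs_fderiv_apply_sub_le (hu : HasC11Bound Ω u D) {x : Space d} {r : ℝ}
    (hbr : Metric.closedBall x r ⊆ Ω) {y : Space d} (hy : y ∈ Metric.closedBall x r)
    (e : Space d) : |fderiv ℝ u y e - fderiv ℝ u x e| ≤ D * ‖e‖ * r := by
  have hr : 0 ≤ r := dist_nonneg.trans (Metric.mem_closedBall.1 hy)
  have hx : x ∈ Metric.closedBall x r := Metric.mem_closedBall_self hr
  have hD : 0 ≤ D := hu.nonneg ⟨x, hbr hx⟩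
  have h1 := hu.lipschitz x (hbr hx) y (hbr hy)
    (((convex_closedBall x r).segment_subset hx hy).trans hbr)
  have h2 := (fderiv ℝ u y - fderiv ℝ u x).le_opNorm e
  rw [← dist_eq_norm y x] at h1
  calc _ ≤ (D * dist y x) * ‖e‖ := h2.trans (by gcongr)
    _ ≤ (D * r) * ‖e‖ := by gcongr; exact hy
    _ = _ := by ring

lemma HasC11Bound.abs_sub_le_of_closedBall (hu : HasC11Bound Ω u D) {x : Space d} {r : ℝ}
    (hbr : Metric.closedBall x r ⊆ Ω) {y : Space d} (hy : y ∈ Metric.closedBall x r) :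
    |u y - u x| ≤ D * r := by
  have hr : 0 ≤ r := dist_nonneg.trans (Metric.mem_closedBall.1 hy)
  have hx : x ∈ Metric.closedBall x r := Metric.mem_closedBall_self hr
  have hD : 0 ≤ D := hu.nonneg ⟨x, hbr hx⟩
  refine (hu.abs_sub_le_of_segment
    (((convex_closedBall x r).segment_subset hx hy).trans hbr)).trans ?_
  rw [← dist_eq_norm]
  gcongr
  exact hy

theorem exists_tendsto_of_hasC11Bound (hΩ : IsOpen Ω) {u : ℕ → Space d → ℝ}
    (hu : ∀ n, HasC11Bound Ω (u n) D)
    (hweak : ∀ ψ, IsSpaceTest Ω ψ → ∃ l, Tendsto (fun n => ∫ x in Ω, u n x * ψ x) atTop (𝓝 l))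
    {x : Space d} (hx : x ∈ Ω) :
    (∃ l, Tendsto (fun n => u n x) atTop (𝓝 l)) ∧
      ∃ p, Tendsto (fun n => gradient (u n) x) atTop (𝓝 p) := by
  constructor
  · exact exists_tendsto_of_weak hΩ hx (D := D) (fun n => (hu n).aestronglyMeasurable hΩ)
      (fun r _ hbr n y hy => (hu n).abs_sub_le_of_closedBall hbr hy)
      (fun ψ h1 h2 h3 => hweak ψ ⟨h1, h2, h3⟩)
  · have h : ∀ e, ∃ l, Tendsto (fun n => fderiv ℝ (u n) x e) atTop (𝓝 l) := fun e => by
      refine exists_tendsto_of_weak (f := fun n y => fderiv ℝ (u n) y e) hΩ hx (D := D * ‖e‖)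
        (fun n => (measurable_fderiv_apply_const ℝ (u n) e).aestronglyMeasurable)
        (fun r _ hbr n y hy => (hu n).abs_fderiv_apply_sub_le hbr hy e) fun ψ h1 h2 h3 => ?_
      obtain ⟨l, hl⟩ := hweak _ (IsSpaceTest.contDiff_fderiv_apply ⟨h1, h2, h3⟩ e)
      refine ⟨-l, hl.neg.congr fun n => ?_⟩
      rw [integral_fderiv_mul_test hΩ (hu n) ⟨h1, h2, h3⟩, neg_neg]
    choose l hl using h
    refine ⟨∑ i, l (EuclideanSpace.basisFun (Fin d) ℝ i) • EuclideanSpace.basisFun (Fin d) ℝ i, ?_⟩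
    simp_rw [gradient_eq_sum]
    exact tendsto_finsetSum _ fun i _ => (hl _).smul_const _

/-- Limits of functions with bounded gradients have the limit of the gradients as weak
gradient. -/
lemma hasWeakGrad_of_tendsto (hΩ : IsOpen Ω) (hb : Bornology.IsBounded Ω)
    {u : ℕ → Space d → ℝ} (hu : ∀ n, HasC11Bound Ω (u n) D) {u' : Space d → ℝ}
    {G : Space d → Space d}
    (h1 : ∀ᵐ x ∂(spaceMeas Ω), Tendsto (fun n => u n x) atTop (𝓝 (u' x)))
    (h2 : ∀ᵐ x ∂(spaceMeas Ω), Tendsto (fun n => gradient (u n) x) atTop (𝓝 (G x))) :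
    HasWeakGrad Ω u' G := by
  have := isFiniteMeasure_spaceMeas hb
  have hmem := ae_restrict_mem (μ := volume) hΩ.measurableSet
  have hm1 : AEStronglyMeasurable u' (spaceMeas Ω) :=
    aestronglyMeasurable_of_tendsto_ae atTop (fun n => (hu n).aestronglyMeasurable hΩ) h1
  have hm2 : AEStronglyMeasurable G (spaceMeas Ω) :=
    aestronglyMeasurable_of_tendsto_ae atTop
      (fun n => (measurable_gradient (u n)).aestronglyMeasurable) h2
  have hb1 : ∀ n, ∀ᵐ x ∂(spaceMeas Ω), ‖u n x‖ ≤ D := fun n =>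
    hmem.mono fun x hx => (hu n).abs_le x hx
  have hb2 : ∀ n, ∀ᵐ x ∂(spaceMeas Ω), ‖gradient (u n) x‖ ≤ D := fun n =>
    hmem.mono fun x hx => by rw [norm_gradient]; exact (hu n).norm_fderiv_le x hx
  refine ⟨MemLp.of_bound hm1 D ?_, MemLp.of_bound hm2 D ?_, fun ψ hψ => ?_⟩
  · filter_upwards [h1, ae_all_iff.2 hb1] with x hx hxb
    exact le_of_tendsto hx.norm (Eventually.of_forall hxb)
  · filter_upwards [h2, ae_all_iff.2 hb2] with x hx hxb
    exact le_of_tendsto hx.norm (Eventually.of_forall hxb)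
  · obtain ⟨B, hB0, hB⟩ := hψ.exists_hasC11Bound
    have t1 : Tendsto (fun n => ∫ x in Ω, u n x • gradient ψ x) atTop
        (𝓝 (∫ x in Ω, u' x • gradient ψ x)) := by
      refine tendsto_integral_of_dominated_convergence (fun _ => D * B)
        (fun n => ((hu n).aestronglyMeasurable hΩ).smul
          (measurable_gradient ψ).aestronglyMeasurable) (integrable_const _) (fun n => ?_) ?_
      · filter_upwards [hb1 n] with x hx
        rw [norm_smul, norm_gradient]
        exact mul_le_mul hx ((hB univ).norm_fderiv_le x (mem_univ x)) (norm_nonneg _)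
          ((norm_nonneg _).trans hx)
      · filter_upwards [h1] with x hx
        exact hx.smul_const _
    have t2 : Tendsto (fun n => ∫ x in Ω, ψ x • gradient (u n) x) atTop
        (𝓝 (∫ x in Ω, ψ x • G x)) := by
      refine tendsto_integral_of_dominated_convergence (fun _ => B * D)
        (fun n => hψ.1.continuous.aestronglyMeasurable.smul
          (measurable_gradient (u n)).aestronglyMeasurable) (integrable_const _) (fun n => ?_) ?_
      · filter_upwards [hb2 n] with x hx
        rw [norm_smul]
        exact mul_le_mul ((hB univ).abs_le x (mem_univ x)) hx (norm_nonneg _) hB0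
      · filter_upwards [h2] with x hx
        exact hx.const_smul _
    refine tendsto_nhds_unique t1 (t2.neg.congr fun n => ?_)
    rw [integral_smul_gradient hΩ (hu n) hψ]

end Space

/-! ### Joint measurability in time and space -/

section JointMeasurability

variable {Ω : Set (Space d)} {T : ℝ} {u : ℝ → Space d → ℝ} {D : ℝ}

/-- A property valid for almost all times at all points of `Ω` holds almost everywhere. -/
lemma ae_spaceTime_of_ae_forall (hΩ : MeasurableSet Ω) {p : ℝ → Space d → Prop}
    (h : ∀ᵐ t ∂(timeMeas T), ∀ x ∈ Ω, p t x) : ∀ᵐ q ∂(spaceTimeMeas T Ω), p q.1 q.2 := by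
  filter_upwards [Measure.quasiMeasurePreserving_fst.ae h,
    Measure.quasiMeasurePreserving_snd.ae (ae_restrict_mem hΩ)] with q h1 h2
  exact h1 q.2 h2

lemma aestronglyMeasurable_fderiv_apply (hΩ : IsOpen Ω)
    (hum : AEStronglyMeasurable (Function.uncurry u) (spaceTimeMeas T Ω))
    (hu : ∀ᵐ t ∂(timeMeas T), HasC11Bound Ω (u t) D) (e : Space d) :
    AEStronglyMeasurable (fun q : ℝ × Space d => fderiv ℝ (u q.1) q.2 e)
      (spaceTimeMeas T Ω) := by
  set w := hum.mk _
  have hw : StronglyMeasurable w := hum.stronglyMeasurable_mk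
  set ε : ℕ → ℝ := fun k => 1 / ((k : ℝ) + 1)
  have hε : ∀ k, 0 < ε k := fun k => by positivity
  have hε0 : Tendsto ε atTop (𝓝 0) := tendsto_one_div_add_atTop_nhds_zero_nat
  refine aestronglyMeasurable_of_tendsto_ae atTop (f := fun k (q : ℝ × Space d) =>
    -∫ y in Ω, w (q.1, y) * fderiv ℝ (mollifier (Space d) (ε k)) (y - q.2) e) (fun k => ?_) ?_
  · have hc : Continuous fun x => fderiv ℝ (mollifier (Space d) (ε k)) x e :=
      ((mollifier_contDiff (ε k)).continuous_fderiv (by norm_num)).clm_apply continuous_const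
    have hsm : StronglyMeasurable (Function.uncurry fun (q : ℝ × Space d) (y : Space d) =>
        w (q.1, y) * fderiv ℝ (mollifier (Space d) (ε k)) (y - q.2) e) := by
      refine StronglyMeasurable.mul (hw.comp_measurable
        ((measurable_fst.comp measurable_fst).prodMk measurable_snd)) ?_
      exact (hc.comp (continuous_snd.sub (continuous_snd.comp continuous_fst))).stronglyMeasurable
    exact (hsm.integral_prod_right (ν := spaceMeas Ω)).neg.aestronglyMeasurable
  · have hwu := Measure.ae_ae_of_ae_prod hum.ae_eq_mk
    refine ae_spaceTime_of_ae_forall hΩ.measurableSet (p := fun t x => Tendsto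
      (fun k => -∫ y in Ω, w (t, y) * fderiv ℝ (mollifier (Space d) (ε k)) (y - x) e) atTop
      (𝓝 (fderiv ℝ (u t) x e))) ?_
    filter_upwards [hwu, hu] with t ht hut x hx
    obtain ⟨r, hr, hbr⟩ := Metric.isOpen_iff.1 hΩ x hx
    have hDε : Tendsto (fun k => D * ‖e‖ * ε k) atTop (𝓝 0) := by
      simpa using hε0.const_mul (D * ‖e‖)
    refine tendsto_iff_dist_tendsto_zero.2 (squeeze_zero' (Eventually.of_forall fun _ =>
      dist_nonneg) ?_ hDε)
    filter_upwards [hε0.eventually (gt_mem_nhds hr)] with k hk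
    have hbk : Metric.closedBall x (ε k) ⊆ Ω := (Metric.closedBall_subset_ball hk).trans hbr
    have hψ : IsSpaceTest Ω (fun y => mollifier (Space d) (ε k) (y - x)) :=
      ⟨contDiff_mollifier_sub x, hasCompactSupport_mollifier_sub (hε k) x,
        (tsupport_mollifier_sub (hε k) x).trans hbk⟩
    have hfd : ∀ y, fderiv ℝ (fun y => mollifier (Space d) (ε k) (y - x)) y e
        = fderiv ℝ (mollifier (Space d) (ε k)) (y - x) e := fun y => by
      rw [fderiv_comp_sub]
    have hrw : -∫ y in Ω, w (t, y) * fderiv ℝ (mollifier (Space d) (ε k)) (y - x) e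
        = ∫ y in Ω, fderiv ℝ (u t) y e * mollifier (Space d) (ε k) (y - x) := by
      rw [← neg_neg (∫ y in Ω, fderiv ℝ (u t) y e * mollifier (Space d) (ε k) (y - x)),
        ← integral_fderiv_mul_test hΩ hut hψ e]
      congr 1
      refine integral_congr_ae ?_
      filter_upwards [ht] with y hy
      have hy' : w (t, y) = u t y := hy.symm
      rw [hfd, hy']
    rw [hrw, Real.dist_eq]
    exact abs_integral_mul_mollifier_sub_le (f := fun y => fderiv ℝ (u t) y e) (hε k) hbk
      (measurable_fderiv_apply_const ℝ (u t) e).aestronglyMeasurable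
      (fun y hy => hut.abs_fderiv_apply_sub_le hbk hy e)

lemma aestronglyMeasurable_gradient (hΩ : IsOpen Ω)
    (hum : AEStronglyMeasurable (Function.uncurry u) (spaceTimeMeas T Ω))
    (hu : ∀ᵐ t ∂(timeMeas T), HasC11Bound Ω (u t) D) :
    AEStronglyMeasurable (fun q : ℝ × Space d => gradient (u q.1) q.2) (spaceTimeMeas T Ω) := by
  simp_rw [gradient_eq_sum]
  exact Finset.aestronglyMeasurable_fun_sum _ fun i _ =>
    (aestronglyMeasurable_fderiv_apply hΩ hum hu _).smul_const _

lemma aestronglyMeasurable_nlOp {δ : ℝ} {J : Space d → ℝ} (hJ : IsKernel δ J)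
    (hum : AEStronglyMeasurable (Function.uncurry u) (spaceTimeMeas T Ω)) :
    AEStronglyMeasurable (fun q : ℝ × Space d => nlOp J Ω (u q.1) q.2) (spaceTimeMeas T Ω) := by
  set w := hum.mk _
  have hw : StronglyMeasurable w := hum.stronglyMeasurable_mk
  have hJm := hJ.integrable.aestronglyMeasurable
  set j := hJm.mk _
  have hj : StronglyMeasurable j := hJm.stronglyMeasurable_mk
  have hsm : StronglyMeasurable (Function.uncurry fun (q : ℝ × Space d) (y : Space d) =>
      j (q.2 - y) * (w q - w (q.1, y))) := by
    refine StronglyMeasurable.mul (hj.comp_measurable ?_)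
      (StronglyMeasurable.sub (hw.comp_measurable measurable_fst) (hw.comp_measurable ?_))
    · exact (measurable_snd.comp measurable_fst).sub measurable_snd
    · exact (measurable_fst.comp measurable_fst).prodMk measurable_snd
  refine (hsm.integral_prod_right (ν := spaceMeas Ω)).aestronglyMeasurable.congr ?_
  have hwu := Measure.ae_ae_of_ae_prod hum.ae_eq_mk
  filter_upwards [hum.ae_eq_mk, Measure.quasiMeasurePreserving_fst.ae hwu] with q hq hqt
  have hJx : ∀ᵐ y, J (q.2 - y) = j (q.2 - y) :=
    (Measure.measurePreserving_sub_left volume q.2).quasiMeasurePreserving.ae hJm.ae_eq_mk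
  rw [nlOp]
  refine integral_congr_ae ?_
  filter_upwards [hqt, ae_restrict_of_ae hJx] with y hy hJy
  rw [hJy]
  have e1 : w q = u q.1 q.2 := hq.symm
  have e2 : w (q.1, y) = u q.1 y := hy.symm
  rw [e1, e2]

end JointMeasurability


/-! ### Dominated convergence in `L²` -/

lemma tendsto_eLpNorm_two_zero {α F : Type*} [MeasurableSpace α] {μ : Measure α}
    [IsFiniteMeasure μ] [NormedAddCommGroup F] {f : ℕ → α → F}
    (hf : ∀ n, AEStronglyMeasurable (f n) μ) {K : ℝ}
    (hK : ∀ᶠ n in atTop, ∀ᵐ x ∂μ, ‖f n x‖ ≤ K)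
    (hlim : ∀ᵐ x ∂μ, Tendsto (fun n => f n x) atTop (𝓝 0)) :
    Tendsto (fun n => eLpNorm (f n) 2 μ) atTop (𝓝 0) := by
  have h2 : (2 : ℝ≥0∞) ≠ 0 := by norm_num
  have h2' : (2 : ℝ≥0∞) ≠ ⊤ := by norm_num
  simp_rw [eLpNorm_eq_lintegral_rpow_enorm_toReal h2 h2']
  have hmain : Tendsto (fun n => ∫⁻ x, ‖f n x‖ₑ ^ (2 : ℝ≥0∞).toReal ∂μ) atTop
      (𝓝 (∫⁻ _, 0 ∂μ)) := by
    refine tendsto_lintegral_filter_of_dominated_convergence'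
      (fun _ => ENNReal.ofReal K ^ (2 : ℝ≥0∞).toReal) (Eventually.of_forall fun n => ?_) ?_ ?_ ?_
    · exact (hf n).enorm.pow_const _
    · filter_upwards [hK] with n hn
      filter_upwards [hn] with x hx
      rw [← ofReal_norm]
      gcongr
    · rw [lintegral_const]
      exact ENNReal.mul_ne_top (ENNReal.rpow_ne_top_of_nonneg (by norm_num) ENNReal.ofReal_ne_top)
        (measure_ne_top _ _)
    · filter_upwards [hlim] with x hx
      have h := hx.enorm
      rw [enorm_zero] at h
      have := (ENNReal.continuous_rpow_const (y := (2 : ℝ≥0∞).toReal)).tendsto 0 |>.comp h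
      simpa [Function.comp_def] using this
  rw [lintegral_zero] at hmain
  have := (ENNReal.continuous_rpow_const (y := 1 / (2 : ℝ≥0∞).toReal)).tendsto 0 |>.comp hmain
  simpa [Function.comp_def] using this

lemma tendsto_toReal_eLpNorm_two_zero {α F : Type*} [MeasurableSpace α] {μ : Measure α}
    [IsFiniteMeasure μ] [NormedAddCommGroup F] {f : ℕ → α → F}
    (hf : ∀ n, AEStronglyMeasurable (f n) μ) {K : ℝ}
    (hK : ∀ᶠ n in atTop, ∀ᵐ x ∂μ, ‖f n x‖ ≤ K)
    (hlim : ∀ᵐ x ∂μ, Tendsto (fun n => f n x) atTop (𝓝 0)) :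
    Tendsto (fun n => (eLpNorm (f n) 2 μ).toReal) atTop (𝓝 0) := by
  have h := (ENNReal.tendsto_toReal ENNReal.zero_ne_top).comp
    (tendsto_eLpNorm_two_zero hf hK hlim)
  exact h

lemma integrable_inner_of_memLp {α F : Type*} [MeasurableSpace α] {μ : Measure α}
    [NormedAddCommGroup F] [InnerProductSpace ℝ F] {f g : α → F} (hf : MemLp f 2 μ)
    (hg : MemLp g 2 μ) : Integrable (fun x => inner ℝ (f x) (g x)) μ := by
  refine (L2.integrable_inner (𝕜 := ℝ) (hf.toLp f) (hg.toLp g)).congr ?_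
  filter_upwards [hf.coeFn_toLp, hg.coeFn_toLp] with x h1 h2
  rw [h1, h2]

section Dual

variable {α E : Type*} [MeasurableSpace α] {μ : Measure α} [SeminormedAddCommGroup E]
  [NormedSpace ℝ E] {f : ℕ → α → StrongDual ℝ E} {g : α → StrongDual ℝ E}

lemma eLpNorm_dual_sub (f g : α → StrongDual ℝ E) :
    eLpNorm (f - g) 2 μ = eLpNorm (fun x => ‖f x - g x‖) 2 μ :=
  eLpNorm_congr_enorm_ae (Eventually.of_forall fun _ => (enorm_norm _).symm)

lemma tendsto_eLpNorm_dual_const_smul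
    (h : Tendsto (fun n => eLpNorm (f n - g) 2 μ) atTop (𝓝 0)) (a : ℝ) :
    Tendsto (fun n => eLpNorm ((fun x => a • f n x) - fun x => a • g x) 2 μ) atTop (𝓝 0) := by
  have heq : ∀ n, eLpNorm ((fun x => a • f n x) - fun x => a • g x) 2 μ
      = ‖a‖ₑ * eLpNorm (f n - g) 2 μ := fun n => by
    rw [eLpNorm_dual_sub, eLpNorm_dual_sub, ← enorm_norm a, ← eLpNorm_const_smul]
    congr 1
    ext x
    have : a • f n x - a • g x = a • (f n x - g x) := by
      ext v; simp [mul_sub]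
    rw [this, norm_smul]
    rfl
  simp_rw [heq]
  simpa using ENNReal.Tendsto.const_mul h (Or.inr (by simp))

lemma tendsto_dual_of_norm_sub_le [IsFiniteMeasure μ]
    (hf : ∀ n, MemLp (f n) 2 μ) (hg : MemLp g 2 μ) {c : ℕ → ℝ} (hc : Tendsto c atTop (𝓝 0))
    {p : ℕ → Prop} (hp : ∀ᶠ n in atTop, p n) {e : ℕ → α → ℝ}
    (h : ∀ᵐ x ∂μ, ∀ n, p n → ‖f n x - g x‖ ≤ c n + e n x) {B : ℝ}
    (heB : ∀ᵐ x ∂μ, ∀ n, e n x ≤ B) (he : ∀ᵐ x ∂μ, Tendsto (fun n => e n x) atTop (𝓝 0)) :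
    Tendsto (fun n => eLpNorm (f n - g) 2 μ) atTop (𝓝 0) ∧
      ∀ᵐ x ∂μ, Tendsto (fun n => f n x) atTop (𝓝 (g x)) := by
  have hlim : ∀ᵐ x ∂μ, Tendsto (fun n => ‖f n x - g x‖) atTop (𝓝 0) := by
    filter_upwards [h, he] with x a1 a2
    refine squeeze_zero' (Eventually.of_forall fun n => norm_nonneg _) ?_ (by simpa using hc.add a2)
    filter_upwards [hp] with n hn using a1 n hn
  refine ⟨?_, hlim.mono fun x hx => tendsto_iff_norm_sub_tendsto_zero.2 hx⟩
  simp_rw [eLpNorm_dual_sub]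
  refine tendsto_eLpNorm_two_zero (K := 1 + B) (fun n => ?_) ?_ hlim
  · refine ((hf n).1.dist hg.1).congr (Eventually.of_forall fun x => ?_)
    exact dist_eq_norm (f n x) (g x)
  filter_upwards [hp, hc.eventually (gt_mem_nhds one_pos)] with n hn hcn
  filter_upwards [h, heB] with x a1 a2
  rw [norm_norm]
  exact (a1 n hn).trans (add_le_add hcn.le (a2 n))
lemma memLp_dual_const_smul {f : α → StrongDual ℝ E} (hf : MemLp f 2 μ) (a : ℝ) :
    MemLp (fun x => a • f x) 2 μ := by
  refine ⟨(continuous_const_smul a).comp_aestronglyMeasurable hf.1, ?_⟩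
  have hr : MemLp (fun x => ‖f x‖) 2 μ := ⟨hf.1.norm, by
    rw [eLpNorm_congr_enorm_ae (g := f) (Eventually.of_forall fun x => enorm_norm _)]
    exact hf.2⟩
  rw [eLpNorm_congr_enorm_ae (g := fun x => a * ‖f x‖)
    (Eventually.of_forall fun x => by rw [enorm_mul, enorm_norm, enorm_smul])]
  exact (hr.const_mul a).2

end Dual

lemma tendsto_apply_of_tendsto {E : Type*} [NormedAddCommGroup E] [NormedSpace ℝ E]
    {f : ℕ → StrongDual ℝ E} {g : StrongDual ℝ E} (h : Tendsto f atTop (𝓝 g)) (v : E) :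
    Tendsto (fun n => f n v) atTop (𝓝 (g v)) :=
  ((ContinuousLinearMap.apply ℝ ℝ v).continuous.tendsto _).comp h

/-! ### Consistency in `H⁻¹(Ω)` -/

section Consistency

variable {Ω : Set (Space d)}

lemma tendsto_layerWeight (hΩ : IsOpen Ω) (hb : Bornology.IsBounded Ω) {K : ℝ} (hK : 0 ≤ K)
    {δ : ℕ → ℝ} (hδ0 : ∀ n, 0 < δ n) (hδ : Tendsto δ atTop (𝓝 0)) :
    Tendsto (fun n => (eLpNorm (layerWeight Ω K (δ n)) 2 (spaceMeas Ω)).toReal) atTop (𝓝 0) := by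
  have := isFiniteMeasure_spaceMeas hb
  refine tendsto_toReal_eLpNorm_two_zero (K := 1 + (K + 1))
    (fun n => (measurable_layerWeight K).aestronglyMeasurable) ?_ ?_
  · filter_upwards [hδ.eventually (gt_mem_nhds one_pos)] with n hn
    refine Eventually.of_forall fun x => ?_
    rw [Real.norm_of_nonneg (layerWeight_nonneg hK (hδ0 n).le x)]
    exact (layerWeight_le hK x).trans (by linarith)
  · filter_upwards [ae_restrict_mem hΩ.measurableSet] with x hx
    have hev : ∀ᶠ s in 𝓝 (0 : ℝ), x ∉ Metric.cthickening s Ωᶜ :=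
      Metric.eventually_notMem_cthickening_of_infEDist_pos
        (by rw [hΩ.isClosed_compl.closure_eq]; simpa using hx)
    refine hδ.congr' ?_
    filter_upwards [hδ.eventually hev] with n hn
    rw [layerWeight, indicator_of_notMem hn, add_zero]

lemma aestronglyMeasurable_nlOp_slice {δ : ℝ} {J : Space d → ℝ} (hJ : IsKernel δ J)
    (hΩ : MeasurableSet Ω) (hb : Bornology.IsBounded Ω) {u : Space d → ℝ} {D : ℝ}
    (hum : AEStronglyMeasurable u (spaceMeas Ω)) (hu : ∀ x ∈ Ω, |u x| ≤ D) :
    AEStronglyMeasurable (nlOp J Ω u) (spaceMeas Ω) := by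
  have := isFiniteMeasure_spaceMeas hb
  have h := (hJ.integrable_form hΩ (v := fun _ => (1 : ℝ)) hum hu
    (integrable_const 1)).1.integral_prod_right'
  refine h.congr (Eventually.of_forall fun x => ?_)
  simp [nlOp]

lemma memLp_nlOp {δ : ℝ} {J : Space d → ℝ} (hJ : IsKernel δ J)
    (hΩ : MeasurableSet Ω) (hb : Bornology.IsBounded Ω) {u : Space d → ℝ} {D : ℝ}
    (hum : AEStronglyMeasurable u (spaceMeas Ω)) (hu : ∀ x ∈ Ω, |u x| ≤ D) :
    MemLp (nlOp J Ω u) 2 (spaceMeas Ω) := by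
  have := isFiniteMeasure_spaceMeas hb
  exact MemLp.of_bound (aestronglyMeasurable_nlOp_slice hJ hΩ hb hum hu) (2 * D * ∫ z, J z)
    ((ae_restrict_mem hΩ).mono fun x hx => abs_nlOp_le_of_bound hJ hΩ hu hx)

lemma HasC11Bound.memLp_gradient (hΩ : MeasurableSet Ω) (hb : Bornology.IsBounded Ω)
    {u : Space d → ℝ} {D : ℝ} (hu : HasC11Bound Ω u D) :
    MemLp (gradient u) 2 (spaceMeas Ω) := by
  have := isFiniteMeasure_spaceMeas hb
  exact MemLp.of_bound (measurable_gradient u).aestronglyMeasurable D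
    ((ae_restrict_mem hΩ).mono fun x hx => by
      rw [norm_gradient]; exact hu.norm_fderiv_le x hx)

/-- Consistency of the nonlocal operator with `-Δ` in `H⁻¹(Ω)`. -/
theorem abs_integral_nlOp_sub_le {K r : ℝ} (hK : 0 ≤ K) (hΩ : IsOpen Ω)
    (hb : Bornology.IsBounded Ω) (hqc : IsQuasiConvex Ω K r) {δ : ℝ} {J : Space d → ℝ}
    (hJ : IsKernel δ J) {u : Space d → ℝ} {D : ℝ} (hu : HasC11Bound Ω u D) (hD : 0 ≤ D)
    (hδ : 0 ≤ δ) (hδr : δ < r) (v : H10 Ω) :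
    |(∫ x in Ω, nlOp J Ω u x * fn v x) - ∫ x in Ω, inner ℝ (gradient u x) (grad v x)|
      ≤ d * D * (eLpNorm (layerWeight Ω K δ) 2 (spaceMeas Ω)).toReal * ‖v‖ := by
  have := isFiniteMeasure_spaceMeas hb
  have hum := hu.aestronglyMeasurable hΩ
  have ha := memLp_nlOp hJ hΩ.measurableSet hb hum hu.abs_le
  have hP : MemLp (fun x => -gradient u x) 2 (spaceMeas Ω) :=
    (hu.memLp_gradient hΩ.measurableSet hb).neg
  have hΛ : ∀ v : H10 Ω, dualPair ha hP v
      = (∫ x in Ω, nlOp J Ω u x * fn v x) - ∫ x in Ω, inner ℝ (gradient u x) (grad v x) := by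
    intro v
    rw [dualPair_apply]
    simp only [inner_neg_left, integral_neg]
    ring
  rw [← hΛ]
  refine H10.induction_on (P := fun v => |dualPair ha hP v|
    ≤ d * D * (eLpNorm (layerWeight Ω K δ) 2 (spaceMeas Ω)).toReal * ‖v‖) v ?_ ?_
  · exact isClosed_le (dualPair ha hP).continuous.abs (continuous_const.mul continuous_norm)
  · rintro v ψ ⟨hψ, h1, h2⟩
    rw [hΛ]
    have e1 : ∫ x in Ω, nlOp J Ω u x * fn v x = nlForm J Ω u ψ := by
      rw [nlForm_eq_integral_nlOp_mul hJ hΩ.measurableSet hum hu.abs_le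
        ((hψ.memLp hb).integrable (by norm_num))]
      refine integral_congr_ae ?_
      filter_upwards [h1] with x hx
      rw [hx]
    have e2 : ∫ x in Ω, inner ℝ (gradient u x) (grad v x)
        = ∫ x in Ω, inner ℝ (gradient u x) (gradient ψ x) := by
      refine integral_congr_ae ?_
      filter_upwards [h2] with x hx
      rw [hx]
    rw [e1, e2]
    refine (abs_nlForm_sub_le hK hΩ hb hqc hJ hu hD hδr hψ).trans ?_
    rw [mul_assoc (d * D : ℝ)]
    refine mul_le_mul_of_nonneg_left ?_ (mul_nonneg d.cast_nonneg hD)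
    have hw : MemLp (layerWeight Ω K δ) 2 (spaceMeas Ω) :=
      MemLp.of_bound (measurable_layerWeight K).aestronglyMeasurable (δ + (K + 1))
        (Eventually.of_forall fun x => by
          rw [Real.norm_of_nonneg (layerWeight_nonneg hK hδ x)]
          exact layerWeight_le hK x)
    have e3 : ∫ x in Ω, layerWeight Ω K δ x * ‖fderiv ℝ ψ x‖
        = ∫ x in Ω, layerWeight Ω K δ x * ‖grad v x‖ := by
      refine integral_congr_ae ?_
      filter_upwards [h2] with x hx
      rw [hx, norm_gradient]
    rw [e3]
    refine (le_abs_self _).trans ((abs_integral_mul_le hw (memLp_grad v).norm).trans ?_)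
    refine mul_le_mul_of_nonneg_left ?_ ENNReal.toReal_nonneg
    rw [eLpNorm_norm]
    exact norm_snd_le v

end Consistency

/-! ### Convergence on space-time -/

section SpaceTime

variable {Ω : Set (Space d)} {T D : ℝ} {u : ℕ → ℝ → Space d → ℝ} {u' : ℝ → Space d → ℝ}

lemma exists_spaceTime_limit (hΩ : IsOpen Ω)
    (hum : ∀ n, AEStronglyMeasurable (Function.uncurry (u n)) (spaceTimeMeas T Ω))
    (hu : ∀ᵐ t ∂(timeMeas T), ∀ n, HasC11Bound Ω (u n t) D)
    (hweak : ∀ᵐ t ∂(timeMeas T), ∀ ψ, IsSpaceTest Ω ψ →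
      ∃ l, Tendsto (fun n => ∫ x in Ω, u n t x * ψ x) atTop (𝓝 l)) :
    ∃ (v : ℝ → Space d → ℝ) (G : ℝ → Space d → Space d),
      (∀ᵐ q ∂(spaceTimeMeas T Ω), Tendsto (fun n => u n q.1 q.2) atTop (𝓝 (v q.1 q.2))) ∧
      ∀ᵐ q ∂(spaceTimeMeas T Ω),
        Tendsto (fun n => gradient (u n q.1) q.2) atTop (𝓝 (G q.1 q.2)) := by
  have hex : ∀ᵐ t ∂(timeMeas T), ∀ x ∈ Ω, (∃ l, Tendsto (fun n => u n t x) atTop (𝓝 l)) ∧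
      ∃ p, Tendsto (fun n => gradient (u n t) x) atTop (𝓝 p) := by
    filter_upwards [hu, hweak] with t h1 h2 x hx
    exact exists_tendsto_of_hasC11Bound hΩ h1 h2 hx
  have hq := ae_spaceTime_of_ae_forall hΩ.measurableSet hex
  obtain ⟨v, -, hv⟩ := exists_stronglyMeasurable_limit_of_tendsto_ae
    (f := fun n (q : ℝ × Space d) => u n q.1 q.2) hum (hq.mono fun q h => h.1)
  obtain ⟨G, -, hG⟩ := exists_stronglyMeasurable_limit_of_tendsto_ae
    (f := fun n (q : ℝ × Space d) => gradient (u n q.1) q.2)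
    (fun n => aestronglyMeasurable_gradient hΩ (hum n) (hu.mono fun t h => h n))
    (hq.mono fun q h => h.2)
  exact ⟨fun t x => v (t, x), fun t x => G (t, x), hv, hG⟩

lemma ae_bound_of_hasC11Bound (hΩ : MeasurableSet Ω)
    (hu : ∀ᵐ t ∂(timeMeas T), ∀ n, HasC11Bound Ω (u n t) D) :
    ∀ᵐ q ∂(spaceTimeMeas T Ω), ∀ n, |u n q.1 q.2| ≤ D ∧ ‖gradient (u n q.1) q.2‖ ≤ D := by
  refine ae_spaceTime_of_ae_forall hΩ
    (p := fun t x => ∀ n, |u n t x| ≤ D ∧ ‖gradient (u n t) x‖ ≤ D) ?_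
  filter_upwards [hu] with t ht x hx n
  rw [norm_gradient]
  exact ⟨(ht n).abs_le x hx, (ht n).norm_fderiv_le x hx⟩

/-- A bounded sequence converging weakly and pointwise has the same limit in both senses. -/
lemma ae_tendsto_of_tendstoWeakly (hb : Bornology.IsBounded Ω) (hweak : TendstoWeakly T Ω u u')
    (hbd : ∀ᵐ q ∂(spaceTimeMeas T Ω), ∀ n, |u n q.1 q.2| ≤ D) {v : ℝ → Space d → ℝ}
    (hv : ∀ᵐ q ∂(spaceTimeMeas T Ω), Tendsto (fun n => u n q.1 q.2) atTop (𝓝 (v q.1 q.2))) :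
    ∀ᵐ q ∂(spaceTimeMeas T Ω), Tendsto (fun n => u n q.1 q.2) atTop (𝓝 (u' q.1 q.2)) := by
  have := isFiniteMeasure_spaceMeas hb
  obtain ⟨hu', hun, hw⟩ := hweak
  have hvm : AEStronglyMeasurable (Function.uncurry v) (spaceTimeMeas T Ω) :=
    aestronglyMeasurable_of_tendsto_ae atTop (fun n => (hun n).1) hv
  have hvL : MemLp (Function.uncurry v) 2 (spaceTimeMeas T Ω) := by
    refine MemLp.of_bound hvm D ?_
    filter_upwards [hv, hbd] with q h1 h2
    exact le_of_tendsto h1.norm (Eventually.of_forall h2)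
  set w : ℝ × Space d → ℝ := Function.uncurry v - Function.uncurry u'
  have hwL : MemLp w 2 (spaceTimeMeas T Ω) := hvL.sub hu'
  have hwi : Integrable w (spaceTimeMeas T Ω) := hwL.integrable (by norm_num)
  have t1 := hw w hwL
  have t2 : Tendsto (fun n => ∫ p, u n p.1 p.2 * w p ∂(spaceTimeMeas T Ω)) atTop
      (𝓝 (∫ p, v p.1 p.2 * w p ∂(spaceTimeMeas T Ω))) := by
    refine tendsto_integral_of_dominated_convergence (fun p => D * ‖w p‖)
      (fun n => (hun n).1.mul hwL.1) (hwi.norm.const_mul D) (fun n => ?_) ?_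
    · filter_upwards [hbd] with q hq
      rw [norm_mul]
      exact mul_le_mul_of_nonneg_right (hq n) (norm_nonneg _)
    · filter_upwards [hv] with q hq
      exact hq.mul_const _
  have heq := tendsto_nhds_unique t1 t2
  have hzero : ∫ p, w p * w p ∂(spaceTimeMeas T Ω) = 0 := by
    have : ∀ p, w p * w p = v p.1 p.2 * w p - u' p.1 p.2 * w p := fun p => by
      rw [← sub_mul]; rfl
    have i1 : Integrable (fun p => v p.1 p.2 * w p) (spaceTimeMeas T Ω) :=
      integrable_mul_of_memLp hvL hwL
    have i2 : Integrable (fun p => u' p.1 p.2 * w p) (spaceTimeMeas T Ω) :=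
      integrable_mul_of_memLp hu' hwL
    simp_rw [this]
    rw [integral_sub i1 i2, heq, sub_self]
  have hae := (integral_eq_zero_iff_of_nonneg (fun p => mul_self_nonneg (w p))
    (integrable_mul_of_memLp hwL hwL)).1 hzero
  filter_upwards [hv, hae] with q h1 h2
  have h3 : w q = 0 := mul_self_eq_zero.1 h2
  have h4 : v q.1 q.2 = u' q.1 q.2 := sub_eq_zero.1 h3
  rwa [h4] at h1

/-- Convergence of the nonlocal operators in `L²(0,T;H⁻¹(Ω))`. -/
theorem tendstoL2HNeg_nlOp (hΩ : IsC3Domain Ω) {δ : ℕ → ℝ} {J : ℕ → Space d → ℝ}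
    (hJ : ∀ n, IsKernel (δ n) (J n)) (hδ0 : ∀ n, 0 < δ n) (hδ : Tendsto δ atTop (𝓝 0))
    (hum : ∀ n, AEStronglyMeasurable (Function.uncurry (u n)) (spaceTimeMeas T Ω))
    (hu : ∀ᵐ t ∂(timeMeas T), ∀ n, HasC11Bound Ω (u n t) D) (hD : 0 ≤ D)
    {G : ℝ → Space d → Space d}
    (h1 : ∀ᵐ q ∂(spaceTimeMeas T Ω), Tendsto (fun n => u n q.1 q.2) atTop (𝓝 (u' q.1 q.2)))
    (h2 : ∀ᵐ q ∂(spaceTimeMeas T Ω),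
      Tendsto (fun n => gradient (u n q.1) q.2) atTop (𝓝 (G q.1 q.2))) :
    HasSpaceGrad T Ω u' G ∧ (∀ᵐ q ∂(spaceTimeMeas T Ω), ‖G q.1 q.2‖ ≤ D) ∧
    TendstoL2HNeg T Ω (fun n t v => ∫ x in Ω, nlOp (J n) Ω (u n t) x * fn v x)
      (fun t v => -lapPairing (G t) v) ∧
    ∀ᵐ t ∂(timeMeas T), ∀ v : H10 Ω, Tendsto
      (fun n => ∫ x in Ω, nlOp (J n) Ω (u n t) x * fn v x) atTop (𝓝 (-lapPairing (G t) v)) := by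
  have hm := hΩ.isOpen.measurableSet
  have hb := hΩ.isBounded
  have := isFiniteMeasure_spaceMeas hb
  have hgm : ∀ n, AEStronglyMeasurable (fun q : ℝ × Space d => gradient (u n q.1) q.2)
      (spaceTimeMeas T Ω) := fun n =>
    aestronglyMeasurable_gradient hΩ.isOpen (hum n) (hu.mono fun t h => h n)
  have hbd := ae_bound_of_hasC11Bound hm hu
  have hu'm : AEStronglyMeasurable (Function.uncurry u') (spaceTimeMeas T Ω) :=
    aestronglyMeasurable_of_tendsto_ae atTop hum h1
  have hGm : AEStronglyMeasurable (Function.uncurry G) (spaceTimeMeas T Ω) :=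
    aestronglyMeasurable_of_tendsto_ae atTop hgm h2
  have hu'b : ∀ᵐ q ∂(spaceTimeMeas T Ω), ‖u' q.1 q.2‖ ≤ D := by
    filter_upwards [h1, hbd] with q hq hqb
    exact le_of_tendsto hq.norm (Eventually.of_forall fun n => (hqb n).1)
  have hGb : ∀ᵐ q ∂(spaceTimeMeas T Ω), ‖G q.1 q.2‖ ≤ D := by
    filter_upwards [h2, hbd] with q hq hqb
    exact le_of_tendsto hq.norm (Eventually.of_forall fun n => (hqb n).2)
  have h1t := Measure.ae_ae_of_ae_prod h1
  have h2t := Measure.ae_ae_of_ae_prod h2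
  have hGt := Measure.ae_ae_of_ae_prod hGb
  have hgrad : HasSpaceGrad T Ω u' G := by
    refine ⟨MemLp.of_bound hu'm D hu'b, MemLp.of_bound hGm D hGb, ?_⟩
    filter_upwards [hu, h1t, h2t] with t a1 a2 a3
    exact hasWeakGrad_of_tendsto hΩ.isOpen hb a1 a2 a3
  obtain ⟨K, hK, r, hr, hqc⟩ := hΩ.exists_isQuasiConvex
  have hF : ∀ n, ∃ F : ℝ → HNeg Ω, MemLp F 2 (timeMeas T) ∧ ∀ᵐ t ∂(timeMeas T), ∀ v : H10 Ω,
      F t v = ∫ x in Ω, nlOp (J n) Ω (u n t) x * fn v x := by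
    intro n
    have hJ0 : 0 ≤ ∫ z, J n z := integral_nonneg (hJ n).nonneg
    obtain ⟨F, hF1, hF2⟩ := exists_dual_representation (T := T) (Ω := Ω) hb
      (a := fun t => nlOp (J n) Ω (u n t)) (P := fun _ _ => 0) (K := 2 * D * ∫ z, J n z)
      (aestronglyMeasurable_nlOp (hJ n) (hum n)) aestronglyMeasurable_const
      (by
        filter_upwards [hu] with t ht
        filter_upwards [ae_restrict_mem hm] with x hx
        exact abs_nlOp_le_of_bound (hJ n) hm (ht n).abs_le hx)
      (Eventually.of_forall fun t => Eventually.of_forall fun x => by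
        rw [norm_zero]; positivity)
    refine ⟨F, hF1, hF2.mono fun t ht v => ?_⟩
    rw [ht v]
    simp
  choose F hFL hFr using hF
  obtain ⟨F', hF'L, hF'r⟩ := exists_dual_representation (T := T) (Ω := Ω) hb
    (a := fun _ _ => 0) (P := G) (K := D) aestronglyMeasurable_const hGm
    (Eventually.of_forall fun t => Eventually.of_forall fun x => by
      rw [abs_zero]; exact hD) hGt
  have hF'r' : ∀ᵐ t ∂(timeMeas T), ∀ v : H10 Ω, F' t v = -lapPairing (G t) v := by
    filter_upwards [hF'r] with t ht v
    rw [ht v]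
    simp [lapPairing]
  set c : ℕ → ℝ := fun n => d * D * (eLpNorm (layerWeight Ω K (δ n)) 2 (spaceMeas Ω)).toReal
  have hc : Tendsto c atTop (𝓝 0) := by
    simpa using (tendsto_layerWeight hΩ.isOpen hb hK.le hδ0 hδ).const_mul (d * D)
  have hc0 : ∀ n, 0 ≤ c n := fun n => by positivity
  have hnorm : ∀ᵐ t ∂(timeMeas T), ∀ n, δ n < r → ‖F n t - F' t‖
      ≤ c n + (eLpNorm (fun x => gradient (u n t) x - G t x) 2 (spaceMeas Ω)).toReal := by
    filter_upwards [ae_all_iff.2 hFr, hF'r', hu, hgrad.2.2] with t a1 a2 a3 a4 n hn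
    refine ContinuousLinearMap.opNorm_le_bound _ (add_nonneg (hc0 n) ENNReal.toReal_nonneg)
      fun v => ?_
    have hP1 := (a3 n).memLp_gradient hm hb
    have hP : MemLp (fun x => gradient (u n t) x - G t x) 2 (spaceMeas Ω) := hP1.sub a4.2.1
    have hz : MemLp (fun _ : Space d => (0 : ℝ)) 2 (spaceMeas Ω) := MemLp.zero'
    have hsplit : (F n t - F' t) v
        = ((∫ x in Ω, nlOp (J n) Ω (u n t) x * fn v x)
            - ∫ x in Ω, inner ℝ (gradient (u n t) x) (grad v x)) + dualPair hz hP v := by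
      have i1 : Integrable (fun x => inner ℝ (gradient (u n t) x) (grad v x)) (spaceMeas Ω) :=
        integrable_inner_of_memLp hP1 (memLp_grad v)
      have i2 : Integrable (fun x => inner ℝ (G t x) (grad v x)) (spaceMeas Ω) :=
        integrable_inner_of_memLp a4.2.1 (memLp_grad v)
      have e0 : (F n t - F' t) v = F n t v - F' t v := rfl
      rw [e0, a1 n v, a2 v, dualPair_apply, lapPairing]
      simp only [inner_sub_left]
      rw [integral_sub i1 i2]
      simp
    rw [hsplit, add_mul]
    refine (norm_add_le _ _).trans (add_le_add ?_ ?_)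
    · exact abs_integral_nlOp_sub_le hK.le hΩ.isOpen hb hqc (hJ n) (a3 n) hD (hδ0 n).le hn v
    · refine (ContinuousLinearMap.le_opNorm _ v).trans ?_
      refine mul_le_mul_of_nonneg_right ((norm_dualPair_le hz hP).trans ?_) (norm_nonneg v)
      simp
  have hδr : ∀ᶠ n in atTop, δ n < r := hδ.eventually (gt_mem_nhds hr)
  have hgb : ∀ᵐ t ∂(timeMeas T), ∀ n, ∀ᵐ x ∂(spaceMeas Ω),
      ‖gradient (u n t) x - G t x‖ ≤ 2 * D := by
    filter_upwards [hu, hGt] with t a1 a2 n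
    filter_upwards [a2, ae_restrict_mem hm] with x b1 b2
    refine (norm_sub_le _ _).trans ?_
    have := (a1 n).norm_fderiv_le x b2
    rw [← norm_gradient] at this
    linarith
  have hgl : ∀ᵐ t ∂(timeMeas T), Tendsto (fun n =>
      (eLpNorm (fun x => gradient (u n t) x - G t x) 2 (spaceMeas Ω)).toReal) atTop (𝓝 0) := by
    filter_upwards [hgb, h2t, hgrad.2.2] with t a1 a2 a3
    refine tendsto_toReal_eLpNorm_two_zero (K := 2 * D)
      (fun n => (measurable_gradient _).aestronglyMeasurable.sub a3.2.1.1)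
      (Eventually.of_forall a1) ?_
    filter_upwards [a2] with x hx
    simpa using hx.sub_const (G t x)
  have hconv := tendsto_dual_of_norm_sub_le (E := H10 Ω) hFL hF'L hc hδr hnorm
    (B := 2 * D * (spaceMeas Ω univ ^ (2 : ℝ)⁻¹).toReal)
    (by
      filter_upwards [hgb] with t a1 n
      exact eLpNorm_toReal_le_of_bound hb (by positivity) (a1 n)) hgl
  refine ⟨hgrad, hGb, ⟨F, F', fun n => ⟨hFL n, hFr n⟩, ⟨hF'L, hF'r'⟩, hconv.1⟩, ?_⟩
  filter_upwards [hconv.2, ae_all_iff.2 hFr, hF'r'] with t a1 a2 a3 v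
  rw [← a3 v]
  simp_rw [← a2 _ v]
  exact tendsto_apply_of_tendsto a1 v

lemma TendstoL2HNeg.const_mul {ℓ : ℕ → ℝ → H10 Ω → ℝ} {ℓ' : ℝ → H10 Ω → ℝ}
    (h : TendstoL2HNeg T Ω ℓ ℓ') (a : ℝ) :
    TendstoL2HNeg T Ω (fun n t v => a * ℓ n t v) (fun t v => a * ℓ' t v) := by
  obtain ⟨F, F', h1, h2, h3⟩ := h
  refine ⟨fun n t => a • F n t, fun t => a • F' t,
    fun n => ⟨memLp_dual_const_smul (E := H10 Ω) (h1 n).1 a, ?_⟩,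
    ⟨memLp_dual_const_smul (E := H10 Ω) h2.1 a, ?_⟩,
    tendsto_eLpNorm_dual_const_smul (E := H10 Ω) h3 a⟩
  · filter_upwards [(h1 n).2] with t ht v
    rw [← ht v, smul_apply, smul_eq_mul]
  · filter_upwards [h2.2] with t ht v
    rw [← ht v, smul_apply, smul_eq_mul]

lemma TendstoL2HNeg.congr {ℓ m : ℕ → ℝ → H10 Ω → ℝ} {ℓ' m' : ℝ → H10 Ω → ℝ}
    (h : TendstoL2HNeg T Ω ℓ ℓ') (h1 : ∀ n, ∀ᵐ t ∂(timeMeas T), ∀ v, ℓ n t v = m n t v)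
    (h2 : ∀ t v, ℓ' t v = m' t v) : TendstoL2HNeg T Ω m m' := by
  obtain ⟨F, F', a1, a2, a3⟩ := h
  refine ⟨F, F', fun n => ⟨(a1 n).1, ?_⟩, ⟨a2.1, ?_⟩, a3⟩
  · filter_upwards [(a1 n).2, h1 n] with t b1 b2 v
    rw [b1 v, b2 v]
  · filter_upwards [a2.2] with t b1 v
    rw [b1 v, h2 t v]

end SpaceTime


/-! ### The free energy density -/

lemma IsFreeEnergy.continuous_dPhi {f : ℝ → ℝ → ℝ} (hf : IsFreeEnergy f) :
    Continuous fun p : ℝ × ℝ => dPhi f p.1 p.2 := by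
  have heq : (fun p : ℝ × ℝ => dPhi f p.1 p.2)
      = fun p => fderiv ℝ (Function.uncurry f) p ((1 : ℝ), (0 : ℝ)) := by
    funext p
    have h1 : HasFDerivAt (Function.uncurry f) (fderiv ℝ (Function.uncurry f) p) (p.1, p.2) :=
      (hf.contDiff.differentiable one_ne_zero p).hasFDerivAt
    have h2 : HasDerivAt (fun s : ℝ => (s, p.2)) ((1 : ℝ), (0 : ℝ)) p.1 :=
      (hasDerivAt_id p.1).prodMk (hasDerivAt_const p.1 p.2)
    exact (h1.comp_hasDerivAt p.1 h2).deriv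
  rw [heq]
  exact (hf.contDiff.continuous_fderiv one_ne_zero).clm_apply continuous_const

lemma IsFreeEnergy.exists_abs_dPhi_le {f : ℝ → ℝ → ℝ} (hf : IsFreeEnergy f) (D : ℝ) :
    ∃ B, 0 ≤ B ∧ ∀ p q, |p| ≤ D → |q| ≤ D → |dPhi f p q| ≤ B := by
  obtain ⟨B, hB⟩ := ((isCompact_Icc (a := -D) (b := D)).prod
    (isCompact_Icc (a := -D) (b := D))).exists_bound_of_continuousOn hf.continuous_dPhi.continuousOn
  exact ⟨|B|, abs_nonneg B, fun p q hp hq =>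
    (hB (p, q) ⟨abs_le.1 hp, abs_le.1 hq⟩).trans (le_abs_self B)⟩

section Composition

variable {Ω : Set (Space d)}

lemma HasC11Bound.comp {u : Space d → ℝ} {C : ℝ} (hu : HasC11Bound Ω u C) (hC : 0 ≤ C) {h : ℝ → ℝ}
    (hh : ContDiff ℝ 1 h) {K : ℝ≥0} (hK : LipschitzWith K (deriv h)) {B : ℝ} (hB : 0 ≤ B)
    (h0 : ∀ p, |p| ≤ C → |h p| ≤ B) (h1 : ∀ p, |p| ≤ C → |deriv h p| ≤ B) :
    HasC11Bound Ω (fun x => h (u x)) (B + B * C + K * C * C) := by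
  have hd : ∀ x ∈ Ω, HasFDerivAt (fun x => h (u x)) (deriv h (u x) • fderiv ℝ u x) x := fun x hx =>
    ((hh.differentiable one_ne_zero (u x)).hasDerivAt).comp_hasFDerivAt x
      (hu.differentiableAt x hx).hasFDerivAt
  have hK0 : 0 ≤ (K : ℝ) * C * C := by positivity
  have hBC : 0 ≤ B * C := by positivity
  refine ⟨fun x hx => ?_, fun x hx => (hd x hx).differentiableAt, fun x hx => ?_,
    fun x hx y hy hxy => ?_⟩
  · have := h0 _ (hu.abs_le x hx)
    linarith
  · rw [(hd x hx).fderiv, norm_smul, Real.norm_eq_abs]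
    have := mul_le_mul (h1 _ (hu.abs_le x hx)) (hu.norm_fderiv_le x hx) (norm_nonneg _) hB
    linarith
  · rw [(hd x hx).fderiv, (hd y hy).fderiv]
    have e : deriv h (u y) • fderiv ℝ u y - deriv h (u x) • fderiv ℝ u x
        = deriv h (u y) • (fderiv ℝ u y - fderiv ℝ u x)
          + (deriv h (u y) - deriv h (u x)) • fderiv ℝ u x := by
      rw [smul_sub, sub_smul]
      abel
    have l1 : |deriv h (u y) - deriv h (u x)| ≤ K * (C * ‖y - x‖) := by
      have a1 := hK.dist_le_mul (u y) (u x)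
      rw [Real.dist_eq, Real.dist_eq] at a1
      exact a1.trans (mul_le_mul_of_nonneg_left (hu.abs_sub_le_of_segment hxy) K.2)
    rw [e]
    refine (norm_add_le _ _).trans ?_
    rw [norm_smul, norm_smul, Real.norm_eq_abs, Real.norm_eq_abs]
    have a1 := mul_le_mul (h1 _ (hu.abs_le y hy)) (hu.lipschitz x hx y hy hxy) (norm_nonneg _) hB
    have a2 := mul_le_mul l1 (hu.norm_fderiv_le x hx) (norm_nonneg _) (by positivity)
    have a3 : 0 ≤ B * ‖y - x‖ := by positivity
    nlinarith

lemma HasC11Bound.sub_div {u v : Space d → ℝ} {C D : ℝ} (hu : HasC11Bound Ω u C)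
    (hv : HasC11Bound Ω v D) {A : ℝ} (hA : 0 < A) :
    HasC11Bound Ω (fun x => (u x - v x) / A) ((C + D) / A) := by
  have hd : ∀ x ∈ Ω, HasFDerivAt (fun x => (u x - v x) / A)
      (A⁻¹ • (fderiv ℝ u x - fderiv ℝ v x)) x := fun x hx => by
    simp_rw [div_eq_inv_mul]
    exact ((hu.differentiableAt x hx).hasFDerivAt.sub
      (hv.differentiableAt x hx).hasFDerivAt).const_mul A⁻¹
  refine ⟨fun x hx => ?_, fun x hx => (hd x hx).differentiableAt, fun x hx => ?_,
    fun x hx y hy hxy => ?_⟩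
  · rw [abs_div, abs_of_pos hA]
    gcongr
    exact (abs_sub _ _).trans (add_le_add (hu.abs_le x hx) (hv.abs_le x hx))
  · rw [(hd x hx).fderiv, norm_smul, norm_inv, Real.norm_of_nonneg hA.le, ← div_eq_inv_mul]
    gcongr
    exact (norm_sub_le _ _).trans (add_le_add (hu.norm_fderiv_le x hx) (hv.norm_fderiv_le x hx))
  · rw [(hd x hx).fderiv, (hd y hy).fderiv, ← smul_sub, norm_smul, norm_inv,
      Real.norm_of_nonneg hA.le, ← div_eq_inv_mul, div_mul_eq_mul_div]
    gcongr
    rw [sub_sub_sub_comm, add_mul]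
    exact (norm_sub_le _ _).trans (add_le_add (hu.lipschitz x hx y hy hxy)
      (hv.lipschitz x hx y hy hxy))

/-- Bounds for the phase field and the chemical potential control the concentration. -/
lemma IsFreeEnergy.exists_hasC11Bound {f : ℝ → ℝ → ℝ} (hf : IsFreeEnergy f) {C : ℝ} (hC : 0 ≤ C) :
    ∃ D, C ≤ D ∧ ∀ u c : Space d → ℝ, HasC11Bound Ω u C →
      HasC11Bound Ω (fun x => dC f (u x) (c x)) C → HasC11Bound Ω c D := by
  obtain ⟨-, -, -, -, -, -, ⟨A, h, -, -, hA, ⟨hh, ⟨K, hK⟩, -⟩, -, -, hdC, -⟩, -⟩ := hf.splitting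
  obtain ⟨B₀, hB₀⟩ := (isCompact_Icc (a := -C) (b := C)).exists_bound_of_continuousOn
    hh.continuous.continuousOn
  obtain ⟨B₁, hB₁⟩ := (isCompact_Icc (a := -C) (b := C)).exists_bound_of_continuousOn
    (hh.continuous_deriv le_rfl).continuousOn
  set B := max |B₀| |B₁|
  have hB : 0 ≤ B := (abs_nonneg _).trans (le_max_left _ _)
  refine ⟨max C ((C + (B + B * C + K * C * C)) / A), le_max_left _ _, fun u c hu hg => ?_⟩
  have hcomp := hu.comp hC hh hK hB
    (fun p hp => (hB₀ p (abs_le.1 hp)).trans ((le_abs_self _).trans (le_max_left _ _)))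
    (fun p hp => (hB₁ p (abs_le.1 hp)).trans ((le_abs_self _).trans (le_max_right _ _)))
  have heq : c = fun x => (dC f (u x) (c x) - h (u x)) / A := by
    funext x
    rw [hdC]
    field_simp
    ring
  rw [heq]
  exact (hg.sub_div hcomp hA).mono (le_max_right _ _)

lemma IsFreeEnergy.continuous_dC {f : ℝ → ℝ → ℝ} (hf : IsFreeEnergy f) :
    Continuous fun p : ℝ × ℝ => dC f p.1 p.2 := by
  obtain ⟨-, -, -, -, -, -, ⟨A, h, -, -, -, ⟨hh, -⟩, -, -, hdC, -⟩, -⟩ := hf.splitting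
  simp_rw [hdC]
  exact (continuous_const.mul continuous_snd).add (hh.continuous.comp continuous_fst)

end Composition

/-! ### Uniform bounds against test functions -/

section Bounds

variable {Ω : Set (Space d)} {ψ : Space d → ℝ}

lemma abs_integral_mul_le_of_bound (hΩ : MeasurableSet Ω) {a : Space d → ℝ} {B : ℝ}
    (ha : ∀ x ∈ Ω, |a x| ≤ B) (hψ : Integrable ψ (spaceMeas Ω)) :
    |∫ x in Ω, a x * ψ x| ≤ B * ∫ x in Ω, |ψ x| := by
  rw [← integral_const_mul, ← Real.norm_eq_abs]
  refine norm_integral_le_of_norm_le (hψ.abs.const_mul B) ?_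
  filter_upwards [ae_restrict_mem hΩ] with x hx
  rw [Real.norm_eq_abs, abs_mul]
  exact mul_le_mul_of_nonneg_right (ha x hx) (abs_nonneg _)

lemma IsSpaceTest.integrable (hψ : IsSpaceTest Ω ψ) (hb : Bornology.IsBounded Ω) :
    Integrable ψ (spaceMeas Ω) := by
  have := isFiniteMeasure_spaceMeas hb
  exact (hψ.memLp hb).integrable (by norm_num)

lemma IsSpaceTest.nlForm_eq (hψ : IsSpaceTest Ω ψ) (hΩ : IsOpen Ω) (hb : Bornology.IsBounded Ω)
    {δ : ℝ} {J : Space d → ℝ} (hJ : IsKernel δ J) {u : Space d → ℝ} {D : ℝ}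
    (hu : HasC11Bound Ω u D) :
    nlForm J Ω u ψ = ∫ x in Ω, u x * nlOp J Ω ψ x := by
  obtain ⟨B, -, hB⟩ := hψ.exists_hasC11Bound
  have hum := hu.aestronglyMeasurable hΩ
  rw [nlForm_eq_integral_nlOp_mul hJ hΩ.measurableSet hum hu.abs_le (hψ.integrable hb)]
  exact integral_nlOp_mul_comm hJ hΩ.measurableSet hb hum hu.abs_le
    ((hB Ω).aestronglyMeasurable hΩ) (hB Ω).abs_le

lemma abs_nlOp_mul_le (hΩ : IsOpen Ω) {δ : ℝ} (hδ : 0 ≤ δ) {J : Space d → ℝ} (hJ : IsKernel δ J)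
    {u : Space d → ℝ} {D : ℝ} (hu : HasC11Bound Ω u D)
    {w : Space d → ℝ} (hw : ∀ x ∈ Metric.cthickening δ Ωᶜ, w x = 0) (x : Space d) :
    |nlOp J Ω u x * w x| ≤ D * (2 * d) * |w x| := by
  by_cases hx : x ∈ Metric.cthickening δ Ωᶜ
  · rw [hw x hx]
    simp
  · rw [abs_mul]
    exact mul_le_mul_of_nonneg_right (abs_nlOp_le_of_interior hJ hΩ hu hδ hx) (abs_nonneg _)

/-- Both nonlocal terms of the system, tested with `ψ`, are bounded uniformly in small `δ`. -/
lemma IsSpaceTest.exists_uniform_bound (hψ : IsSpaceTest Ω ψ) (hΩ : IsOpen Ω)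
    (hb : Bornology.IsBounded Ω) {D : ℝ} (hD : 0 ≤ D) :
    ∃ r > 0, ∃ K, 0 ≤ K ∧ ∀ (δ : ℝ) (J : Space d → ℝ) (u : Space d → ℝ), 0 < δ → δ ≤ r →
      IsKernel δ J → HasC11Bound Ω u D →
      |nlForm J Ω u ψ| ≤ K ∧ |∫ x in Ω, nlOp J Ω u x * nlOp J Ω ψ x| ≤ K := by
  have := isFiniteMeasure_spaceMeas hb
  obtain ⟨r, hr, B, hB, h⟩ := hψ.exists_abs_nlOp_le hΩ
  set V : ℝ := (spaceMeas Ω).real univ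
  have hV : 0 ≤ V := measureReal_nonneg
  refine ⟨r, hr, D * B * V + D * (2 * d) * B * V, by positivity, fun δ J u hδ hδr hJ hu => ?_⟩
  obtain ⟨h1, h2⟩ := h δ J hδ hδr hJ
  have p1 : 0 ≤ D * B * V := by positivity
  have p2 : 0 ≤ D * (2 * d) * B * V := by positivity
  constructor
  · rw [hψ.nlForm_eq hΩ hb hJ hu]
    have := norm_integral_le_of_norm_le_const (μ := spaceMeas Ω)
      (f := fun x => u x * nlOp J Ω ψ x) (C := D * B)
      ((ae_restrict_mem hΩ.measurableSet).mono fun x hx => by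
        rw [Real.norm_eq_abs, abs_mul]
        exact mul_le_mul (hu.abs_le x hx) (h1 x) (abs_nonneg _) hD)
    rw [Real.norm_eq_abs] at this
    linarith
  · have := norm_integral_le_of_norm_le_const (μ := spaceMeas Ω)
      (f := fun x => nlOp J Ω u x * nlOp J Ω ψ x) (C := D * (2 * d) * B)
      (Eventually.of_forall fun x => by
        rw [Real.norm_eq_abs]
        exact (abs_nlOp_mul_le hΩ hδ.le hJ hu h2 x).trans
          (mul_le_mul_of_nonneg_left (h1 x) (by positivity)))
    rw [Real.norm_eq_abs] at this
    linarith

end Bounds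

/-! ### Compactness in time -/

section Time

variable {Ω : Set (Space d)} {T D : ℝ} {u : ℕ → ℝ → Space d → ℝ} {u' : ℝ → Space d → ℝ}

lemma aestronglyMeasurable_integral_mul {u : ℝ → Space d → ℝ} {ψ : Space d → ℝ}
    (hu : AEStronglyMeasurable (Function.uncurry u) (spaceTimeMeas T Ω))
    (hψ : AEStronglyMeasurable ψ (spaceMeas Ω)) :
    AEStronglyMeasurable (fun t => ∫ x in Ω, u t x * ψ x) (timeMeas T) :=
  (hu.mul hψ.comp_snd).integral_prod_right'

lemma integral_prod_mul_test {u : ℝ → Space d → ℝ}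
    (hu : MemLp (Function.uncurry u) 2 (spaceTimeMeas T Ω)) {θ : ℝ → ℝ} {ψ : Space d → ℝ}
    (hw : MemLp (fun q : ℝ × Space d => θ q.1 * ψ q.2) 2 (spaceTimeMeas T Ω)) :
    ∫ q, u q.1 q.2 * (θ q.1 * ψ q.2) ∂(spaceTimeMeas T Ω)
      = ∫ t in Ioo 0 T, (∫ x in Ω, u t x * ψ x) * θ t := by
  have hi : Integrable (fun q : ℝ × Space d => u q.1 q.2 * (θ q.1 * ψ q.2))
    (spaceTimeMeas T Ω) := integrable_mul_of_memLp hu hw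
  rw [integral_prod _ hi]
  refine integral_congr_ae (Eventually.of_forall fun t => ?_)
  simp only
  rw [← integral_mul_const]
  refine integral_congr_ae (Eventually.of_forall fun x => ?_)
  simp only
  ring

lemma ae_forall_exists_tendsto (hT : 0 < T) (hΩ : IsOpen Ω) (hb : Bornology.IsBounded Ω)
    (hweak : TendstoWeakly T Ω u u')
    (hu : ∀ᵐ t ∂(timeMeas T), ∀ n, HasC11Bound Ω (u n t) D) {u₀ : Space d → ℝ}
    (hder : ∀ ψ, IsSpaceTest Ω ψ → ∃ (b : ℕ → ℝ → ℝ) (K : ℝ),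
      (∀ n, AEStronglyMeasurable (b n) (timeMeas T)) ∧
      (∀ᶠ n in atTop, ∀ᵐ t ∂(timeMeas T), |b n t| ≤ K) ∧
      ∀ n η, IsTimeTest T η →
        - (∫ t in Ioo 0 T, deriv η t * ∫ x in Ω, u n t x * ψ x) - η 0 * ∫ x in Ω, u₀ x * ψ x
          = ∫ t in Ioo 0 T, η t * b n t) :
    ∀ᵐ t ∂(timeMeas T), ∀ ψ, IsSpaceTest Ω ψ →
      ∃ l, Tendsto (fun n => ∫ x in Ω, u n t x * ψ x) atTop (𝓝 l) := by
  have := isFiniteMeasure_spaceMeas hb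
  obtain ⟨-, hun, hw⟩ := hweak
  have hsingle : ∀ ψ, IsSpaceTest Ω ψ → ∀ᵐ t ∂(timeMeas T),
      ∃ l, Tendsto (fun n => ∫ x in Ω, u n t x * ψ x) atTop (𝓝 l) := by
    intro ψ hψ
    obtain ⟨b, K, hbm, hbK, hbη⟩ := hder ψ hψ
    obtain ⟨N, hN⟩ := eventually_atTop.1 hbK
    obtain ⟨B, -, hB⟩ := hψ.exists_hasC11Bound
    have hconv := ae_exists_tendsto_of_weak_deriv hT
      (a := fun n t => ∫ x in Ω, u (n + N) t x * ψ x) (b := fun n => b (n + N))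
      (α := ∫ x in Ω, u₀ x * ψ x) (K := K) (fun n => ?_) (fun n => hbm _)
      (fun n => hN _ (Nat.le_add_left _ _)) (fun n => hbη _) ?_
    · filter_upwards [hconv] with t ht
      obtain ⟨l, hl⟩ := ht
      exact ⟨l, (tendsto_add_atTop_iff_nat (f := fun n => ∫ x in Ω, u n t x * ψ x) N).1 hl⟩
    · refine Integrable.of_bound (aestronglyMeasurable_integral_mul (hun _).1
        (hψ.memLp hb).1) (D * ∫ x in Ω, |ψ x|) ?_
      filter_upwards [hu] with t ht
      exact abs_integral_mul_le_of_bound hΩ.measurableSet (ht _).abs_le (hψ.integrable hb)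
    · intro θ hθ hθc
      obtain ⟨Θ, hΘ⟩ := hθc.exists_bound_of_continuous hθ
      have hwm : MemLp (fun q : ℝ × Space d => θ q.1 * ψ q.2) 2 (spaceTimeMeas T Ω) := by
        refine MemLp.of_bound ((hθ.comp continuous_fst).mul
          (hψ.1.continuous.comp continuous_snd)).aestronglyMeasurable (Θ * B)
          (Eventually.of_forall fun q => ?_)
        rw [norm_mul]
        exact mul_le_mul (hΘ _) ((hB univ).abs_le _ (mem_univ _)) (abs_nonneg _)
          ((norm_nonneg _).trans (hΘ 0))
      have h1 := (tendsto_add_atTop_iff_nat N).2 (hw _ hwm)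
      simp_rw [fun n => integral_prod_mul_test (hun n) hwm] at h1
      exact ⟨_, h1⟩
  obtain ⟨S, hSc, hS, hdense⟩ := exists_countable_tests hb
  have hall : ∀ᵐ t ∂(timeMeas T), ∀ χ ∈ S,
      ∃ l, Tendsto (fun n => ∫ x in Ω, u n t x * χ x) atTop (𝓝 l) :=
    (ae_ball_iff hSc).2 fun χ hχ => hsingle χ (hS χ hχ)
  filter_upwards [hall, hu] with t h1 h2 ψ hψ
  exact exists_tendsto_of_countable_tests hΩ.measurableSet hb hS
    (fun ψ hψ ε hε => (hdense ψ hψ ε hε).imp fun χ h => ⟨h.1, h.2.1⟩)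
    (fun n => (h2 n).aestronglyMeasurable hΩ) (fun n => (h2 n).abs_le) h1 hψ

/-- The weak formulation of a time derivative passes to pointwise bounded limits. -/
lemma weak_deriv_of_tendsto {a b : ℕ → ℝ → ℝ} {a' b' : ℝ → ℝ} {α K : ℝ}
    (ham : ∀ n, AEStronglyMeasurable (a n) (timeMeas T))
    (hbm : ∀ n, AEStronglyMeasurable (b n) (timeMeas T))
    (haK : ∀ᶠ n in atTop, ∀ᵐ t ∂(timeMeas T), |a n t| ≤ K)
    (hbK : ∀ᶠ n in atTop, ∀ᵐ t ∂(timeMeas T), |b n t| ≤ K)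
    (ha : ∀ᵐ t ∂(timeMeas T), Tendsto (fun n => a n t) atTop (𝓝 (a' t)))
    (hb : ∀ᵐ t ∂(timeMeas T), Tendsto (fun n => b n t) atTop (𝓝 (b' t)))
    {η : ℝ → ℝ} (hη : IsTimeTest T η)
    (h : ∀ n, - (∫ t in Ioo 0 T, deriv η t * a n t) - η 0 * α = ∫ t in Ioo 0 T, η t * b n t) :
    - (∫ t in Ioo 0 T, deriv η t * a' t) - η 0 * α = ∫ t in Ioo 0 T, η t * b' t := by
  have hlim : ∀ {θ : ℝ → ℝ} {p : ℕ → ℝ → ℝ} {p' : ℝ → ℝ}, Continuous θ → HasCompactSupport θ →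
      (∀ n, AEStronglyMeasurable (p n) (timeMeas T)) →
      (∀ᶠ n in atTop, ∀ᵐ t ∂(timeMeas T), |p n t| ≤ K) →
      (∀ᵐ t ∂(timeMeas T), Tendsto (fun n => p n t) atTop (𝓝 (p' t))) →
      Tendsto (fun n => ∫ t in Ioo 0 T, θ t * p n t) atTop (𝓝 (∫ t in Ioo 0 T, θ t * p' t)) := by
    intro θ p p' hθ hθc hpm hpK hp
    refine tendsto_integral_filter_of_dominated_convergence (fun t => |θ t| * K)
      (Eventually.of_forall fun n => hθ.aestronglyMeasurable.mul (hpm n)) ?_ ?_ ?_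
    · filter_upwards [hpK] with n hn
      filter_upwards [hn] with t ht
      rw [norm_mul]
      exact mul_le_mul_of_nonneg_left ht (abs_nonneg _)
    · exact ((hθ.integrable_of_hasCompactSupport hθc).abs.mul_const K).mono_measure
        Measure.restrict_le_self
    · filter_upwards [hp] with t ht
      exact ht.const_mul _
  have t1 := hlim (hη.1.continuous_deriv (by simp)) hη.2.1.deriv ham haK ha
  have t2 := hlim hη.1.continuous hη.2.1 hbm hbK hb
  refine tendsto_nhds_unique (t1.neg.sub_const (η 0 * α)) ?_
  simp_rw [h]
  exact t2

end Time

/-! ### Weak compactness in `L²` -/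

lemma exists_weak_limit {α : Type*} [MeasurableSpace α] [MeasurableSpace.CountablyGenerated α]
    {μ : Measure α} [IsFiniteMeasure μ] {w : ℕ → α → ℝ} {K : ℝ}
    (hwm : ∀ n, AEStronglyMeasurable (w n) μ) (hw : ∀ n, ∀ᵐ x ∂μ, |w n x| ≤ K) :
    ∃ (w' : α → ℝ) (k : ℕ → ℕ), MemLp w' 2 μ ∧ StrictMono k ∧ ∀ g, MemLp g 2 μ →
      Tendsto (fun n => ∫ x, w (k n) x * g x ∂μ) atTop (𝓝 (∫ x, w' x * g x ∂μ)) := by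
  have : Fact ((2 : ℝ≥0∞) ≠ ⊤) := ⟨by norm_num⟩
  have : SecondCountableTopology (Lp ℝ 2 μ) := Lp.SecondCountableTopology
  have hL : ∀ n, MemLp (w n) 2 μ := fun n => MemLp.of_bound (hwm n) |K|
    ((hw n).mono fun x hx => hx.trans (le_abs_self K))
  have hinner : ∀ {f g : α → ℝ} (hf : MemLp f 2 μ) (hg : MemLp g 2 μ),
      inner ℝ (hf.toLp f : Lp ℝ 2 μ) (hg.toLp g : Lp ℝ 2 μ) = ∫ x, f x * g x ∂μ := by
    intro f g hf hg
    rw [L2.inner_def]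
    refine integral_congr_ae ?_
    filter_upwards [hf.coeFn_toLp, hg.coeFn_toLp] with x h1 h2
    rw [h1, h2]
    simp [mul_comm]
  set R : ℝ := ((μ univ) ^ (2 : ℝ)⁻¹ * ENNReal.ofReal |K|).toReal
  set z : ℕ → WeakDual ℝ (Lp ℝ 2 μ) := fun n =>
    StrongDual.toWeakDual (InnerProductSpace.toDual ℝ (Lp ℝ 2 μ) ((hL n).toLp (w n)))
  have hz : ∀ n, z n ∈ WeakDual.toStrongDual ⁻¹'
      Metric.closedBall (0 : StrongDual ℝ (Lp ℝ 2 μ)) R := by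
    intro n
    rw [mem_preimage, mem_closedBall_zero_iff]
    change ‖InnerProductSpace.toDual ℝ (Lp ℝ 2 μ) ((hL n).toLp (w n))‖ ≤ R
    rw [LinearIsometryEquiv.norm_map, Lp.norm_toLp]
    refine ENNReal.toReal_mono (ENNReal.mul_ne_top
      (ENNReal.rpow_ne_top_of_nonneg (by norm_num) (measure_ne_top _ _)) ENNReal.ofReal_ne_top) ?_
    have := eLpNorm_le_of_ae_bound (p := 2) ((hw n).mono fun x hx =>
      (show ‖w n x‖ ≤ |K| from hx.trans (le_abs_self K)))
    simpa using this
  obtain ⟨Λ, -, k, hk, hlim⟩ := WeakDual.isSeqCompact_closedBall ℝ (Lp ℝ 2 μ) 0 R hz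
  set W : Lp ℝ 2 μ := (InnerProductSpace.toDual ℝ (Lp ℝ 2 μ)).symm (WeakDual.toStrongDual Λ)
  refine ⟨W, k, Lp.memLp W, hk, fun g hg => ?_⟩
  have h1 := ((WeakDual.eval_continuous (𝕜 := ℝ) (hg.toLp g)).tendsto Λ).comp hlim
  have h2 : Λ (hg.toLp g) = ∫ x, W x * g x ∂μ := by
    rw [← hinner (Lp.memLp W) hg, Lp.toLp_coeFn]
    exact (InnerProductSpace.toDual_symm_apply (y := WeakDual.toStrongDual Λ)).symm
  rw [← h2]
  refine h1.congr fun n => ?_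
  rw [← hinner (hL (k n)) hg]
  rfl

/-! ### The nonlocal operators against test functions -/

section Limits

variable {Ω : Set (Space d)} {ψ : Space d → ℝ} {δ : ℕ → ℝ} {J : ℕ → Space d → ℝ} {D : ℝ}
  {u : ℕ → Space d → ℝ} {u' : Space d → ℝ}

lemma tendsto_integral_mul_of_bound (hΩ : IsOpen Ω) (hb : Bornology.IsBounded Ω)
    (hu : ∀ n, HasC11Bound Ω (u n) D)
    (hlim : ∀ᵐ x ∂(spaceMeas Ω), Tendsto (fun n => u n x) atTop (𝓝 (u' x)))
    {w : ℕ → Space d → ℝ} {w' : Space d → ℝ} {B : ℝ}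
    (hwm : ∀ n, AEStronglyMeasurable (w n) (spaceMeas Ω))
    (hw : ∀ᶠ n in atTop, ∀ x, |w n x| ≤ B)
    (hwlim : ∀ x ∈ Ω, Tendsto (fun n => w n x) atTop (𝓝 (w' x))) :
    Tendsto (fun n => ∫ x in Ω, u n x * w n x) atTop (𝓝 (∫ x in Ω, u' x * w' x)) := by
  have := isFiniteMeasure_spaceMeas hb
  refine tendsto_integral_filter_of_dominated_convergence (fun _ => D * B)
    (Eventually.of_forall fun n => ((hu n).aestronglyMeasurable hΩ).mul (hwm n)) ?_
    (integrable_const _) ?_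
  · filter_upwards [hw] with n hn
    filter_upwards [ae_restrict_mem hΩ.measurableSet] with x hx
    rw [norm_mul]
    have h1 := (hu n).abs_le x hx
    exact mul_le_mul h1 (hn x) (abs_nonneg _) ((abs_nonneg _).trans h1)
  · filter_upwards [hlim, ae_restrict_mem hΩ.measurableSet] with x hx hxΩ
    exact hx.mul (hwlim x hxΩ)

lemma IsSpaceTest.aestronglyMeasurable_nlOp (hψ : IsSpaceTest Ω ψ) (hΩ : IsOpen Ω)
    (hb : Bornology.IsBounded Ω) {δ : ℝ} {J : Space d → ℝ} (hJ : IsKernel δ J) :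
    AEStronglyMeasurable (nlOp J Ω ψ) (spaceMeas Ω) := by
  obtain ⟨B, -, hB⟩ := hψ.exists_hasC11Bound
  exact aestronglyMeasurable_nlOp_slice hJ hΩ.measurableSet hb
    ((hB Ω).aestronglyMeasurable hΩ) (hB Ω).abs_le

/-- `𝓛_δ uₙ → -Δu` in the sense of distributions. -/
lemma tendsto_integral_nlOp_mul (hΩ : IsOpen Ω) (hb : Bornology.IsBounded Ω)
    (hJ : ∀ n, IsKernel (δ n) (J n)) (hδ0 : ∀ n, 0 < δ n) (hδ : Tendsto δ atTop (𝓝 0))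
    (hu : ∀ n, HasC11Bound Ω (u n) D)
    (hlim : ∀ᵐ x ∂(spaceMeas Ω), Tendsto (fun n => u n x) atTop (𝓝 (u' x)))
    (hψ : IsSpaceTest Ω ψ) :
    Tendsto (fun n => ∫ x in Ω, nlOp (J n) Ω (u n) x * ψ x) atTop
      (𝓝 (-∫ x in Ω, u' x * Laplacian.laplacian ψ x)) := by
  obtain ⟨r, hr, B, -, hB⟩ := hψ.exists_abs_nlOp_le hΩ
  have h := tendsto_integral_mul_of_bound hΩ hb hu hlim (B := B)
    (w := fun n => nlOp (J n) Ω ψ) (w' := fun x => -Laplacian.laplacian ψ x)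
    (fun n => hψ.aestronglyMeasurable_nlOp hΩ hb (hJ n))
    ((hδ.eventually (ge_mem_nhds hr)).mono fun n hn => (hB _ _ (hδ0 n) hn (hJ n)).1)
    (fun x hx => hψ.tendsto_nlOp hΩ hJ hδ hx)
  simp_rw [mul_neg, integral_neg] at h
  refine h.congr fun n => ?_
  rw [← hψ.nlForm_eq hΩ hb (hJ n) (hu n), nlForm_eq_integral_nlOp_mul (hJ n) hΩ.measurableSet
    ((hu n).aestronglyMeasurable hΩ) (hu n).abs_le (hψ.integrable hb)]

lemma IsSpaceTest.eq_zero_of_mem_cthickening (hψ : IsSpaceTest Ω ψ) (hΩ : IsOpen Ω) :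
    ∃ r > 0, ∀ δ ≤ r, ∀ x ∈ Metric.cthickening δ Ωᶜ, ψ x = 0 := by
  obtain ⟨r, hr, h⟩ := hψ.exists_layer hΩ
  exact ⟨r, hr, fun δ hδ x hx => h x (Metric.cthickening_mono hδ _ hx) x (by simpa using hr.le)⟩

/-- `∫ 𝓛_δ uₙ 𝓛_δ ψ → ∫ u Δ²ψ`. -/
lemma tendsto_integral_nlOp_mul_nlOp (hΩ : IsOpen Ω) (hb : Bornology.IsBounded Ω)
    (hJ : ∀ n, IsKernel (δ n) (J n)) (hδ0 : ∀ n, 0 < δ n) (hδ : Tendsto δ atTop (𝓝 0))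
    (hu : ∀ n, HasC11Bound Ω (u n) D) (hD : 0 ≤ D)
    (hlim : ∀ᵐ x ∂(spaceMeas Ω), Tendsto (fun n => u n x) atTop (𝓝 (u' x)))
    (hψ : IsSpaceTest Ω ψ) :
    Tendsto (fun n => ∫ x in Ω, nlOp (J n) Ω (u n) x * nlOp (J n) Ω ψ x) atTop
      (𝓝 (∫ x in Ω, u' x * Laplacian.laplacian (Laplacian.laplacian ψ) x)) := by
  have := isFiniteMeasure_spaceMeas hb
  obtain ⟨r, hr, B, hB0, hB⟩ := hψ.exists_abs_nlOp_le hΩ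
  obtain ⟨r', hr', hr'Δ⟩ := hψ.laplacian.eq_zero_of_mem_cthickening hΩ
  obtain ⟨B', hB'0, hB'⟩ := hψ.laplacian.exists_hasC11Bound
  have hmain := (tendsto_integral_nlOp_mul hΩ hb hJ hδ0 hδ hu hlim hψ.laplacian).neg
  rw [neg_neg] at hmain
  set e : ℕ → Space d → ℝ := fun n x => nlOp (J n) Ω ψ x + Laplacian.laplacian ψ x
  have hem : ∀ n, AEStronglyMeasurable (e n) (spaceMeas Ω) := fun n =>
    (hψ.aestronglyMeasurable_nlOp hΩ hb (hJ n)).add (hψ.laplacian.memLp hb).1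
  have hev : ∀ᶠ n in atTop, δ n ≤ r ∧ δ n ≤ r' :=
    (hδ.eventually (ge_mem_nhds hr)).and (hδ.eventually (ge_mem_nhds hr'))
  have heb : ∀ᶠ n in atTop, ∀ x, |e n x| ≤ B + B' := by
    filter_upwards [hev] with n hn x
    exact (abs_add_le _ _).trans (add_le_add ((hB _ _ (hδ0 n) hn.1 (hJ n)).1 x)
      ((hB' univ).abs_le x (mem_univ x)))
  have herr : Tendsto (fun n => ∫ x in Ω, nlOp (J n) Ω (u n) x * e n x) atTop (𝓝 0) := by
    rw [← integral_zero (Space d) ℝ (μ := spaceMeas Ω)]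
    refine tendsto_integral_filter_of_dominated_convergence (fun _ => D * (2 * d) * (B + B'))
      (Eventually.of_forall fun n => ?_) ?_ (integrable_const _) ?_
    · exact (aestronglyMeasurable_nlOp_slice (hJ n) hΩ.measurableSet hb
        ((hu n).aestronglyMeasurable hΩ) (hu n).abs_le).mul (hem n)
    · filter_upwards [hev, heb] with n hn hen
      refine Eventually.of_forall fun x => (abs_nlOp_mul_le hΩ (hδ0 n).le (hJ n) (hu n)
        (fun y hy => ?_) x).trans (mul_le_mul_of_nonneg_left (hen x) (by positivity))
      simp only [e]
      rw [(hB _ _ (hδ0 n) hn.1 (hJ n)).2 y hy, hr'Δ _ hn.2 y hy, add_zero]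
    · filter_upwards [ae_restrict_mem hΩ.measurableSet] with x hx
      have he : Tendsto (fun n => D * (2 * d) * |e n x|) atTop (𝓝 0) := by
        have h1 := (hψ.tendsto_nlOp hΩ hJ hδ hx).add_const (Laplacian.laplacian ψ x)
        rw [neg_add_cancel] at h1
        simpa using h1.abs.const_mul (D * (2 * d))
      refine squeeze_zero_norm' ?_ he
      filter_upwards [hev] with n hn
      refine abs_nlOp_mul_le hΩ (hδ0 n).le (hJ n) (hu n) (fun y hy => ?_) x
      simp only [e]
      rw [(hB _ _ (hδ0 n) hn.1 (hJ n)).2 y hy, hr'Δ _ hn.2 y hy, add_zero]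
  have hsum := herr.add hmain
  rw [zero_add] at hsum
  refine hsum.congr fun n => ?_
  have hn := memLp_nlOp (hJ n) hΩ.measurableSet hb ((hu n).aestronglyMeasurable hΩ) (hu n).abs_le
  have hψn : MemLp (nlOp (J n) Ω ψ) 2 (spaceMeas Ω) := by
    obtain ⟨E, -, hE⟩ := hψ.exists_hasC11Bound
    exact memLp_nlOp (hJ n) hΩ.measurableSet hb ((hE Ω).aestronglyMeasurable hΩ) (hE Ω).abs_le
  have i1 : Integrable (fun x => nlOp (J n) Ω (u n) x * e n x) (spaceMeas Ω) :=
    integrable_mul_of_memLp hn (hψn.add (hψ.laplacian.memLp hb))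
  have i2 := integrable_mul_of_memLp hn (hψ.laplacian.memLp hb)
  rw [← sub_eq_add_neg, ← integral_sub i1 i2]
  refine integral_congr_ae (Eventually.of_forall fun x => ?_)
  simp only [e]
  ring

end Limits

/-! ### The weak Laplacian of the limit -/

section WeakLaplacian

variable {Ω : Set (Space d)} {T D : ℝ} {u : ℕ → ℝ → Space d → ℝ} {u' : ℝ → Space d → ℝ}

lemma ae_memLp_slice {w : ℝ → Space d → ℝ} (hb : Bornology.IsBounded Ω)
    (hw : MemLp (Function.uncurry w) 2 (spaceTimeMeas T Ω)) :
    ∀ᵐ t ∂(timeMeas T), MemLp (w t) 2 (spaceMeas Ω) := by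
  have := isFiniteMeasure_spaceMeas hb
  have hi := (memLp_two_iff_integrable_sq hw.1).1 hw
  filter_upwards [hi.prod_right_ae, hw.1.prodMk_left] with t h1 h2
  exact (memLp_two_iff_integrable_sq h2).2 h1

/-- A weak Laplacian in space-time only needs to be tested against one test function at a time. -/
lemma ae_hasWeakLaplacian (hb : Bornology.IsBounded Ω) {u w : ℝ → Space d → ℝ}
    (hu : MemLp (Function.uncurry u) 2 (spaceTimeMeas T Ω))
    (hw : MemLp (Function.uncurry w) 2 (spaceTimeMeas T Ω))
    (h : ∀ ψ, IsSpaceTest Ω ψ → ∀ᵐ t ∂(timeMeas T),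
      ∫ x in Ω, u t x * Laplacian.laplacian ψ x = ∫ x in Ω, w t x * ψ x) :
    ∀ᵐ t ∂(timeMeas T), HasWeakLaplacian Ω (u t) (w t) := by
  obtain ⟨S, hSc, hS, hdense⟩ := exists_countable_tests hb
  have hall := (ae_ball_iff hSc).2 fun χ hχ => h χ (hS χ hχ)
  filter_upwards [hall, ae_memLp_slice hb hu, ae_memLp_slice hb hw] with t h1 h2 h3
  refine ⟨h2, h3, fun ψ hψ => ?_⟩
  set U := (eLpNorm (u t) 2 (spaceMeas Ω)).toReal
  set W := (eLpNorm (w t) 2 (spaceMeas Ω)).toReal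
  have hU : 0 ≤ U := ENNReal.toReal_nonneg
  have hW : 0 ≤ W := ENNReal.toReal_nonneg
  refine eq_of_forall_dist_le fun ε hε => ?_
  obtain ⟨χ, hχ, e1, e2⟩ := hdense ψ hψ (ε / (U + W + 1)) (by positivity)
  have hψL := hψ.memLp hb
  have hχL := (hS χ hχ).memLp hb
  have hψΔ := hψ.laplacian.memLp hb
  have hχΔ := (hS χ hχ).laplacian.memLp hb
  have d1 : (∫ x in Ω, u t x * Laplacian.laplacian ψ x)
      - ∫ x in Ω, u t x * Laplacian.laplacian χ x
      = ∫ x in Ω, u t x * (Laplacian.laplacian ψ - Laplacian.laplacian χ) x := by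
    rw [← integral_sub (integrable_mul_of_memLp h2 hψΔ) (integrable_mul_of_memLp h2 hχΔ)]
    simp_rw [← mul_sub]
    rfl
  have d2 : (∫ x in Ω, w t x * ψ x) - ∫ x in Ω, w t x * χ x
      = ∫ x in Ω, w t x * (ψ - χ) x := by
    rw [← integral_sub (integrable_mul_of_memLp h3 hψL) (integrable_mul_of_memLp h3 hχL)]
    simp_rw [← mul_sub]
    rfl
  have b1 := abs_integral_mul_le h2 (hψΔ.sub hχΔ)
  have b2 := abs_integral_mul_le h3 (hψL.sub hχL)
  rw [← d1] at b1
  rw [← d2, ← h1 χ hχ] at b2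
  rw [Real.dist_eq]
  have c1 : (∫ x in Ω, u t x * Laplacian.laplacian ψ x) - ∫ x in Ω, w t x * ψ x
      = ((∫ x in Ω, u t x * Laplacian.laplacian ψ x) - ∫ x in Ω, u t x * Laplacian.laplacian χ x)
        - ((∫ x in Ω, w t x * ψ x) - ∫ x in Ω, u t x * Laplacian.laplacian χ x) := by ring
  rw [c1]
  refine (abs_sub _ _).trans ((add_le_add (b1.trans (mul_le_mul_of_nonneg_left e2.le hU))
    (b2.trans (mul_le_mul_of_nonneg_left e1.le hW))).trans ?_)
  rw [← add_mul, mul_div_assoc', div_le_iff₀ (by positivity)]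
  nlinarith

theorem exists_weak_laplacian (hΩ : IsOpen Ω) (hb : Bornology.IsBounded Ω) {δ : ℕ → ℝ}
    {J : ℕ → Space d → ℝ} (hJ : ∀ n, IsKernel (δ n) (J n)) (hδ0 : ∀ n, 0 < δ n)
    (hδ : Tendsto δ atTop (𝓝 0))
    (hum : ∀ n, AEStronglyMeasurable (Function.uncurry (u n)) (spaceTimeMeas T Ω))
    (hu : ∀ᵐ t ∂(timeMeas T), ∀ n, HasC11Bound Ω (u n t) D) (hD : 0 ≤ D)
    (hu' : MemLp (Function.uncurry u') 2 (spaceTimeMeas T Ω))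
    (hlim : ∀ᵐ q ∂(spaceTimeMeas T Ω), Tendsto (fun n => u n q.1 q.2) atTop (𝓝 (u' q.1 q.2))) :
    ∃ w : ℝ → Space d → ℝ, MemLp (Function.uncurry w) 2 (spaceTimeMeas T Ω) ∧
      ∀ᵐ t ∂(timeMeas T), HasWeakLaplacian Ω (u' t) (w t) := by
  have := isFiniteMeasure_spaceMeas hb
  set w : ℕ → ℝ × Space d → ℝ := fun n q =>
    (Metric.cthickening (δ n) Ωᶜ)ᶜ.indicator (fun x => -nlOp (J n) Ω (u n q.1) x) q.2
  have hwm : ∀ n, AEStronglyMeasurable (w n) (spaceTimeMeas T Ω) := fun n =>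
    (aestronglyMeasurable_nlOp (hJ n) (hum n)).neg.indicator
      (s := Prod.snd ⁻¹' (Metric.cthickening (δ n) Ωᶜ)ᶜ)
      (Metric.isClosed_cthickening.measurableSet.compl.preimage measurable_snd)
  have hwb : ∀ᵐ t ∂(timeMeas T), ∀ n x, |w n (t, x)| ≤ D * (2 * d) := by
    filter_upwards [hu] with t ht n x
    by_cases hx : x ∈ Metric.cthickening (δ n) Ωᶜ
    · simp only [w]
      rw [indicator_of_notMem (by simpa using hx), abs_zero]
      positivity
    · simp only [w]
      rw [indicator_of_mem (by simpa using hx), abs_neg]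
      exact abs_nlOp_le_of_interior (hJ n) hΩ (ht n) (hδ0 n).le hx
  obtain ⟨w', k, hw'L, hk, hw'⟩ := exists_weak_limit (K := D * (2 * d)) hwm fun n =>
    ae_spaceTime_of_ae_forall (p := fun t x => |w n (t, x)| ≤ D * (2 * d)) hΩ.measurableSet
      (hwb.mono fun t ht x _ => ht n x)
  refine ⟨fun t x => w' (t, x), hw'L, ae_hasWeakLaplacian hb hu' hw'L fun ψ hψ => ?_⟩
  obtain ⟨B, hB0, hB⟩ := hψ.exists_hasC11Bound
  obtain ⟨r, hr, hrψ⟩ := hψ.eq_zero_of_mem_cthickening hΩ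
  have hpt : ∀ᵐ t ∂(timeMeas T), Tendsto (fun n => ∫ x in Ω, w (k n) (t, x) * ψ x) atTop
      (𝓝 (∫ x in Ω, u' t x * Laplacian.laplacian ψ x)) := by
    filter_upwards [hu, Measure.ae_ae_of_ae_prod hlim] with t h1 h2
    have h3 := (tendsto_integral_nlOp_mul hΩ hb hJ hδ0 hδ h1 h2 hψ).neg.comp hk.tendsto_atTop
    rw [neg_neg] at h3
    refine h3.congr' ?_
    filter_upwards [(hδ.comp hk.tendsto_atTop).eventually (ge_mem_nhds hr)] with n hn
    simp only [Function.comp_apply] at hn ⊢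
    rw [← integral_neg]
    refine integral_congr_ae (Eventually.of_forall fun x => ?_)
    by_cases hx : x ∈ Metric.cthickening (δ (k n)) Ωᶜ
    · simp only [hrψ _ hn x hx, mul_zero, neg_zero]
    · simp only [w]
      rw [indicator_of_mem (by simpa using hx), neg_mul]
  have hψm : MemLp (fun q : ℝ × Space d => ψ q.2) 2 (spaceTimeMeas T Ω) :=
    MemLp.of_bound (hψ.1.continuous.comp continuous_snd).aestronglyMeasurable B
      (Eventually.of_forall fun q => (hB univ).abs_le _ (mem_univ _))
  have hΔm : MemLp (fun q : ℝ × Space d => Laplacian.laplacian ψ q.2) 2 (spaceTimeMeas T Ω) := by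
    obtain ⟨B', -, hB'⟩ := hψ.laplacian.exists_hasC11Bound
    exact MemLp.of_bound (hψ.laplacian.1.continuous.comp continuous_snd).aestronglyMeasurable B'
      (Eventually.of_forall fun q => (hB' univ).abs_le _ (mem_univ _))
  have i1 : Integrable (fun t => ∫ x in Ω, u' t x * Laplacian.laplacian ψ x) (timeMeas T) :=
    (integrable_mul_of_memLp hu' hΔm).integral_prod_left
  have i2 : Integrable (fun t => ∫ x in Ω, w' (t, x) * ψ x) (timeMeas T) :=
    (integrable_mul_of_memLp hw'L hψm).integral_prod_left
  refine Integrable.ae_eq_of_forall_setIntegral_eq _ _ i1 i2 fun s hs _ => ?_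
  have hθ : MemLp (fun q : ℝ × Space d => s.indicator (fun _ => (1 : ℝ)) q.1 * ψ q.2) 2
      (spaceTimeMeas T Ω) := by
    refine MemLp.of_bound (((measurable_const.indicator hs).comp
      measurable_fst).aestronglyMeasurable.mul hψm.1) B (Eventually.of_forall fun q => ?_)
    rw [norm_mul]
    have h1 : ‖s.indicator (fun _ => (1 : ℝ)) q.1‖ ≤ 1 := by
      refine (norm_indicator_le_norm_self _ _).trans ?_
      simp
    calc _ ≤ 1 * ‖ψ q.2‖ := mul_le_mul_of_nonneg_right h1 (norm_nonneg _)
      _ ≤ B := by rw [one_mul]; exact (hB univ).abs_le _ (mem_univ _)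
  have hset : ∀ p : ℝ → ℝ, ∫ t in Ioo 0 T, p t * s.indicator (fun _ => (1 : ℝ)) t
      = ∫ t in s, p t ∂(timeMeas T) := fun p => by
    rw [← integral_indicator hs]
    refine integral_congr_ae (Eventually.of_forall fun t => ?_)
    by_cases ht : t ∈ s <;> simp [ht]
  have hwL : ∀ n, MemLp (w n) 2 (spaceTimeMeas T Ω) := fun n =>
    MemLp.of_bound (hwm n) (D * (2 * d)) (ae_spaceTime_of_ae_forall
      (p := fun t x => |w n (t, x)| ≤ D * (2 * d)) hΩ.measurableSet
      (hwb.mono fun t ht x _ => ht n x))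
  have t1 := hw' _ hθ
  have e1 : ∀ n, ∫ q, w (k n) q * (s.indicator (fun _ => (1 : ℝ)) q.1 * ψ q.2)
      ∂(spaceTimeMeas T Ω) = ∫ t in s, (∫ x in Ω, w (k n) (t, x) * ψ x) ∂(timeMeas T) := fun n => by
    rw [← hset]
    exact integral_prod_mul_test (u := fun t x => w (k n) (t, x)) (hwL (k n)) hθ
  have e2 : ∫ q, w' q * (s.indicator (fun _ => (1 : ℝ)) q.1 * ψ q.2) ∂(spaceTimeMeas T Ω)
      = ∫ t in s, (∫ x in Ω, w' (t, x) * ψ x) ∂(timeMeas T) := by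
    rw [← hset]
    exact integral_prod_mul_test (u := fun t x => w' (t, x)) hw'L hθ
  simp_rw [e1] at t1
  rw [e2] at t1
  refine tendsto_nhds_unique ?_ t1
  refine tendsto_integral_of_dominated_convergence
    (fun _ => D * (2 * d) * ∫ x in Ω, |ψ x|) (fun n => ?_) (integrable_const _) (fun n => ?_)
    (ae_restrict_of_ae hpt)
  · exact (aestronglyMeasurable_integral_mul (u := fun t x => w (k n) (t, x)) (hwm (k n))
      (hψ.memLp hb).1).mono_measure Measure.restrict_le_self
  · refine ae_restrict_of_ae ?_
    filter_upwards [hwb] with t ht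
    exact abs_integral_mul_le_of_bound hΩ.measurableSet (fun x _ => ht (k n) x) (hψ.integrable hb)

end WeakLaplacian

/-! ### Passage to the limit in the equations -/

lemma integrable_apply_of_memLp {E : Type*} [SeminormedAddCommGroup E] [NormedSpace ℝ E]
    {μ : Measure ℝ} [IsFiniteMeasure μ] {F : ℝ → StrongDual ℝ E} (hF : MemLp F 2 μ) (v : E) :
    Integrable (fun t => F t v) μ := by
  have hn : MemLp (fun t => ‖F t‖) 2 μ := ⟨hF.1.norm, by
    rw [eLpNorm_congr_enorm_ae (g := F) (Eventually.of_forall fun x => enorm_norm _)]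
    exact hF.2⟩
  exact ((hn.integrable (by norm_num)).mul_const ‖v‖).mono'
    ((ContinuousLinearMap.apply ℝ ℝ v).continuous.comp_aestronglyMeasurable hF.1)
    (Eventually.of_forall fun t => (F t).le_opNorm v)

lemma continuous_integral_mul_dual {E : Type*} [SeminormedAddCommGroup E] [NormedSpace ℝ E]
    {μ : Measure ℝ} [IsFiniteMeasure μ] {F : ℝ → StrongDual ℝ E} (hF : MemLp F 2 μ) {θ : ℝ → ℝ}
    (hθ : Continuous θ) (hθc : HasCompactSupport θ) :
    Continuous fun v => ∫ t, θ t * F t v ∂μ := by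
  obtain ⟨B, hB⟩ := hθc.exists_bound_of_continuous hθ
  have hn : MemLp (fun t => ‖F t‖) 2 μ := ⟨hF.1.norm, by
    rw [eLpNorm_congr_enorm_ae (g := F) (Eventually.of_forall fun x => enorm_norm _)]
    exact hF.2⟩
  have hni : Integrable (fun t => B * ‖F t‖) μ := (hn.integrable (by norm_num)).const_mul B
  have hb : ∀ v t, ‖θ t * F t v‖ ≤ B * ‖F t‖ * ‖v‖ := fun v t => by
    rw [norm_mul, mul_assoc]
    exact mul_le_mul (hB t) ((F t).le_opNorm v) (norm_nonneg _) ((norm_nonneg _).trans (hB t))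
  have hi : ∀ v, Integrable (fun t => θ t * F t v) μ := fun v =>
    (hni.mul_const ‖v‖).mono' (hθ.aestronglyMeasurable.mul
      ((ContinuousLinearMap.apply ℝ ℝ v).continuous.comp_aestronglyMeasurable hF.1))
      (Eventually.of_forall (hb v))
  refine (LipschitzWith.of_dist_le' (K := ∫ t, B * ‖F t‖ ∂μ) fun v w => ?_).continuous
  rw [dist_eq_norm, dist_eq_norm, ← integral_sub (hi v) (hi w), ← integral_mul_const]
  refine norm_integral_le_of_norm_le (hni.mul_const _) (Eventually.of_forall fun t => ?_)
  rw [← mul_sub, ← map_sub]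
  exact hb (v - w) t

/-- A sequence of nonlocal solutions with vanishing interaction range and uniform `C^{1,1}`
bounds. -/
structure IsRegularSequence (T : ℝ) (Ω : Set (Space d)) (f : ℝ → ℝ → ℝ) (L M αφ αc : ℝ)
    (φ₀ c₀ : Space d → ℝ) (δ : ℕ → ℝ) (J : ℕ → Space d → ℝ) (φ c : ℕ → ℝ → Space d → ℝ)
    (D : ℝ) : Prop where
  domain : IsC3Domain Ω
  freeEnergy : IsFreeEnergy f
  kernel : ∀ n, IsKernel (δ n) (J n)
  pos : ∀ n, 0 < δ n
  tendsto_zero : Tendsto δ atTop (𝓝 0)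
  solution : ∀ n, IsNonlocalSolution T Ω f L M αφ αc (J n) φ₀ c₀ (φ n) (c n)
  bound_nonneg : 0 ≤ D
  bound_phi : ∀ᵐ t ∂(timeMeas T), ∀ n, HasC11Bound Ω (φ n t) D
  bound_c : ∀ᵐ t ∂(timeMeas T), ∀ n, HasC11Bound Ω (c n t) D
  bound_dC : ∀ᵐ t ∂(timeMeas T), ∀ n, HasC11Bound Ω (fun x => dC f (φ n t x) (c n t x)) D

namespace IsRegularSequence

variable {T : ℝ} {Ω : Set (Space d)} {f : ℝ → ℝ → ℝ} {L M αφ αc : ℝ} {φ₀ c₀ : Space d → ℝ}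
  {δ : ℕ → ℝ} {J : ℕ → Space d → ℝ} {φ c : ℕ → ℝ → Space d → ℝ} {D : ℝ}
  {φ' c' : ℝ → Space d → ℝ}

lemma exists_deriv_phi (h : IsRegularSequence T Ω f L M αφ αc φ₀ c₀ δ J φ c D)
    {ψ : Space d → ℝ} (hψ : IsSpaceTest Ω ψ) : ∃ (b : ℕ → ℝ → ℝ) (K : ℝ),
      (∀ n, AEStronglyMeasurable (b n) (timeMeas T)) ∧
      (∀ᶠ n in atTop, ∀ᵐ t ∂(timeMeas T), |b n t| ≤ K) ∧
      (∀ n η, IsTimeTest T η →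
        - (∫ t in Ioo 0 T, deriv η t * ∫ x in Ω, φ n t x * ψ x) - η 0 * ∫ x in Ω, φ₀ x * ψ x
          = ∫ t in Ioo 0 T, η t * b n t) ∧
      ∀ n, ∀ᵐ t ∂(timeMeas T), b n t = - L * (∫ x in Ω, dPhi f (φ n t x) (c n t x) * ψ x)
        - αφ * L * nlForm (J n) Ω (φ n t) ψ := by
  have hm := h.domain.isOpen.measurableSet
  have hb := h.domain.isBounded
  have hV : ∀ n, MemV (J n) Ω ψ := fun n => hψ.memV (h.kernel n) hm hb
  choose ξ hξ hξe using fun n => (h.solution n).allenCahn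
  obtain ⟨B, hB, hBf⟩ := h.freeEnergy.exists_abs_dPhi_le D
  obtain ⟨r, hr, K, hK, hKb⟩ := hψ.exists_uniform_bound h.domain.isOpen hb h.bound_nonneg
  refine ⟨fun n t => ξ n t ψ, |L| * (B * ∫ x in Ω, |ψ x|) + |αφ * L| * K,
    fun n => (hξ n).1.measurable ψ (hV n), ?_, fun n η hη => (hξ n).2 ψ (hV n) η hη,
    fun n => (hξe n).mono fun t ht => ht ψ (hV n)⟩
  filter_upwards [h.tendsto_zero.eventually (ge_mem_nhds hr)] with n hn
  filter_upwards [hξe n, h.bound_phi, h.bound_c] with t h1 h2 h3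
  rw [h1 ψ (hV n)]
  refine (abs_sub _ _).trans ?_
  rw [abs_mul, abs_mul (αφ * L), abs_neg]
  gcongr
  · exact abs_integral_mul_le_of_bound hm (fun x hx => hBf _ _ ((h2 n).abs_le x hx)
      ((h3 n).abs_le x hx)) (hψ.integrable hb)
  · exact (hKb _ _ _ (h.pos n) hn (h.kernel n) (h2 n)).1

lemma exists_deriv_c (h : IsRegularSequence T Ω f L M αφ αc φ₀ c₀ δ J φ c D)
    {ψ : Space d → ℝ} (hψ : IsSpaceTest Ω ψ) : ∃ (b : ℕ → ℝ → ℝ) (K : ℝ),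
      (∀ n, AEStronglyMeasurable (b n) (timeMeas T)) ∧
      (∀ᶠ n in atTop, ∀ᵐ t ∂(timeMeas T), |b n t| ≤ K) ∧
      (∀ n η, IsTimeTest T η →
        - (∫ t in Ioo 0 T, deriv η t * ∫ x in Ω, c n t x * ψ x) - η 0 * ∫ x in Ω, c₀ x * ψ x
          = ∫ t in Ioo 0 T, η t * b n t) ∧
      ∀ n, ∀ᵐ t ∂(timeMeas T),
        b n t = - M * nlForm (J n) Ω (fun x => dC f (φ n t x) (c n t x)) ψ
          - αc * M * ∫ x in Ω, nlOp (J n) Ω (c n t) x * nlOp (J n) Ω ψ x := by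
  have hm := h.domain.isOpen.measurableSet
  have hb := h.domain.isBounded
  have hV : ∀ n, MemV (J n) Ω ψ := fun n => hψ.memV (h.kernel n) hm hb
  choose ξ hξ hξe using fun n => (h.solution n).cahnHilliard
  obtain ⟨r, hr, K, hK, hKb⟩ := hψ.exists_uniform_bound h.domain.isOpen hb h.bound_nonneg
  refine ⟨fun n t => ξ n t ψ, |M| * K + |αc * M| * K,
    fun n => (hξ n).1.measurable ψ (hV n), ?_, fun n η hη => (hξ n).2 ψ (hV n) η hη,
    fun n => (hξe n).mono fun t ht => ht ψ (hV n)⟩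
  filter_upwards [h.tendsto_zero.eventually (ge_mem_nhds hr)] with n hn
  filter_upwards [hξe n, h.bound_dC, h.bound_c] with t h1 h2 h3
  rw [h1 ψ (hV n)]
  refine (abs_sub _ _).trans ?_
  rw [abs_mul, abs_mul (αc * M), abs_neg]
  gcongr
  · exact (hKb _ _ _ (h.pos n) hn (h.kernel n) (h2 n)).1
  · exact (hKb _ _ _ (h.pos n) hn (h.kernel n) (h3 n)).2

/-- Weak limits are limits almost everywhere, and the gradients converge as well. -/
lemma exists_gradient_limits (h : IsRegularSequence T Ω f L M αφ αc φ₀ c₀ δ J φ c D) (hT : 0 < T)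
    (hφ : TendstoWeakly T Ω φ φ') (hc : TendstoWeakly T Ω c c') :
    ∃ Gφ Gg : ℝ → Space d → Space d,
      (∀ᵐ q ∂(spaceTimeMeas T Ω), Tendsto (fun n => φ n q.1 q.2) atTop (𝓝 (φ' q.1 q.2))) ∧
      (∀ᵐ q ∂(spaceTimeMeas T Ω), Tendsto (fun n => c n q.1 q.2) atTop (𝓝 (c' q.1 q.2))) ∧
      (∀ᵐ q ∂(spaceTimeMeas T Ω),
        Tendsto (fun n => gradient (φ n q.1) q.2) atTop (𝓝 (Gφ q.1 q.2))) ∧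
      ∀ᵐ q ∂(spaceTimeMeas T Ω), Tendsto
        (fun n => gradient (fun x => dC f (φ n q.1 x) (c n q.1 x)) q.2) atTop (𝓝 (Gg q.1 q.2)) := by
  have hΩ := h.domain.isOpen
  have hb := h.domain.isBounded
  have hm := hΩ.measurableSet
  have hφw := ae_forall_exists_tendsto hT hΩ hb hφ h.bound_phi fun ψ hψ => by
    obtain ⟨b, K, h1, h2, h3, -⟩ := h.exists_deriv_phi hψ
    exact ⟨b, K, h1, h2, h3⟩
  have hcw := ae_forall_exists_tendsto hT hΩ hb hc h.bound_c fun ψ hψ => by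
    obtain ⟨b, K, h1, h2, h3, -⟩ := h.exists_deriv_c hψ
    exact ⟨b, K, h1, h2, h3⟩
  obtain ⟨vφ, Gφ, hvφ, hGφ⟩ := exists_spaceTime_limit hΩ (fun n => (hφ.2.1 n).1) h.bound_phi hφw
  obtain ⟨vc, -, hvc, -⟩ := exists_spaceTime_limit hΩ (fun n => (hc.2.1 n).1) h.bound_c hcw
  have hφ' := ae_tendsto_of_tendstoWeakly hb hφ
    ((ae_bound_of_hasC11Bound hm h.bound_phi).mono fun q hq n => (hq n).1) hvφ
  have hc' := ae_tendsto_of_tendstoWeakly hb hc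
    ((ae_bound_of_hasC11Bound hm h.bound_c).mono fun q hq n => (hq n).1) hvc
  have hgw : ∀ᵐ t ∂(timeMeas T), ∀ ψ, IsSpaceTest Ω ψ →
      ∃ l, Tendsto (fun n => ∫ x in Ω, dC f (φ n t x) (c n t x) * ψ x) atTop (𝓝 l) := by
    filter_upwards [h.bound_dC, Measure.ae_ae_of_ae_prod hφ', Measure.ae_ae_of_ae_prod hc']
      with t h1 h2 h3 ψ hψ
    obtain ⟨B, -, hB⟩ := hψ.exists_hasC11Bound
    refine ⟨_, tendsto_integral_mul_of_bound hΩ hb (u := fun n x => dC f (φ n t x) (c n t x))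
      (u' := fun x => dC f (φ' t x) (c' t x)) h1 ?_ (w := fun _ => ψ) (w' := ψ) (B := B)
      (fun _ => (hψ.memLp hb).1)
      (Eventually.of_forall fun _ x => (hB univ).abs_le x (mem_univ x))
      (fun x _ => tendsto_const_nhds)⟩
    filter_upwards [h2, h3] with x a1 a2
    exact (h.freeEnergy.continuous_dC.tendsto (φ' t x, c' t x)).comp (a1.prodMk_nhds a2)
  obtain ⟨-, Gg, -, hGg⟩ := exists_spaceTime_limit hΩ
    (u := fun n t x => dC f (φ n t x) (c n t x))
    (fun n => h.freeEnergy.continuous_dC.comp_aestronglyMeasurable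
      ((hφ.2.1 n).1.prodMk (hc.2.1 n).1)) h.bound_dC hgw
  exact ⟨Gφ, Gg, hφ', hc', hGφ, hGg⟩

lemma tendsto_dC (h : IsRegularSequence T Ω f L M αφ αc φ₀ c₀ δ J φ c D)
    (hφ : ∀ᵐ q ∂(spaceTimeMeas T Ω), Tendsto (fun n => φ n q.1 q.2) atTop (𝓝 (φ' q.1 q.2)))
    (hc : ∀ᵐ q ∂(spaceTimeMeas T Ω), Tendsto (fun n => c n q.1 q.2) atTop (𝓝 (c' q.1 q.2))) :
    ∀ᵐ q ∂(spaceTimeMeas T Ω), Tendsto (fun n => dC f (φ n q.1 q.2) (c n q.1 q.2)) atTop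
      (𝓝 (dC f (φ' q.1 q.2) (c' q.1 q.2))) := by
  filter_upwards [hφ, hc] with q a1 a2
  exact (h.freeEnergy.continuous_dC.tendsto (φ' q.1 q.2, c' q.1 q.2)).comp (a1.prodMk_nhds a2)

theorem allenCahn_limit (h : IsRegularSequence T Ω f L M αφ αc φ₀ c₀ δ J φ c D)
    (hφ₀ : MemLp φ₀ 2 (spaceMeas Ω))
    (hφ : TendstoWeakly T Ω φ φ') (hc : TendstoWeakly T Ω c c') {G : ℝ → Space d → Space d}
    (hφl : ∀ᵐ q ∂(spaceTimeMeas T Ω), Tendsto (fun n => φ n q.1 q.2) atTop (𝓝 (φ' q.1 q.2)))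
    (hcl : ∀ᵐ q ∂(spaceTimeMeas T Ω), Tendsto (fun n => c n q.1 q.2) atTop (𝓝 (c' q.1 q.2)))
    (hG : HasSpaceGrad T Ω φ' G) (hGD : ∀ᵐ q ∂(spaceTimeMeas T Ω), ‖G q.1 q.2‖ ≤ D)
    (hop : ∀ᵐ t ∂(timeMeas T), ∀ v : H10 Ω, Tendsto
      (fun n => ∫ x in Ω, nlOp (J n) Ω (φ n t) x * fn v x) atTop (𝓝 (-lapPairing (G t) v))) :
    MemLp (Function.uncurry fun t x => dPhi f (φ' t x) (c' t x)) 2 (spaceTimeMeas T Ω) ∧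
    ∃ ξ : ℝ → HNeg Ω, MemLp ξ 2 (timeMeas T) ∧
      (∀ v : H10 Ω, ∀ η, IsTimeTest T η →
        - (∫ t in Ioo 0 T, deriv η t * ∫ x in Ω, φ' t x * fn v x)
          - η 0 * ∫ x in Ω, φ₀ x * fn v x
        = ∫ t in Ioo 0 T, η t * ξ t v) ∧
      ∀ᵐ t ∂(timeMeas T), ∀ v : H10 Ω, ξ t v
        = - L * ((∫ x in Ω, dPhi f (φ' t x) (c' t x) * fn v x) - αφ * lapPairing (G t) v) := by
  have hΩ := h.domain.isOpen
  have hb := h.domain.isBounded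
  have hm := hΩ.measurableSet
  have := isFiniteMeasure_spaceMeas hb
  obtain ⟨B, hB, hBf⟩ := h.freeEnergy.exists_abs_dPhi_le D
  have hφb : ∀ᵐ q ∂(spaceTimeMeas T Ω), |φ' q.1 q.2| ≤ D := by
    filter_upwards [hφl, ae_bound_of_hasC11Bound hm h.bound_phi] with q h1 h2
    exact le_of_tendsto h1.abs (Eventually.of_forall fun n => (h2 n).1)
  have hcb : ∀ᵐ q ∂(spaceTimeMeas T Ω), |c' q.1 q.2| ≤ D := by
    filter_upwards [hcl, ae_bound_of_hasC11Bound hm h.bound_c] with q h1 h2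
    exact le_of_tendsto h1.abs (Eventually.of_forall fun n => (h2 n).1)
  have hdm : AEStronglyMeasurable (Function.uncurry fun t x => dPhi f (φ' t x) (c' t x))
      (spaceTimeMeas T Ω) :=
    h.freeEnergy.continuous_dPhi.comp_aestronglyMeasurable (hφ.1.1.prodMk hc.1.1)
  have hdb : ∀ᵐ q ∂(spaceTimeMeas T Ω), |dPhi f (φ' q.1 q.2) (c' q.1 q.2)| ≤ B := by
    filter_upwards [hφb, hcb] with q h1 h2 using hBf _ _ h1 h2
  refine ⟨MemLp.of_bound hdm B hdb, ?_⟩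
  obtain ⟨ξ, hξL, hξ⟩ := exists_dual_representation (T := T) (Ω := Ω) hb
    (a := fun t x => -L * dPhi f (φ' t x) (c' t x)) (P := fun t x => (-(αφ * L)) • G t x)
    (K := |L| * B + |αφ * L| * D) (hdm.const_mul (-L)) (hG.2.1.1.const_smul (-(αφ * L)))
    (by
      filter_upwards [Measure.ae_ae_of_ae_prod hdb] with t ht
      filter_upwards [ht] with x hx
      rw [abs_mul, abs_neg]
      have h1 := mul_le_mul_of_nonneg_left hx (abs_nonneg L)
      have h2 := mul_nonneg (abs_nonneg (αφ * L)) h.bound_nonneg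
      linarith)
    (by
      filter_upwards [Measure.ae_ae_of_ae_prod hGD] with t ht
      filter_upwards [ht] with x hx
      rw [norm_smul, norm_neg, Real.norm_eq_abs]
      have h1 := mul_le_mul_of_nonneg_left hx (abs_nonneg (αφ * L))
      have h2 := mul_nonneg (abs_nonneg L) hB
      linarith)
  have hξe : ∀ᵐ t ∂(timeMeas T), ∀ v : H10 Ω, ξ t v
      = - L * ((∫ x in Ω, dPhi f (φ' t x) (c' t x) * fn v x) - αφ * lapPairing (G t) v) := by
    filter_upwards [hξ] with t ht v
    rw [ht v, lapPairing]
    simp only [real_inner_smul_left, mul_assoc (-L), integral_const_mul]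
    ring
  obtain ⟨Φ, hΦL, hΦ⟩ := exists_dual_representation (T := T) (Ω := Ω) hb
    (a := φ') (P := fun _ _ => 0) (K := D) hφ.1.1 aestronglyMeasurable_const
    (Measure.ae_ae_of_ae_prod hφb)
    (Eventually.of_forall fun t => Eventually.of_forall fun x => by
      rw [norm_zero]; exact h.bound_nonneg)
  have hΦe : ∀ᵐ t ∂(timeMeas T), ∀ v : H10 Ω, Φ t v = ∫ x in Ω, φ' t x * fn v x := by
    filter_upwards [hΦ] with t ht v
    rw [ht v]
    simp
  refine ⟨ξ, hξL, fun v η hη => ?_, hξe⟩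
  have hz : MemLp (fun _ : Space d => (0 : Space d)) 2 (spaceMeas Ω) := MemLp.zero'
  have hinit : ∀ v : H10 Ω, ∫ x in Ω, φ₀ x * fn v x = dualPair hφ₀ hz v := fun v => by
    rw [dualPair_apply]
    simp
  have hΦint : ∀ v : H10 Ω, ∫ t in Ioo 0 T, deriv η t * ∫ x in Ω, φ' t x * fn v x
      = ∫ t in Ioo 0 T, deriv η t * Φ t v := fun v => by
    refine integral_congr_ae ?_
    filter_upwards [hΦe] with t ht
    rw [ht v]
  refine H10.induction_on (P := fun v =>
    - (∫ t in Ioo 0 T, deriv η t * ∫ x in Ω, φ' t x * fn v x) - η 0 * ∫ x in Ω, φ₀ x * fn v x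
      = ∫ t in Ioo 0 T, η t * ξ t v) v ?_ ?_
  · simp_rw [hinit, hΦint]
    exact isClosed_eq
      ((continuous_integral_mul_dual (E := H10 Ω) hΦL (hη.1.continuous_deriv (by simp))
        hη.2.1.deriv).neg.sub ((dualPair hφ₀ hz).continuous.const_mul _))
      (continuous_integral_mul_dual (E := H10 Ω) hξL hη.1.continuous hη.2.1)
  · rintro v ψ ⟨hψ, hv, -⟩
    have hfn : ∀ a : Space d → ℝ, ∫ x in Ω, a x * fn v x = ∫ x in Ω, a x * ψ x := fun a => by
      refine integral_congr_ae ?_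
      filter_upwards [hv] with x hx
      rw [hx]
    obtain ⟨E, -, hE⟩ := hψ.exists_hasC11Bound
    obtain ⟨b, K, hbm, hbK, hbη, hbe⟩ := h.exists_deriv_phi hψ
    simp_rw [hfn]
    refine weak_deriv_of_tendsto (K := max K (D * ∫ x in Ω, |ψ x|))
      (a := fun n t => ∫ x in Ω, φ n t x * ψ x) (b := b)
      (fun n => aestronglyMeasurable_integral_mul (hφ.2.1 n).1 (hψ.memLp hb).1) hbm
      (Eventually.of_forall fun n => ?_)
      (hbK.mono fun n hn => hn.mono fun t ht => ht.trans (le_max_left _ _)) ?_ ?_ hη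
      (fun n => hbη n η hη)
    · filter_upwards [h.bound_phi] with t ht
      exact (abs_integral_mul_le_of_bound hm (ht n).abs_le (hψ.integrable hb)).trans
        (le_max_right _ _)
    · filter_upwards [h.bound_phi, Measure.ae_ae_of_ae_prod hφl] with t h1 h2
      exact tendsto_integral_mul_of_bound hΩ hb h1 h2 (w := fun _ => ψ) (B := E)
        (fun _ => (hψ.memLp hb).1)
        (Eventually.of_forall fun _ x => (hE univ).abs_le x (mem_univ x))
        (fun x _ => tendsto_const_nhds)
    · filter_upwards [ae_all_iff.2 hbe, hξe, hop, h.bound_phi, h.bound_c,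
        Measure.ae_ae_of_ae_prod hφl, Measure.ae_ae_of_ae_prod hcl] with t a1 a2 a3 a4 a5 a6 a7
      have l1 : Tendsto (fun n => ∫ x in Ω, dPhi f (φ n t x) (c n t x) * ψ x) atTop
          (𝓝 (∫ x in Ω, dPhi f (φ' t x) (c' t x) * ψ x)) := by
        refine tendsto_integral_of_dominated_convergence (fun x => B * |ψ x|) (fun n => ?_)
          ((hψ.integrable hb).abs.const_mul B) (fun n => ?_) ?_
        · exact (h.freeEnergy.continuous_dPhi.comp_aestronglyMeasurable
            (((a4 n).aestronglyMeasurable hΩ).prodMk ((a5 n).aestronglyMeasurable hΩ))).mul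
            (hψ.memLp hb).1
        · filter_upwards [ae_restrict_mem hm] with x hx
          rw [Real.norm_eq_abs, abs_mul]
          exact mul_le_mul_of_nonneg_right (hBf _ _ ((a4 n).abs_le x hx) ((a5 n).abs_le x hx))
            (abs_nonneg _)
        · filter_upwards [a6, a7] with x b1 b2
          exact ((h.freeEnergy.continuous_dPhi.tendsto (φ' t x, c' t x)).comp
            (b1.prodMk_nhds b2)).mul_const _
      have l2 := a3 v
      simp_rw [hfn] at l2
      rw [a2 v, hfn]
      have l3 := (l1.const_mul (-L)).sub (l2.const_mul (αφ * L))
      have e : -L * (∫ x in Ω, dPhi f (φ' t x) (c' t x) * ψ x) - αφ * L * -lapPairing (G t) v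
          = -L * ((∫ x in Ω, dPhi f (φ' t x) (c' t x) * ψ x) - αφ * lapPairing (G t) v) := by
        ring
      rw [e] at l3
      refine l3.congr fun n => ?_
      rw [a1 n, nlForm_eq_integral_nlOp_mul (h.kernel n) hm ((a4 n).aestronglyMeasurable hΩ)
        (a4 n).abs_le (hψ.integrable hb)]

theorem cahnHilliard_limit (h : IsRegularSequence T Ω f L M αφ αc φ₀ c₀ δ J φ c D)
    (hc : TendstoWeakly T Ω c c') {G : ℝ → Space d → Space d}
    (hcl : ∀ᵐ q ∂(spaceTimeMeas T Ω), Tendsto (fun n => c n q.1 q.2) atTop (𝓝 (c' q.1 q.2)))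
    (hG : AEStronglyMeasurable (Function.uncurry G) (spaceTimeMeas T Ω))
    (hGD : ∀ᵐ q ∂(spaceTimeMeas T Ω), ‖G q.1 q.2‖ ≤ D)
    (hop : ∀ᵐ t ∂(timeMeas T), ∀ v : H10 Ω, Tendsto
      (fun n => ∫ x in Ω, nlOp (J n) Ω (fun x => dC f (φ n t x) (c n t x)) x * fn v x) atTop
        (𝓝 (-lapPairing (G t) v))) :
    ∃ (w : ℝ → Space d → ℝ) (ζ : ℝ → HNeg Ω),
      MemLp (Function.uncurry w) 2 (spaceTimeMeas T Ω) ∧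
      (∀ᵐ t ∂(timeMeas T), HasWeakLaplacian Ω (c' t) (w t)) ∧
      MemLp ζ 2 (timeMeas T) ∧
      (∀ ψ, IsSpaceTest Ω ψ → ∀ v : H10 Ω, fn v =ᵐ[spaceMeas Ω] ψ → ∀ η, IsTimeTest T η →
        - (∫ t in Ioo 0 T, deriv η t * ∫ x in Ω, c' t x * ψ x)
          - η 0 * (∫ x in Ω, c₀ x * ψ x)
          + M * αc * (∫ t in Ioo 0 T, η t * ∫ x in Ω, w t x * Laplacian.laplacian ψ x)
        = ∫ t in Ioo 0 T, η t * ζ t v) ∧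
      ∀ᵐ t ∂(timeMeas T), ∀ v : H10 Ω, ζ t v = M * lapPairing (G t) v := by
  have hΩ := h.domain.isOpen
  have hb := h.domain.isBounded
  have hm := hΩ.measurableSet
  have := isFiniteMeasure_spaceMeas hb
  obtain ⟨w, hwL, hw⟩ := exists_weak_laplacian hΩ hb h.kernel h.pos h.tendsto_zero
    (fun n => (hc.2.1 n).1) h.bound_c h.bound_nonneg hc.1 hcl
  obtain ⟨ζ, hζL, hζ⟩ := exists_dual_representation (T := T) (Ω := Ω) hb
    (a := fun _ _ => 0) (P := fun t x => (-M) • G t x) (K := |M| * D)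
    aestronglyMeasurable_const (hG.const_smul (-M))
    (Eventually.of_forall fun t => Eventually.of_forall fun x => by
      rw [abs_zero]; exact mul_nonneg (abs_nonneg _) h.bound_nonneg)
    (by
      filter_upwards [Measure.ae_ae_of_ae_prod hGD] with t ht
      filter_upwards [ht] with x hx
      rw [norm_smul, norm_neg, Real.norm_eq_abs]
      exact mul_le_mul_of_nonneg_left hx (abs_nonneg M))
  have hζe : ∀ᵐ t ∂(timeMeas T), ∀ v : H10 Ω, ζ t v = M * lapPairing (G t) v := by
    filter_upwards [hζ] with t ht v
    rw [ht v, lapPairing]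
    simp only [real_inner_smul_left, integral_const_mul, zero_mul, integral_zero]
    ring
  refine ⟨w, ζ, hwL, hw, hζL, fun ψ hψ v hv η hη => ?_, hζe⟩
  have hfn : ∀ a : Space d → ℝ, ∫ x in Ω, a x * fn v x = ∫ x in Ω, a x * ψ x := fun a => by
    refine integral_congr_ae ?_
    filter_upwards [hv] with x hx
    rw [hx]
  obtain ⟨E, -, hE⟩ := hψ.exists_hasC11Bound
  obtain ⟨E', -, hE'⟩ := hψ.laplacian.exists_hasC11Bound
  obtain ⟨b, K, hbm, hbK, hbη, hbe⟩ := h.exists_deriv_c hψ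
  have hlim := weak_deriv_of_tendsto (K := max K (D * ∫ x in Ω, |ψ x|))
    (a := fun n t => ∫ x in Ω, c n t x * ψ x) (b := b)
    (a' := fun t => ∫ x in Ω, c' t x * ψ x)
    (b' := fun t => ζ t v - M * αc * ∫ x in Ω, w t x * Laplacian.laplacian ψ x)
    (fun n => aestronglyMeasurable_integral_mul (hc.2.1 n).1 (hψ.memLp hb).1) hbm
    (Eventually.of_forall fun n => by
      filter_upwards [h.bound_c] with t ht
      exact (abs_integral_mul_le_of_bound hm (ht n).abs_le (hψ.integrable hb)).trans
        (le_max_right _ _))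
    (hbK.mono fun n hn => hn.mono fun t ht => ht.trans (le_max_left _ _))
    (by
      filter_upwards [h.bound_c, Measure.ae_ae_of_ae_prod hcl] with t h1 h2
      exact tendsto_integral_mul_of_bound hΩ hb h1 h2 (w := fun _ => ψ) (B := E)
        (fun _ => (hψ.memLp hb).1)
        (Eventually.of_forall fun _ x => (hE univ).abs_le x (mem_univ x))
        (fun x _ => tendsto_const_nhds))
    (by
      filter_upwards [ae_all_iff.2 hbe, hζe, hop, h.bound_dC, h.bound_c,
        Measure.ae_ae_of_ae_prod hcl, hw] with t a1 a2 a3 a4 a5 a6 a7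
      have l1 := tendsto_integral_nlOp_mul_nlOp hΩ hb h.kernel h.pos h.tendsto_zero a5
        h.bound_nonneg a6 hψ
      rw [a7.2.2 _ hψ.laplacian] at l1
      have l2 := a3 v
      simp_rw [hfn] at l2
      rw [a2 v]
      have l3 := (l2.const_mul (-M)).sub (l1.const_mul (αc * M))
      have e : -M * -lapPairing (G t) v - αc * M * ∫ x in Ω, w t x * Laplacian.laplacian ψ x
          = M * lapPairing (G t) v - M * αc * ∫ x in Ω, w t x * Laplacian.laplacian ψ x := by
        ring
      rw [e] at l3
      refine l3.congr fun n => ?_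
      rw [a1 n, nlForm_eq_integral_nlOp_mul (h.kernel n) hm ((a4 n).aestronglyMeasurable hΩ)
        (a4 n).abs_le (hψ.integrable hb)])
    hη (fun n => hbη n η hη)
  obtain ⟨H, hH⟩ := hη.2.1.exists_bound_of_continuous hη.1.continuous
  have hΔm : MemLp (fun q : ℝ × Space d => Laplacian.laplacian ψ q.2) 2 (spaceTimeMeas T Ω) :=
    MemLp.of_bound (hψ.laplacian.1.continuous.comp continuous_snd).aestronglyMeasurable E'
      (Eventually.of_forall fun q => (hE' univ).abs_le _ (mem_univ _))
  have i1 : Integrable (fun t => ∫ x in Ω, w t x * Laplacian.laplacian ψ x) (timeMeas T) :=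
    (integrable_mul_of_memLp hwL hΔm).integral_prod_left
  have i2 : Integrable (fun t => ζ t v) (timeMeas T) := integrable_apply_of_memLp (E := H10 Ω) hζL v
  have j1 := i1.bdd_mul hη.1.continuous.aestronglyMeasurable (Eventually.of_forall hH)
  have j2 := i2.bdd_mul hη.1.continuous.aestronglyMeasurable (Eventually.of_forall hH)
  have e : ∫ t in Ioo 0 T, η t * (ζ t v - M * αc * ∫ x in Ω, w t x * Laplacian.laplacian ψ x)
      = (∫ t in Ioo 0 T, η t * ζ t v)
        - M * αc * ∫ t in Ioo 0 T, η t * ∫ x in Ω, w t x * Laplacian.laplacian ψ x := by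
    rw [← integral_const_mul, ← integral_sub j2 (j1.const_mul _)]
    refine integral_congr_ae (Eventually.of_forall fun t => ?_)
    simp only
    ring
  rw [e] at hlim
  linarith

end IsRegularSequence

end KKS

end

theorem proposition5p2
    (d : ℕ) (hd : 1 ≤ d) (hd' : d ≤ 3)
    (Ω : Set (KKS.Space d)) (hΩ : KKS.IsC3Domain Ω)
    (T : ℝ) (hT : 0 < T)
    (L M αφ αc : ℝ) (hL : 0 < L) (hM : 0 < M) (hαφ : 0 < αφ) (hαc : 0 ≤ αc)
    (f : ℝ → ℝ → ℝ) (hf : KKS.IsFreeEnergy f)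
    (φ₀ c₀ : KKS.Space d → ℝ)
    (hφ₀ : MemLp φ₀ 2 (KKS.spaceMeas Ω)) (hc₀ : MemLp c₀ 2 (KKS.spaceMeas Ω))
    (δ₀ : ℝ) (hδ₀ : 0 < δ₀)
    (J : ℝ → KKS.Space d → ℝ) (hJ : ∀ δ ∈ Ioo 0 δ₀, KKS.IsKernel δ (J δ))
    (φ c : ℝ → ℝ → KKS.Space d → ℝ)
    (hsol : ∀ δ ∈ Ioo 0 δ₀,
      KKS.IsNonlocalSolution T Ω f L M αφ αc (J δ) φ₀ c₀ (φ δ) (c δ))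
    (C : ℝ)
    (hreg : ∀ δ ∈ Ioo 0 δ₀, ∀ᵐ t ∂(KKS.timeMeas T),
      KKS.IsC3Closure Ω (φ δ t) ∧ KKS.C3BoundedBy Ω (φ δ t) C ∧
      KKS.IsC3Closure Ω (fun x => KKS.dC f (φ δ t x) (c δ t x)) ∧
      KKS.C3BoundedBy Ω (fun x => KKS.dC f (φ δ t x) (c δ t x)) C)
    (δ : ℕ → ℝ) (hδ : ∀ n, δ n ∈ Ioo 0 δ₀) (hδlim : Tendsto δ atTop (𝓝 0))
    (φ' c' : ℝ → KKS.Space d → ℝ)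
    (hφ' : KKS.TendstoWeakly T Ω (fun n => φ (δ n)) φ')
    (hc' : KKS.TendstoWeakly T Ω (fun n => c (δ n)) c') :
    (∃ Gφ : ℝ → KKS.Space d → KKS.Space d, KKS.HasSpaceGrad T Ω φ' Gφ ∧
      KKS.TendstoL2HNeg T Ω
        (fun n t v => ∫ x in Ω, KKS.phaseOp αφ (J (δ n)) Ω (φ (δ n) t) x * KKS.fn v x)
        (fun t v => - αφ * KKS.lapPairing (Gφ t) v)) ∧
    (∃ Gg : ℝ → KKS.Space d → KKS.Space d,
      KKS.HasSpaceGrad T Ω (fun t x => KKS.dC f (φ' t x) (c' t x)) Gg ∧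
      KKS.TendstoL2HNeg T Ω
        (fun n t v => KKS.nlForm (J (δ n)) Ω
          (fun x => KKS.dC f (φ (δ n) t x) (c (δ n) t x)) (KKS.fn v))
        (fun t v => - KKS.lapPairing (Gg t) v)) ∧
    KKS.IsLocalSolution T Ω f L M αφ αc φ₀ c₀ φ' c' := by
  have hne : Ω.Nonempty := hΩ.isConnected.nonempty
  have hm := hΩ.isOpen.measurableSet
  have := KKS.isFiniteMeasure_spaceMeas hΩ.isBounded
  have hT0 : (KKS.timeMeas T) ≠ 0 := by
    rw [Ne, Measure.restrict_eq_zero, Real.volume_Ioo, sub_zero]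
    simpa using hT
  have : (ae (KKS.timeMeas T)).NeBot := ae_neBot.2 hT0
  have hall := ae_all_iff.2 fun n => hreg (δ n) (hδ n)
  have hC : 0 ≤ C := by
    obtain ⟨t, ht⟩ := hall.exists
    exact (KKS.hasC11Bound_of_C3 hΩ.isOpen (ht 0).1 (ht 0).2.1).nonneg hne
  obtain ⟨D, hCD, hD⟩ := hf.exists_hasC11Bound (d := d) (Ω := Ω) hC
  have h : KKS.IsRegularSequence T Ω f L M αφ αc φ₀ c₀ δ (fun n => J (δ n))
      (fun n => φ (δ n)) (fun n => c (δ n)) D :=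
    { domain := hΩ
      freeEnergy := hf
      kernel := fun n => hJ _ (hδ n)
      pos := fun n => (hδ n).1
      tendsto_zero := hδlim
      solution := fun n => hsol _ (hδ n)
      bound_nonneg := hC.trans hCD
      bound_phi := hall.mono fun t ht n =>
        (KKS.hasC11Bound_of_C3 hΩ.isOpen (ht n).1 (ht n).2.1).mono hCD
      bound_c := hall.mono fun t ht n =>
        hD _ _ (KKS.hasC11Bound_of_C3 hΩ.isOpen (ht n).1 (ht n).2.1)
          (KKS.hasC11Bound_of_C3 hΩ.isOpen (ht n).2.2.1 (ht n).2.2.2)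
      bound_dC := hall.mono fun t ht n =>
        (KKS.hasC11Bound_of_C3 hΩ.isOpen (ht n).2.2.1 (ht n).2.2.2).mono hCD }
  obtain ⟨Gφ, Gg, hφl, hcl, hGφ, hGg⟩ := h.exists_gradient_limits hT hφ' hc'
  have hgm : ∀ n, AEStronglyMeasurable
      (Function.uncurry fun t x => KKS.dC f (φ (δ n) t x) (c (δ n) t x))
      (KKS.spaceTimeMeas T Ω) := fun n =>
    hf.continuous_dC.comp_aestronglyMeasurable ((hφ'.2.1 n).1.prodMk (hc'.2.1 n).1)
  obtain ⟨pφ, bφ, cφ, wφ⟩ := KKS.tendstoL2HNeg_nlOp hΩ h.kernel h.pos hδlim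
    (fun n => (hφ'.2.1 n).1) h.bound_phi h.bound_nonneg hφl hGφ
  obtain ⟨pg, bg, cg, wg⟩ := KKS.tendstoL2HNeg_nlOp hΩ h.kernel h.pos hδlim
    (u := fun n t x => KKS.dC f (φ (δ n) t x) (c (δ n) t x))
    (u' := fun t x => KKS.dC f (φ' t x) (c' t x))
    hgm h.bound_dC h.bound_nonneg (h.tendsto_dC hφl hcl) hGg
  refine ⟨⟨Gφ, pφ, (cφ.const_mul αφ).congr (fun n => Eventually.of_forall fun t v => ?_)
    fun t v => by ring⟩, ⟨Gg, pg, cg.congr (fun n => ?_) fun t v => rfl⟩, ?_⟩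
  · simp only [KKS.phaseOp, mul_assoc]
    rw [integral_const_mul]
  · filter_upwards [h.bound_dC] with t ht v
    exact (KKS.nlForm_eq_integral_nlOp_mul (h.kernel n) hm ((ht n).aestronglyMeasurable hΩ.isOpen)
      (ht n).abs_le ((KKS.memLp_fn v).integrable (by norm_num))).symm
  · obtain ⟨hdL, ξ, hξ⟩ := h.allenCahn_limit hφ₀ hφ' hc' hφl hcl pφ bφ wφ
    obtain ⟨w, ζ, hw, hwl, hζ⟩ := h.cahnHilliard_limit hc' hcl pg.2.1.1 bg wg
    exact ⟨⟨hdL, Gφ, ξ, pφ, hξ⟩, ⟨Gg, w, ζ, pg, hc'.1, hw, hwl, hζ⟩⟩
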